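/- Let $c>0$ and let $q:\mathbb R\to\mathbb R$ be continuous with $q(x)\to0$ as $x\to+\infty$, $q(x)\to-c^2$ as $x\to-\infty$, and $\int_0^\infty e^{(c+\eta)x}\left(|q(x)|+|q(-x)+c^2|\right)dx<\infty$ for some $\eta>0$. **Scattering data.** For $k=\mathrm i s$, $0<s<c$, put $k_1=\sqrt{c^2-s^2}$ and let $\phi,\phi_1$ be the solutions of $-\psi''+q\psi=k^2\psi$ with $e^{-\mathrm ikx}\phi\to1$ ($x\to+\infty$) and $e^{\mathrm ik_1x}\phi_1\to1$ ($x\to-\infty$). Let $W=\phi_1\phi'-\phi_1'\phi$, $W_1=\overline{\phi_1}\phi'-\overline{\phi_1}'\phi$ and $\chi(k)=4kk_1/(WW_1)$ (the limit from the right side of $[0,\mathrm ic]$). **The functions $a$, $B$, $\Delta$, $\Lambda$.** For $-\frac{c^2}{2}<\xi<\frac{c^2}{3}$ let $a=a(\xi)\in(0,c)$ be defined by $$\int_0^a\Big(\xi+\tfrac{c^2-a^2}{2}-s^2\Big)\sqrt{\tfrac{a^2-s^2}{c^2-s^2}}\,ds=0,$$ and put $$B(\xi)=24\int_a^c\Big(s^2-\xi-\tfrac{c^2-a^2}{2}\Big)\sqrt{\tfrac{s^2-a^2}{c^2-s^2}}\,ds,\qquad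 \Delta(\xi)=\frac{2\int_a^c\log|\chi(\mathrm is)|\,\big((c^2-s^2)(s^2-a^2)\big)^{-1/2}ds}{\int_{-a}^a\big((c^2-s^2)(a^2-s^2)\big)^{-1/2}ds}.$$ For $x\in\mathbb R$, $t>0$, put $\xi=\frac{x}{12t}$ and $\Lambda=tB(\xi)+\Delta(\xi)$. **The matrix model solution.** Let $w(k)=\sqrt{(k^2+c^2)(k^2+a^2)}$ be holomorphic off $[\mathrm ia,\mathrm ic]\cup[-\mathrm ic,-\mathrm ia]$ with $w(0)>0$, let $w_+$ be its limit on $[\mathrm ia,\mathrm ic]$ from the right, and let $$\Gamma=\Big(2\int_{\mathrm ia}^{-\mathrm ia}\frac{dz}{w(z)}\Big)^{-1},\qquad \tau=2\Gamma\int_{\mathrm ia}^{\mathrm ic}\frac{dz}{w_+(z)}\in\mathrm i\mathbb R_+,\qquad A(k)=\Gamma\int_{\mathrm ic}^k\frac{dz}{w(z)},$$ the last integral along a path off $[-\mathrm ic,\mathrm ic]$. Let $\theta_3(z)=\sum_{n\in\mathbb Z}e^{\pi\mathrm i(n^2\tau+2nz)}$, let $\varrho(k)=\sqrt[4]{\frac{k^2+a^2}{k^2+c^2}}\sqrt{\frac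 ca}$ with $\varrho(0)=1$ (holomorphic off the same two cuts), and $$\mu(k)=\frac{\theta_3(A(k)-\frac14-\frac{\Lambda}{2\pi})}{\theta_3(A(k)-\frac14)},\qquad \nu(k)=\frac{\theta_3(-A(k)-\frac14-\frac{\Lambda}{2\pi})}{\theta_3(-A(k)-\frac14)}.$$ For $k\in\mathbb C\setminus[-\mathrm ic,\mathrm ic]$ define $$M^{\mathrm{mod}}(k)=\begin{pmatrix}(\varrho(k)+\varrho(k)^{-1})\mu(k)&(\varrho(k)-\varrho(k)^{-1})\nu(k)\\(\varrho(k)-\varrho(k)^{-1})\nu(-k)&(\varrho(k)+\varrho(k)^{-1})\mu(-k)\end{pmatrix}.$$ **The domain $\mathcal D_\varepsilon$.** On the elliptic curve of $R(z)=\sqrt{z(z+a^2)(z+c^2)}$, with cuts $[-c^2,-a^2]\cup[0,\infty)$, and upper sheet fixed by $R(z)=\sqrt z\,w(\sqrt z)$, $\operatorname{Im}\sqrt z>0$, let $d\hat\omega$ be the holomorphic differential with $\oint_{\hat{\mathbf a}}d\hat\omega=2\pi\mathrm i$, where $\hat{\mathbf a}$ runs through the gap $[-a^2,0]$ in the positive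 direction on the lower sheet and returns on the upper sheet. Let $\mathrm iV$ and $\mathrm iW$ be the integrals over the counterclockwise loop around $[-c^2,-a^2]$ on the upper sheet of the differentials $$d\Omega_1=\frac{\mathrm i}{2}\,\frac{z+h_1}{R(z)}\,dz,\qquad d\Omega_3=-\frac{3\mathrm i}{2}\,\frac{z^2+\frac{a^2+c^2}{2}z+h_3}{R(z)}\,dz,$$ with the constants $h_1,h_3$ for which $\oint_{\hat{\mathbf a}}d\Omega_1=\oint_{\hat{\mathbf a}}d\Omega_3=0$. Let $p_0$ and $p(x,t)=(\lambda(x,t,\xi),\pm)$ be the points over $[-a^2,0]$ with $$\int_{-a^2}^{p_0}d\hat\omega=-\mathrm i\Delta,\qquad \int_{p_0}^{p(x,t)}d\hat\omega=-\mathrm i(Vx-4Wt)\pmod{2\pi\mathrm i}.$$ For $0<\varepsilon<\frac{5c^2}{12}$ and $0<\gamma<\frac12$ let $\mathcal I_\varepsilon=[-\frac{c^2}{2}+\varepsilon,\frac{c^2}{3}-\varepsilon]$ and $$\mathcal D_\varepsilon=\Big\{(x,t):\ t>0,\ \xi=\tfrac{x}{12t}\in\mathcal I_\varepsilon,\ \lambda(x,t,\xi)<-\tfrac1{t^\gamma}\Big\}.$$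 **Claim.** For all $c>0$ and $0<\varepsilon<\frac{5c^2}{12}$ there is a constant $C>0$, depending only on $c$ and $\varepsilon$ (not on $q$, $\gamma$, $\xi$, $x$, $t$, $k$), such that for all $\gamma\in(0,\frac12)$, all $q$ as above, all $(x,t)\in\mathcal D_\varepsilon$ and all $k\in\mathbb C\setminus[-\mathrm ic,\mathrm ic]$, $$\big|\det M^{\mathrm{mod}}(k)\big|\ \ge\ \frac{C}{a^2\!\left(-\frac{c^2}{2}+\varepsilon\right)t^{\gamma}}.$$ -/

import Mathlib

open Complex Filter Topology Set MeasureTheory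

namespace KdVShock

/-! ### The steplike potential and its scattering data -/

/-- Steplike initial data: `q(x) → 0` as `x → +∞`, `q(x) → -c²` as `x → -∞`, with exponential
rate `c + η` for some `η > 0`. -/
structure IsSteplike (c : ℝ) (q : ℝ → ℝ) : Prop where
  continuous : Continuous q
  tendsto_right : Tendsto q atTop (𝓝 0)
  tendsto_left : Tendsto q atBot (𝓝 (-c ^ 2))
  decay : ∃ η : ℝ, 0 < η ∧
    IntegrableOn (fun x => Real.exp ((c + η) * x) * (|q x| + |q (-x) + c ^ 2|)) (Ioi 0)

/-- `ψ` is a classical solution of `-ψ'' + q ψ = k² ψ`. -/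
def IsSolution (q : ℝ → ℝ) (k : ℂ) (ψ : ℝ → ℂ) : Prop :=
  Differentiable ℝ ψ ∧ ∀ x, HasDerivAt (deriv ψ) (((q x : ℂ) - k ^ 2) * ψ x) x

/-- The right Jost solution: `e^{-ikx} ψ(x) → 1` as `x → +∞`. -/
def IsJostRight (q : ℝ → ℝ) (k : ℂ) (ψ : ℝ → ℂ) : Prop :=
  IsSolution q k ψ ∧ Tendsto (fun x : ℝ => cexp (-I * k * x) * ψ x) atTop (𝓝 1)

/-- The left Jost solution: `e^{i k₁ x} ψ(x) → 1` as `x → -∞`, where `k₁² = k² + c²`. -/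
def IsJostLeft (q : ℝ → ℝ) (k k₁ : ℂ) (ψ : ℝ → ℂ) : Prop :=
  IsSolution q k ψ ∧ Tendsto (fun x : ℝ => cexp (I * k₁ * x) * ψ x) atBot (𝓝 1)

/-- The value of `k₁ = √(k² + c²)` at `k = is`, `0 < s < c`, on the right side of the cut. -/
noncomputable def kOne (c s : ℝ) : ℝ := √(c ^ 2 - s ^ 2)

/-- The right Jost solution `φ(k, ·)` at `k = is`. It exists and is unique for `0 < s`. -/
noncomputable def phi (q : ℝ → ℝ) (s : ℝ) : ℝ → ℂ :=
  Classical.epsilon (IsJostRight q (I * s))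

/-- The left Jost solution `φ₁(k, ·)` at `k = is`, on the right side of the cut `[0, ic]`.
It exists and is unique for `0 < s < c`. -/
noncomputable def phiOne (c : ℝ) (q : ℝ → ℝ) (s : ℝ) : ℝ → ℂ :=
  Classical.epsilon (IsJostLeft q (I * s) (kOne c s))

/-- The Wronskian `f g' - f' g` (constant for two solutions of the same equation, taken at `0`). -/
noncomputable def wronskian (f g : ℝ → ℂ) : ℂ := f 0 * deriv g 0 - deriv f 0 * g 0

/-- The limit `χ₊(k)` at `k = is`, `0 < s < c`, from the right side of the cut of
`χ = 4 k k₁ / (W W₁)`. Here `W` is the Wronskian of `φ₁, φ` and `W₁` that of `conj φ₁, φ`. -/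
noncomputable def chiPlus (c : ℝ) (q : ℝ → ℝ) (s : ℝ) : ℂ :=
  4 * (I * s) * kOne c s /
    (wronskian (phiOne c q s) (phi q s) *
      wronskian (fun x => (starRingEnd ℂ) (phiOne c q s x)) (phi q s))

/-! ### The Whitham function `a(ξ)`, the phase `B(ξ)` and the shift `Δ(ξ)` -/

/-- The equation `∫_0^{ia} (k² + ξ + (c² - a²)/2) [√((k² + a²)/(k² + c²))] dk = 0`, with `k = is`. -/
def WhithamEq (c ξ a : ℝ) : Prop :=
  ∫ s in (0 : ℝ)..a, (ξ + (c ^ 2 - a ^ 2) / 2 - s ^ 2) * √((a ^ 2 - s ^ 2) / (c ^ 2 - s ^ 2)) = 0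

/-- The function `a(ξ) ∈ (0, c)`, `-c²/2 < ξ < c²/3`, given implicitly by `WhithamEq`
(whose solution in `(0, c)` exists and is unique). -/
noncomputable def whitham (c ξ : ℝ) : ℝ :=
  Classical.epsilon fun a : ℝ => 0 < a ∧ a < c ∧ WhithamEq c ξ a

/-- `B = -2 g₊(ia)`, where `g(k) = 12 ∫_{ic}^k (z² + ξ + (c² - a²)/2) √((z² + a²)/(z² + c²)) dz`.
The limit of the square root at `z = is`, `a < s < c`, from the right side of the segment
is `i √((s² - a²)/(c² - s²))`, and `dz = i ds`. -/
noncomputable def phaseB (c a ξ : ℝ) : ℝ :=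
  -2 * (12 * ∫ s in c..a,
    -((ξ + (c ^ 2 - a ^ 2) / 2 - s ^ 2) * √((s ^ 2 - a ^ 2) / (c ^ 2 - s ^ 2))))

/-- `Δ = 2i ∫_{ia}^{ic} (log |χ(z)| / w₊(z)) dz · (∫_{-ia}^{ia} dz / w(z))⁻¹`.
At `z = is` one has `w₊ = i √((c² - s²)(s² - a²))` for `a < s < c`,
and `w = √((c² - s²)(a² - s²))` for `|s| < a`; the factors `i` cancel. -/
noncomputable def shift (c a : ℝ) (q : ℝ → ℝ) : ℝ :=
  2 * (∫ s in a..c, Real.log ‖chiPlus c q s‖ / √((c ^ 2 - s ^ 2) * (s ^ 2 - a ^ 2))) *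
    (∫ s in (-a)..a, 1 / √((c ^ 2 - s ^ 2) * (a ^ 2 - s ^ 2)))⁻¹

/-- `Λ = t B(ξ) + Δ(ξ)` with `ξ = x / (12 t)`. -/
noncomputable def Lam (c : ℝ) (q : ℝ → ℝ) (x t : ℝ) : ℝ :=
  t * phaseB c (whitham c (x / (12 * t))) (x / (12 * t)) + shift c (whitham c (x / (12 * t))) q

/-! ### The matrix model solution -/

/-- `w(k) = √((k² + c²)(k² + a²))`, holomorphic off `[ia, ic] ∪ [-ic, -ia]`, with `w(0) > 0`.
The quotient `(k² + a²)/(k² + c²)` is a nonpositive number only on the two cuts. -/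
noncomputable def w (c a : ℝ) (k : ℂ) : ℂ :=
  (k ^ 2 + (c : ℂ) ^ 2) * ((k ^ 2 + (a : ℂ) ^ 2) / (k ^ 2 + (c : ℂ) ^ 2)) ^ (1 / 2 : ℂ)

/-- The limit of `w` at `is`, `a < s < c`, from the right side of the cut `[ia, ic]`;
the limit from the left side is its negative. -/
noncomputable def wPlus (c a s : ℝ) : ℂ := I * (√((c ^ 2 - s ^ 2) * (s ^ 2 - a ^ 2)) : ℝ)

/-- `Γ = (∮ dz/w)⁻¹` over the cycle that runs from `ia` to `-ia` on the upper sheet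
and returns on the lower one. -/
noncomputable def Gam (c a : ℝ) : ℂ := (2 * ∫ s in a..(-a), I / w c a (I * s))⁻¹

/-- `τ = ∮ Γ dz/w` over the counterclockwise cycle around `[ia, ic]` on the upper sheet:
up the right side and down the left side, which contribute equally. -/
noncomputable def tau (c a : ℝ) : ℂ := 2 * ∫ s in a..c, Gam c a * I / wPlus c a s

/-- The Abel map `A(k) = ∫_{ic}^k Γ dz/w` for `k ∉ [-ic, ic]`. As `w(z)` is holomorphic off
`[-ic, ic]` and `1/w(z) = O(z⁻²)`, the integral does not depend on the path, which may be taken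
from `ic` to `i∞`, and from infinity to `k` along the ray `{r k : r ≥ 1}`. -/
noncomputable def abel (c a : ℝ) (k : ℂ) : ℂ :=
  (∫ s in Ioi c, Gam c a * I / w c a (I * s)) - ∫ r in Ioi (1 : ℝ), Gam c a * k / w c a (r * k)

/-- `γ(k) = ((k² + a²)/(k² + c²))^{1/4} √(c/a)`, `γ(0) = 1`. -/
noncomputable def gam (c a : ℝ) (k : ℂ) : ℂ :=
  ((k ^ 2 + (a : ℂ) ^ 2) / (k ^ 2 + (c : ℂ) ^ 2)) ^ (1 / 4 : ℂ) * (√(c / a) : ℝ)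

/-- `μ(k) = θ₃(A(k) - 1/4 - Λ/2π | τ) / θ₃(A(k) - 1/4 | τ)`. -/
noncomputable def mu (c a Λ : ℝ) (k : ℂ) : ℂ :=
  jacobiTheta₂ (abel c a k - 1 / 4 - Λ / (2 * Real.pi)) (tau c a) /
    jacobiTheta₂ (abel c a k - 1 / 4) (tau c a)

/-- `ν(k) = θ₃(-A(k) - 1/4 - Λ/2π | τ) / θ₃(-A(k) - 1/4 | τ)`. -/
noncomputable def nu (c a Λ : ℝ) (k : ℂ) : ℂ :=
  jacobiTheta₂ (-abel c a k - 1 / 4 - Λ / (2 * Real.pi)) (tau c a) /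
    jacobiTheta₂ (-abel c a k - 1 / 4) (tau c a)

/-- The matrix model solution `M^mod(k)`, `k ∈ ℂ ∖ [-ic, ic]`. -/
noncomputable def Mmod (c a Λ : ℝ) (k : ℂ) : Matrix (Fin 2) (Fin 2) ℂ :=
  !![(gam c a k + (gam c a k)⁻¹) * mu c a Λ k, (gam c a k - (gam c a k)⁻¹) * nu c a Λ k;
     (gam c a k - (gam c a k)⁻¹) * nu c a Λ (-k), (gam c a k + (gam c a k)⁻¹) * mu c a Λ (-k)]

/-! ### The Dirichlet eigenvalue and the domain -/

/-- `∫_{-a²}^0 f(z) dz / √(-z (z + a²)(z + c²))`, an integral over the gap. -/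
noncomputable def gapInt (c a : ℝ) (f : ℝ → ℝ) : ℝ :=
  ∫ z in (-a ^ 2)..0, f z / √(-z * (z + a ^ 2) * (z + c ^ 2))

/-- `∫_{-c²}^{-a²} f(z) dz / √(z (z + a²)(z + c²))`, an integral over the band. With
`R(z) = √(z (z + a²)(z + c²)) ∼ z^{3/2}`, it is half the counterclockwise loop integral of
`f dz / R` around the band on the upper sheet (`Im √z > 0`). -/
noncomputable def bandInt (c a : ℝ) (f : ℝ → ℝ) : ℝ :=
  ∫ z in (-c ^ 2)..(-a ^ 2), f z / √(z * (z + a ^ 2) * (z + c ^ 2))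

/-- `iV` is the period around the band of `dΩ₁ = (i/2) (z + h) dz / R(z)`,
where `h` makes the integral over the gap vanish. -/
noncomputable def waveV (c a : ℝ) : ℝ :=
  bandInt c a fun z => z - gapInt c a (fun y => y) / gapInt c a fun _ => 1

/-- `iW` is the period around the band of
`dΩ₃ = -(3i/2) (z² + ((a² + c²)/2) z + h) dz / R(z)`, where `h` makes the integral over the gap
vanish. The second coefficient makes `dΩ₃ = -(3i/2) √z (1 + O(z⁻²)) dz` at infinity. -/
noncomputable def freqW (c a : ℝ) : ℝ :=
  -3 * bandInt c a fun z => z ^ 2 + (a ^ 2 + c ^ 2) / 2 * z -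
    gapInt c a (fun y => y ^ 2 + (a ^ 2 + c ^ 2) / 2 * y) / gapInt c a fun _ => 1

/-- A point `(z, ±)` over the gap `[-a², 0]` of the elliptic curve of `√(z (z + a²)(z + c²))`;
`sheet = 1` is the upper sheet. -/
structure GapPoint (a : ℝ) where
  proj : ℝ
  sheet : ℤˣ
  mem : proj ∈ Icc (-a ^ 2) 0

/-- `-i ∫_{-a²}^p dω`, along the gap on the sheet of `p`. The holomorphic differential
`dω = const · dz / R(z)` is normalized by `∮ dω = 2πi` over the cycle that runs through the gap in
the positive direction on the lower sheet and returns on the upper one. -/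
noncomputable def gapAbel (c a : ℝ) (p : GapPoint a) : ℝ :=
  -((p.sheet : ℤ) : ℝ) * Real.pi *
    (∫ z in (-a ^ 2)..p.proj, 1 / √(-z * (z + a ^ 2) * (z + c ^ 2))) / gapInt c a fun _ => 1

/-- The initial divisor `p₀`: `∫_{-a²}^{p₀} dω = -iΔ (mod 2πi)`. -/
def IsInitialDivisor (c a Δ : ℝ) (p₀ : GapPoint a) : Prop :=
  ∃ n : ℤ, gapAbel c a p₀ = -Δ + 2 * Real.pi * n

/-- The divisor `p(x,t)`: `∫_{p₀}^{p} dω = -i (V x - 4 W t) (mod 2πi)`. -/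
def IsDivisorAt (c a x t : ℝ) (p₀ p : GapPoint a) : Prop :=
  ∃ n : ℤ, gapAbel c a p - gapAbel c a p₀ = -(waveV c a * x - 4 * freqW c a * t) + 2 * Real.pi * n

/-- `y` is the Dirichlet eigenvalue `λ(x,t,ξ) ∈ [-a(ξ)², 0]` of the one-gap potential with spectrum
`[-c², -a(ξ)²] ∪ [0, ∞)` and initial divisor `p₀(ξ)`; it exists and is unique. -/
def IsDirichletEigenvalue (c : ℝ) (q : ℝ → ℝ) (x t ξ y : ℝ) : Prop :=
  ∃ p₀ p : GapPoint (whitham c ξ),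
    IsInitialDivisor c (whitham c ξ) (shift c (whitham c ξ) q) p₀ ∧
    IsDivisorAt c (whitham c ξ) x t p₀ p ∧ p.proj = y

/-- `I_ε = [-c²/2 + ε, c²/3 - ε]`. -/
def intervalI (c ε : ℝ) : Set ℝ := Icc (-c ^ 2 / 2 + ε) (c ^ 2 / 3 - ε)

/-- `D_ε`: the pairs `(x, t)`, `t > 0`, with `ξ = x/(12t) ∈ I_ε` and `λ(x,t,ξ) < -1/t^γ`. -/
def domainD (c ε γ : ℝ) (q : ℝ → ℝ) : Set (ℝ × ℝ) :=
  {z | 0 < z.2 ∧ z.1 / (12 * z.2) ∈ intervalI c ε ∧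
    ∃ y : ℝ, IsDirichletEigenvalue c q z.1 z.2 (z.1 / (12 * z.2)) y ∧ y < -(1 / z.2 ^ γ)}

end KdVShock

/-! The determinant does not depend on `k`. With `τ = it` it equals `4 θ₂(Λ/2π | τ)² / θ₂(0 | τ)²`
(`det_Mmod_eq`), so it is small only when `Λ/2` is near a zero of the cosine. The Dirichlet
eigenvalue `λ` measures exactly this distance.

For the formula, the addition theorem `jacobiTheta₂_add_mul_sub` writes `μ(k)μ(-k)` and `ν(k)ν(-k)`
through theta functions of period `2τ` at `2u`, where `u = A(k) - 1/4`. The only dependence on `k`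
is then the quotient `θ₃/θ₂` at `2u`. By `theta_inversion` it is proportional to `ϱ(k)²`, and the
rest is the rational identity `det_algebra`. The inversion replaces contour arguments by
differential equations. Along the ray from infinity to `k`, both the theta quotient and the
algebraic function solve one second-order equation with the same initial data (`eq_mul_of_ode`). The
coefficients agree because the theta constants at the period ratio `iK'/K` recover the modulus
`a/c`. This comes from integrating the equation over a real and an imaginary half period
(`exists_period_relation`) and from the injectivity of `K'/K`.

For the lower bound, `|θ₂(x | it)| ≥ κ |cos πx| θ₂(0 | it)` with `κ` uniform for `t` bounded away
from `0` (`exists_le_abs_thetaTwoRe`). The Whitham equation gives `B = 12ξV - 4W` (`phaseB_eq`), so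
`Λ` is minus the Abel image of the divisor modulo `2π`. Hence `Λ/2 = ±πr/2 + nπ`, where `r` is the
fraction of `∫_0^a ds/√((c² - s²)(a² - s²))` lying over `(√(-λ), a)`. Therefore `|cos(Λ/2)| ≥ 1 -
r`, which is at least a constant times `√(-λ)`, and squaring gives a bound linear in `-λ > t^{-γ}`.

The constants depend only on an upper bound of `a/c` below `1`, which `exists_whitham_le` provides
from `ξ ≤ c²/3 - ε`. The potential enters only through the real number `Δ`, which cancels between
`Λ` and the initial divisor, so the bound is uniform in `q`. -/

namespace KdVShock

/-! ### Algebra of the Jacobi theta functions -/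

/-- The theta function `θ₂(z | τ) = ∑ exp(πi((n + 1/2)² τ + (2n + 1) z))`. -/
noncomputable def thetaTwo (z τ : ℂ) : ℂ :=
  cexp (Real.pi * I * (τ / 4 + z)) * jacobiTheta₂ (z + τ / 2) τ

lemma thetaTwo_add_one (z τ : ℂ) : thetaTwo (z + 1) τ = -thetaTwo z τ := by
  unfold thetaTwo
  rw [show z + 1 + τ / 2 = z + τ / 2 + 1 by ring, jacobiTheta₂_add_left,
    show (Real.pi : ℂ) * I * (τ / 4 + (z + 1)) = Real.pi * I * (τ / 4 + z) + Real.pi * I by ring,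
    Complex.exp_add, Complex.exp_pi_mul_I]
  ring

lemma thetaTwo_neg (z τ : ℂ) : thetaTwo (-z) τ = thetaTwo z τ := by
  unfold thetaTwo
  rw [show -z + τ / 2 = -(z + τ / 2) + τ by ring, jacobiTheta₂_add_left', jacobiTheta₂_neg_left,
    ← mul_assoc, ← Complex.exp_add]
  congr 2
  ring

/-- An even function with antiperiod `1` vanishes at `1/2`. -/
lemma thetaTwo_half (τ : ℂ) : thetaTwo (1 / 2) τ = 0 := by
  have h := thetaTwo_add_one (-(1 / 2)) τ
  rw [show (-(1 / 2) + 1 : ℂ) = 1 / 2 by norm_num, thetaTwo_neg] at h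
  linear_combination h / 2

lemma jacobiTheta₂_add_half_period (z τ : ℂ) :
    jacobiTheta₂ (z + τ / 2) τ = cexp (-(Real.pi * I * (τ / 4 + z))) * thetaTwo z τ := by
  unfold thetaTwo
  rw [← mul_assoc, ← Complex.exp_add, neg_add_cancel, Complex.exp_zero, one_mul]

lemma thetaTwo_add_half_period (z τ : ℂ) :
    thetaTwo (z + τ / 2) τ = cexp (-(Real.pi * I * (τ / 4 + z))) * jacobiTheta₂ z τ := by
  unfold thetaTwo
  rw [show z + τ / 2 + τ / 2 = z + τ by ring, jacobiTheta₂_add_left', ← mul_assoc,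
    ← Complex.exp_add]
  congr 2
  ring

lemma hasSum_thetaTwo (z : ℂ) {τ : ℂ} (hτ : 0 < τ.im) :
    HasSum (fun n : ℤ => cexp (Real.pi * I * ((n + 1 / 2) ^ 2 * τ + (2 * n + 1) * z)))
      (thetaTwo z τ) := by
  refine ((hasSum_jacobiTheta₂_term (z + τ / 2) hτ).mul_left
    (cexp (Real.pi * I * (τ / 4 + z)))).congr_fun fun n => ?_
  rw [jacobiTheta₂_term, ← Complex.exp_add]
  congr 1
  ring

lemma hasSum_even_odd {f : ℤ → ℂ} {s t : ℂ} (he : HasSum (fun n : ℤ => f (2 * n)) s)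
    (ho : HasSum (fun n : ℤ => f (2 * n + 1)) t) : HasSum f (s + t) := by
  have h2 : Function.Injective fun n : ℤ => 2 * n := fun a b h => by simpa using h
  have h2' : Function.Injective fun n : ℤ => 2 * n + 1 := fun a b h => by simpa using h
  refine (h2.hasSum_range_iff.2 he).add_isCompl ?_ (h2'.hasSum_range_iff.2 ho)
  refine isCompl_iff.2 ⟨Set.disjoint_left.2 ?_, codisjoint_iff.2 ?_⟩
  · rintro _ ⟨a, rfl⟩ ⟨b, hb⟩
    simp only at hb
    omega
  · ext n
    simp only [sup_eq_union, top_eq_univ, mem_union, mem_range, mem_univ, iff_true]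
    rcases Int.even_or_odd' n with ⟨k, h | h⟩
    · exact Or.inl ⟨k, h.symm⟩
    · exact Or.inr ⟨k, h.symm⟩

/-- Splitting the series by the parity of the index quadruples the period, since `(2n)²σ = n²(4σ)`.
The odd indices give the half-integer series of `θ₂`. -/
lemma jacobiTheta₂_eq_add (w : ℂ) {σ : ℂ} (hσ : 0 < σ.im) :
    jacobiTheta₂ w σ = jacobiTheta₂ (2 * w) (4 * σ) + thetaTwo (2 * w) (4 * σ) := by
  have h4 : 0 < (4 * σ).im := by simpa using hσ
  refine (hasSum_jacobiTheta₂_term w hσ).unique (hasSum_even_odd ?_ ?_)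
  · refine (hasSum_jacobiTheta₂_term (2 * w) h4).congr_fun fun n => ?_
    simp only [jacobiTheta₂_term]
    congr 1
    push_cast
    ring
  · refine (hasSum_thetaTwo (2 * w) h4).congr_fun fun n => ?_
    simp only [jacobiTheta₂_term]
    congr 1
    push_cast
    ring

/-- This is the rotation of the lattice behind the addition formula. Pairs with even difference are
`(p + q, p - q)`, for which the sum of squares is `2(p² + q²)`; pairs with odd difference are the
same with half-integer `p` and `q`. -/
lemma hasSum_parity {f : ℤ × ℤ → ℂ} {s t : ℂ}
    (he : HasSum (fun p : ℤ × ℤ => f (p.1 + p.2, p.1 - p.2)) s)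
    (ho : HasSum (fun p : ℤ × ℤ => f (p.1 + p.2 + 1, p.1 - p.2)) t) : HasSum f (s + t) := by
  have h2 : Function.Injective fun p : ℤ × ℤ => (p.1 + p.2, p.1 - p.2) := fun a b h => by
    simp only [Prod.mk.injEq] at h
    ext <;> omega
  have h2' : Function.Injective fun p : ℤ × ℤ => (p.1 + p.2 + 1, p.1 - p.2) := fun a b h => by
    simp only [Prod.mk.injEq] at h
    ext <;> omega
  refine (h2.hasSum_range_iff.2 he).add_isCompl ?_ (h2'.hasSum_range_iff.2 ho)
  refine isCompl_iff.2 ⟨Set.disjoint_left.2 ?_, codisjoint_iff.2 ?_⟩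
  · rintro _ ⟨a, rfl⟩ ⟨b, hb⟩
    simp only [Prod.mk.injEq] at hb
    omega
  · ext ⟨m, n⟩
    simp only [sup_eq_union, top_eq_univ, mem_union, mem_range, mem_univ, iff_true, Prod.mk.injEq, Prod.exists]
    rcases Int.even_or_odd' (m - n) with ⟨k, h | h⟩
    · exact Or.inl ⟨n + k, k, by omega, by omega⟩
    · exact Or.inr ⟨n + k, k, by omega, by omega⟩

lemma hasSum_mul_prod {f g : ℤ → ℂ} {s t : ℂ} (hf : HasSum f s) (hg : HasSum g t) :
    HasSum (fun p : ℤ × ℤ => f p.1 * g p.2) (s * t) :=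
  hf.mul hg (summable_mul_of_summable_norm hf.summable.norm hg.summable.norm)

/-- The addition formula `θ₃(x+y|τ) θ₃(x-y|τ) = θ₃(2x|2τ) θ₃(2y|2τ) + θ₂(2x|2τ) θ₂(2y|2τ)`. -/
lemma jacobiTheta₂_add_mul_sub (x y : ℂ) {τ : ℂ} (hτ : 0 < τ.im) :
    jacobiTheta₂ (x + y) τ * jacobiTheta₂ (x - y) τ =
      jacobiTheta₂ (2 * x) (2 * τ) * jacobiTheta₂ (2 * y) (2 * τ) +
        thetaTwo (2 * x) (2 * τ) * thetaTwo (2 * y) (2 * τ) := by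
  have h2 : 0 < (2 * τ).im := by simpa using hτ
  refine (hasSum_mul_prod (hasSum_jacobiTheta₂_term (x + y) hτ)
    (hasSum_jacobiTheta₂_term (x - y) hτ)).unique (hasSum_parity ?_ ?_)
  · refine (hasSum_mul_prod (hasSum_jacobiTheta₂_term (2 * x) h2)
      (hasSum_jacobiTheta₂_term (2 * y) h2)).congr_fun fun n => ?_
    simp only [jacobiTheta₂_term, ← Complex.exp_add]
    congr 1
    push_cast
    ring
  · refine (hasSum_mul_prod (hasSum_thetaTwo (2 * x) h2)
      (hasSum_thetaTwo (2 * y) h2)).congr_fun fun n => ?_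
    simp only [jacobiTheta₂_term, ← Complex.exp_add]
    congr 1
    push_cast
    ring

/-- Duplication: `θ₂(x|2τ) θ₃(x|2τ) = κ θ₂(x|τ)` with `κ` independent of `x`. -/
lemma exists_thetaTwo_mul_jacobiTheta₂ {τ : ℂ} (hτ : 0 < τ.im) :
    ∃ κ : ℂ, ∀ x, thetaTwo x (2 * τ) * jacobiTheta₂ x (2 * τ) = κ * thetaTwo x τ := by
  have h2 : 0 < (2 * τ).im := by simpa using hτ
  refine ⟨cexp (Real.pi * I * (τ / 4)) * jacobiTheta₂ τ (4 * τ), fun x => ?_⟩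
  have h := jacobiTheta₂_add_mul_sub (x + τ / 2) (τ / 2) h2
  -- At this quarter period the two coefficients on the right of `h` coincide. The sum that remains
  -- is recombined by `jacobiTheta₂_eq_add` into a single theta function of period `τ`.
  have hb : thetaTwo τ (4 * τ) = jacobiTheta₂ τ (4 * τ) := by
    unfold thetaTwo
    rw [show τ + 4 * τ / 2 = -τ + 4 * τ by ring, jacobiTheta₂_add_left', jacobiTheta₂_neg_left,
      ← mul_assoc, ← Complex.exp_add,
      show (Real.pi : ℂ) * I * (4 * τ / 4 + τ) + -Real.pi * I * (4 * τ + 2 * -τ) = 0 by ring,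
      Complex.exp_zero, one_mul]
  rw [show x + τ / 2 + τ / 2 = x + 2 * τ / 2 by ring, show x + τ / 2 - τ / 2 = x by ring,
    jacobiTheta₂_add_half_period, show 2 * (2 * τ) = 4 * τ by ring,
    show 2 * (τ / 2) = τ by ring, hb, ← add_mul, ← jacobiTheta₂_eq_add _ hτ,
    jacobiTheta₂_add_half_period] at h
  have he : cexp (-(Real.pi * I * (τ / 4 + x))) =
      cexp (-(Real.pi * I * (2 * τ / 4 + x))) * cexp (Real.pi * I * (τ / 4)) := by
    rw [← Complex.exp_add]; congr 1; ring
  rw [he] at h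
  refine mul_left_cancel₀ (Complex.exp_ne_zero (-(Real.pi * I * (2 * τ / 4 + x)))) ?_
  linear_combination h

/-! ### The differential equation of the quotient `θ₃ / θ₂` -/

lemma differentiable_jacobiTheta₂ {T : ℂ} (hT : 0 < T.im) :
    Differentiable ℂ fun z => jacobiTheta₂ z T :=
  fun z => differentiableAt_jacobiTheta₂_fst z hT

lemma differentiable_thetaTwo {T : ℂ} (hT : 0 < T.im) :
    Differentiable ℂ fun z => thetaTwo z T := by
  unfold thetaTwo
  have := differentiable_jacobiTheta₂ hT
  exact (by fun_prop : Differentiable ℂ fun z : ℂ => cexp (Real.pi * I * (T / 4 + z))).mul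
    (this.comp (by fun_prop : Differentiable ℂ fun z : ℂ => z + T / 2))

/-- The Wronskian `θ₃' θ₂ - θ₃ θ₂'`. -/
noncomputable def thetaWronskian (T z : ℂ) : ℂ :=
  deriv (fun z => jacobiTheta₂ z T) z * thetaTwo z T -
    jacobiTheta₂ z T * deriv (fun z => thetaTwo z T) z

/-- A two-point form of the Wronskian, whose last factor vanishes at `z = y`. It is the addition
formula with the second argument shifted: the shift by half of the period `2τ` swaps `θ₃` and `θ₂`,
and the shift by `1` produces the minus sign. -/
lemma jacobiTheta₂_mul_thetaTwo_sub (z y : ℂ) {τ : ℂ} (hτ : 0 < τ.im) :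
    jacobiTheta₂ z (2 * τ) * thetaTwo y (2 * τ) - thetaTwo z (2 * τ) * jacobiTheta₂ y (2 * τ) =
      cexp (Real.pi * I * (τ / 2 + y)) * (jacobiTheta₂ ((z + y) / 2 + 1 / 2 + τ / 2) τ *
        jacobiTheta₂ ((z - y) / 2 - 1 / 2 - τ / 2) τ) := by
  have h := jacobiTheta₂_add_mul_sub (z / 2) (y / 2 + 1 / 2 + τ / 2) hτ
  rw [show z / 2 + (y / 2 + 1 / 2 + τ / 2) = (z + y) / 2 + 1 / 2 + τ / 2 by ring,
    show z / 2 - (y / 2 + 1 / 2 + τ / 2) = (z - y) / 2 - 1 / 2 - τ / 2 by ring,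
    show 2 * (z / 2) = z by ring,
    show 2 * (y / 2 + 1 / 2 + τ / 2) = y + 2 * τ / 2 + 1 by ring,
    jacobiTheta₂_add_left, thetaTwo_add_one, jacobiTheta₂_add_half_period y,
    thetaTwo_add_half_period] at h
  rw [h, mul_neg, mul_left_comm, mul_left_comm (thetaTwo z (2 * τ)), ← sub_eq_add_neg, ← mul_sub,
    ← mul_assoc, ← Complex.exp_add,
    show (Real.pi : ℂ) * I * (τ / 2 + y) + -(Real.pi * I * (2 * τ / 4 + y)) = 0 by ring,
    Complex.exp_zero, one_mul]

lemma jacobiTheta₂_zero_of_half (τ : ℂ) : jacobiTheta₂ (-(1 / 2) - τ / 2) τ = 0 := by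
  rw [show -(1 / 2) - τ / 2 = -(1 / 2 + τ / 2) by ring, jacobiTheta₂_neg_left,
    jacobiTheta₂_add_half_period, thetaTwo_half, mul_zero]

/-- Differentiate the two-point identity in `z` at `z = y`. Only the derivative of the vanishing
factor survives, a constant, and the exponentials in `y` cancel. -/
lemma exists_thetaWronskian_eq_thetaTwo {τ : ℂ} (hτ : 0 < τ.im) :
    ∃ c : ℂ, ∀ z, thetaWronskian (2 * τ) z = c * thetaTwo (z + 1 / 2) τ := by
  have h2 : 0 < (2 * τ).im := by simpa using hτ
  have ha := differentiable_jacobiTheta₂ h2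
  have hb := differentiable_thetaTwo h2
  have h3 := differentiable_jacobiTheta₂ hτ
  set D := deriv (fun z => jacobiTheta₂ z τ) (-(1 / 2) - τ / 2) with hD
  refine ⟨-I * cexp (Real.pi * I * (τ / 4)) * (1 / 2 * D), fun y => ?_⟩
  have hl : HasDerivAt (fun z => jacobiTheta₂ z (2 * τ) * thetaTwo y (2 * τ) -
      thetaTwo z (2 * τ) * jacobiTheta₂ y (2 * τ)) (thetaWronskian (2 * τ) y) y := by
    have := ((ha y).hasDerivAt.mul_const (thetaTwo y (2 * τ))).sub
      ((hb y).hasDerivAt.mul_const (jacobiTheta₂ y (2 * τ)))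
    refine this.congr_deriv ?_
    unfold thetaWronskian
    ring
  have hp : HasDerivAt (fun z : ℂ => (z - y) / 2 - 1 / 2 - τ / 2) (1 / 2) y :=
    ((((hasDerivAt_id y).sub_const y).div_const 2).sub_const _).sub_const _
  have hq : DifferentiableAt ℂ (fun z => jacobiTheta₂ ((z + y) / 2 + 1 / 2 + τ / 2) τ) y :=
    (h3 _).comp y (by fun_prop : DifferentiableAt ℂ (fun z : ℂ => (z + y) / 2 + 1 / 2 + τ / 2) y)
  have hD' : HasDerivAt (fun z => jacobiTheta₂ z τ) D ((y - y) / 2 - 1 / 2 - τ / 2) := by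
    rw [show (y - y) / 2 - 1 / 2 - τ / 2 = -(1 / 2) - τ / 2 by ring]
    exact (h3 _).hasDerivAt
  have hr := (hq.hasDerivAt.mul (hD'.comp y hp)).const_mul (cexp (Real.pi * I * (τ / 2 + y)))
  have hfun := funext fun z => jacobiTheta₂_mul_thetaTwo_sub z y hτ
  rw [hfun] at hl
  have hu := hl.unique hr
  rw [hu]
  simp only [Function.comp]
  rw [show (y - y) / 2 - 1 / 2 - τ / 2 = -(1 / 2) - τ / 2 by ring, jacobiTheta₂_zero_of_half,
    mul_zero, zero_add, show (y + y) / 2 + 1 / 2 + τ / 2 = y + 1 / 2 + τ / 2 by ring,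
    jacobiTheta₂_add_half_period]
  have he : cexp (Real.pi * I * (τ / 2 + y)) * cexp (-(Real.pi * I * (τ / 4 + (y + 1 / 2)))) =
      -I * cexp (Real.pi * I * (τ / 4)) := by
    rw [← Complex.exp_add, ← Complex.exp_neg_pi_div_two_mul_I, ← Complex.exp_add]
    congr 1
    ring
  linear_combination (thetaTwo (y + 1 / 2) τ * (D * (1 / 2))) * he

/-- The duplication formula turns the single `θ₂` of period `T/2` into a product at period `T`. The
hypothesis `hne` makes the duplication constant nonzero, so that it can be divided out. -/
lemma exists_thetaWronskian_eq {T : ℂ} (hT : 0 < T.im)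
    (hne : ∃ x, thetaTwo x T * jacobiTheta₂ x T ≠ 0) :
    ∃ c : ℂ, ∀ z, thetaWronskian T z = c * (jacobiTheta₂ (z + 1 / 2) T * thetaTwo (z + 1 / 2) T) := by
  have hτ : 0 < (T / 2).im := by simpa using hT
  obtain ⟨κ, hκ⟩ := exists_thetaTwo_mul_jacobiTheta₂ hτ
  obtain ⟨c, hc⟩ := exists_thetaWronskian_eq_thetaTwo hτ
  rw [show 2 * (T / 2) = T by ring] at hκ hc
  have hκ0 : κ ≠ 0 := by
    rintro rfl
    obtain ⟨x, hx⟩ := hne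
    exact hx (by rw [hκ, zero_mul])
  refine ⟨c / κ, fun z => ?_⟩
  rw [hc, mul_comm (jacobiTheta₂ _ _), hκ]
  field_simp

/-- At period `T/2` the addition formula expresses `θ₃(z/2)²`, `θ₃(z/2 + 1/2)²` and the product of
these two values. The two squares are a sum and a difference, so multiplying them yields a
difference of squares. -/
lemma jacobiTheta₂_sq_half (z : ℂ) {T : ℂ} (hT : 0 < T.im) :
    jacobiTheta₂ (z + 1 / 2) T ^ 2 * jacobiTheta₂ (1 / 2) T ^ 2 =
      jacobiTheta₂ z T ^ 2 * jacobiTheta₂ 0 T ^ 2 - thetaTwo z T ^ 2 * thetaTwo 0 T ^ 2 := by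
  have hτ : 0 < (T / 2).im := by simpa using hT
  have h1 := jacobiTheta₂_add_mul_sub (z / 2) 0 hτ
  have h2 := jacobiTheta₂_add_mul_sub (z / 2 + 1 / 2) 0 hτ
  have h3 := jacobiTheta₂_add_mul_sub (z / 2 + 1 / 4) (1 / 4) hτ
  rw [show 2 * (T / 2) = T by ring] at h1 h2 h3
  rw [add_zero, sub_zero, mul_zero, show 2 * (z / 2) = z by ring] at h1
  rw [add_zero, sub_zero, mul_zero, show 2 * (z / 2 + 1 / 2) = z + 1 by ring,
    jacobiTheta₂_add_left, thetaTwo_add_one] at h2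
  rw [show z / 2 + 1 / 4 + 1 / 4 = z / 2 + 1 / 2 by ring,
    show z / 2 + 1 / 4 - 1 / 4 = z / 2 by ring, show 2 * (z / 2 + 1 / 4) = z + 1 / 2 by ring,
    show (2 * (1 / 4) : ℂ) = 1 / 2 by norm_num, thetaTwo_half, mul_zero, add_zero] at h3
  calc _ = (jacobiTheta₂ (z + 1 / 2) T * jacobiTheta₂ (1 / 2) T) ^ 2 := by ring
    _ = (jacobiTheta₂ (z / 2) (T / 2) * jacobiTheta₂ (z / 2) (T / 2)) *
        (jacobiTheta₂ (z / 2 + 1 / 2) (T / 2) * jacobiTheta₂ (z / 2 + 1 / 2) (T / 2)) := by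
      rw [← h3]; ring
    _ = _ := by rw [h1, h2]; ring

lemma thetaTwo_sq_half (z : ℂ) {T : ℂ} (hT : 0 < T.im) :
    thetaTwo (z + 1 / 2) T ^ 2 * jacobiTheta₂ (1 / 2) T ^ 2 =
      jacobiTheta₂ z T ^ 2 * thetaTwo 0 T ^ 2 - thetaTwo z T ^ 2 * jacobiTheta₂ 0 T ^ 2 := by
  have h := jacobiTheta₂_sq_half (z + T / 2) hT
  rw [show z + T / 2 + 1 / 2 = z + 1 / 2 + T / 2 by ring, jacobiTheta₂_add_half_period,
    jacobiTheta₂_add_half_period, thetaTwo_add_half_period] at h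
  have he : cexp (-(Real.pi * I * (T / 4 + (z + 1 / 2)))) =
      -I * cexp (-(Real.pi * I * (T / 4 + z))) := by
    rw [← Complex.exp_neg_pi_div_two_mul_I, ← Complex.exp_add]
    congr 1
    ring
  rw [he] at h
  have h0 := pow_ne_zero 2 (Complex.exp_ne_zero (-(Real.pi * I * (T / 4 + z))))
  refine mul_left_cancel₀ h0 ?_
  linear_combination -h + (cexp (-(Real.pi * I * (T / 4 + z))) * thetaTwo (z + 1 / 2) T *
    jacobiTheta₂ (1 / 2) T) ^ 2 * I_sq

/-- A product of entire functions vanishes identically only if a factor does, and each factor takes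
the value `θ₃(0)` at `y = -x` or `y = x`. -/
lemma jacobiTheta₂_ne_zero_fun {τ : ℂ} (hτ : 0 < τ.im) (h0 : jacobiTheta₂ 0 τ ≠ 0) (x : ℂ) :
    ∃ y, jacobiTheta₂ (x + y) τ * jacobiTheta₂ (x - y) τ ≠ 0 := by
  by_contra! h
  have h3 := differentiable_jacobiTheta₂ hτ
  have hA : AnalyticOnNhd ℂ (fun y => jacobiTheta₂ (x + y) τ) univ :=
    Complex.analyticOnNhd_univ_iff_differentiable.2 (h3.comp (by fun_prop : Differentiable ℂ fun y : ℂ => x + y))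
  have hB : AnalyticOnNhd ℂ (fun y => jacobiTheta₂ (x - y) τ) univ :=
    Complex.analyticOnNhd_univ_iff_differentiable.2 (h3.comp (by fun_prop : Differentiable ℂ fun y : ℂ => x - y))
  rcases AnalyticOnNhd.eq_zero_or_eq_zero_of_mul_eq_zero hA hB (fun y _ => h y)
    isPreconnected_univ with h' | h'
  · exact h0 (by simpa using h' (-x) (mem_univ _))
  · exact h0 (by simpa using h' x (mem_univ _))

/-- `θ₃` and `θ₂` have no common zero. -/
lemma thetaTwo_ne_zero_of_jacobiTheta₂_eq_zero {T : ℂ} (hT : 0 < T.im)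
    (h0 : jacobiTheta₂ 0 (T / 2) ≠ 0) {z : ℂ} (hz : jacobiTheta₂ z T = 0) : thetaTwo z T ≠ 0 := by
  intro hz2
  have hτ : 0 < (T / 2).im := by simpa using hT
  -- A common zero at `z` would, by the addition formula at period `T/2`, make `θ₃(z/2 + y) θ₃(z/2 -
  -- y)` vanish for every `y`.
  obtain ⟨y, hy⟩ := jacobiTheta₂_ne_zero_fun hτ h0 (z / 2)
  apply hy
  rw [jacobiTheta₂_add_mul_sub _ _ hτ, show 2 * (z / 2) = z by ring,
    show 2 * (T / 2) = T by ring, hz, hz2]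
  ring

/-! ### Theta functions with purely imaginary period: positivity and bounds -/

lemma im_I_mul_pos {t : ℝ} (ht : 0 < t) : 0 < (I * (t : ℂ)).im := by simpa using ht

/-- `θ₃(x | it)` as a real number. -/
noncomputable def thetaThreeRe (t x : ℝ) : ℝ := (jacobiTheta₂ x (I * t)).re

/-- `θ₂(x | it)` as a real number. -/
noncomputable def thetaTwoRe (t x : ℝ) : ℝ := (thetaTwo x (I * t)).re

lemma thetaThreeRe_eq_cosKernel (t x : ℝ) :
    thetaThreeRe t x = HurwitzZeta.cosKernel (x : UnitAddCircle) t := by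
  rw [thetaThreeRe, ← HurwitzZeta.cosKernel_def, ofReal_re]

lemma ofReal_thetaThreeRe (t x : ℝ) : (thetaThreeRe t x : ℂ) = jacobiTheta₂ x (I * t) := by
  rw [thetaThreeRe_eq_cosKernel, HurwitzZeta.cosKernel_def]

lemma ofReal_thetaTwoRe (t x : ℝ) : (thetaTwoRe t x : ℂ) = thetaTwo x (I * t) := by
  rw [thetaTwoRe, ← Complex.conj_eq_iff_re]
  conv_rhs => rw [← thetaTwo_neg]
  rw [thetaTwo, map_mul, jacobiTheta₂_conj, ← Complex.exp_conj, thetaTwo,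
    ← jacobiTheta₂_neg_left (-(x : ℂ) + _)]
  simp only [map_mul, map_add, conj_I, conj_ofReal, map_div₀, map_ofNat]
  congr 2 <;> ring

/-- The cosine series has terms of both signs; the functional equation rewrites it as a positive
multiple of a sum of Gaussians. -/
lemma thetaThreeRe_pos {t : ℝ} (ht : 0 < t) (x : ℝ) : 0 < thetaThreeRe t x := by
  rw [thetaThreeRe_eq_cosKernel]
  have h := HurwitzZeta.evenKernel_functional_equation (x : UnitAddCircle) (1 / t)
  have hs := HurwitzZeta.hasSum_int_evenKernel x (one_div_pos.2 ht)
  have hp : 0 < HurwitzZeta.evenKernel (x : UnitAddCircle) (1 / t) := by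
    rw [← hs.tsum_eq]
    exact hs.summable.tsum_pos (fun n => (Real.exp_pos _).le) 0 (Real.exp_pos _)
  rw [h, one_div_one_div] at hp
  exact pos_of_mul_pos_right hp (by positivity)

/-- The factor `|cos y|` on the right lets the leading term of the `θ₂` series dominate the tail
even near the zeros of `θ₂`. -/
lemma abs_cos_odd_mul_le (n : ℕ) (y : ℝ) :
    |Real.cos ((2 * n + 1) * y)| ≤ (2 * n + 1) * |Real.cos y| := by
  induction n with
  | zero => simp
  | succ n ih =>
    have h : Real.cos ((2 * (n + 1 : ℕ) + 1) * y) = Real.cos ((2 * n + 1) * y) * Real.cos (2 * y) -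
        Real.sin ((2 * n + 1) * y) * (2 * Real.sin y * Real.cos y) := by
      rw [← Real.sin_two_mul, ← Real.cos_add]
      congr 1
      push_cast
      ring
    rw [h]
    calc _ ≤ |Real.cos ((2 * n + 1) * y) * Real.cos (2 * y)| +
          |Real.sin ((2 * n + 1) * y) * (2 * Real.sin y * Real.cos y)| := abs_sub _ _
      _ ≤ (2 * n + 1) * |Real.cos y| * 1 + 1 * (2 * 1 * |Real.cos y|) := by
        simp only [abs_mul]
        gcongr
        · exact Real.abs_cos_le_one _
        · exact Real.abs_sin_le_one _
        · simp
        · exact Real.abs_sin_le_one _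
      _ = _ := by push_cast; ring

lemma hasSum_thetaTwoRe {t : ℝ} (ht : 0 < t) (x : ℝ) :
    HasSum (fun n : ℕ => 2 * Real.exp (-(Real.pi * t / 4)) * (Real.exp (-(Real.pi * t * (n ^ 2 + n))) *
      Real.cos ((2 * n + 1) * (Real.pi * x)))) (thetaTwoRe t x) := by
  have h := (hasSum_thetaTwo x (im_I_mul_pos ht)).nat_add_neg_add_one
  rw [← hasSum_ofReal, ofReal_thetaTwoRe]
  refine h.congr_fun fun n => ?_
  have e1 : (Real.pi : ℂ) * I * (((n : ℤ) + 1 / 2 : ℂ) ^ 2 * (I * t) + (2 * (n : ℤ) + 1) * x) =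
      (-(Real.pi * t / 4) : ℝ) + (-(Real.pi * t * (n ^ 2 + n)) : ℝ) +
        ((2 * n + 1) * (Real.pi * x) : ℝ) * I := by
    push_cast
    linear_combination (Real.pi * ((n : ℂ) + 1 / 2) ^ 2 * t) * I_sq
  have e2 : (Real.pi : ℂ) * I * (((-((n : ℤ) + 1) : ℤ) + 1 / 2 : ℂ) ^ 2 * (I * t) +
        (2 * (-((n : ℤ) + 1) : ℤ) + 1) * x) =
      (-(Real.pi * t / 4) : ℝ) + (-(Real.pi * t * (n ^ 2 + n)) : ℝ) +
        -((2 * n + 1) * (Real.pi * x) : ℝ) * I := by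
    push_cast
    linear_combination (Real.pi * ((n : ℂ) + 1 / 2) ^ 2 * t) * I_sq
  rw [e1, e2]
  simp only [Complex.exp_add]
  push_cast
  rw [Complex.cos]
  ring

lemma exp_neg_pi_mul_le {t : ℝ} (ht : 1 ≤ t) : Real.exp (-(Real.pi * t)) ≤ 1 / 20 := by
  have h3 : Real.exp (-(Real.pi * t)) ≤ Real.exp (-3) :=
    Real.exp_le_exp.2 (by nlinarith [Real.pi_gt_three])
  have h4 : Real.exp (-3) ≤ 1 / 20 := by
    rw [Real.exp_neg, inv_eq_one_div]
    apply one_div_le_one_div_of_le (by norm_num)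
    have : Real.exp 3 = Real.exp 1 ^ 3 := by rw [← Real.exp_nat_mul]; norm_num
    rw [this]
    have := Real.exp_one_gt_d9
    calc (20 : ℝ) ≤ 2.7182818283 ^ 3 := by norm_num
      _ ≤ _ := by gcongr
  linarith

/-- The tail is compared with a geometric series of ratio `2r`, `r = e^{-πt} ≤ 1/20`: the cosines
cost `2n + 3 ≤ 3·2ⁿ` and the exponentials are at most `r^(n+2)`. The error is relative to `|cos
πx|`. -/
lemma abs_thetaTwoRe_sub_le {t : ℝ} (ht : 1 ≤ t) (x : ℝ) :
    |thetaTwoRe t x - 2 * Real.exp (-(Real.pi * t / 4)) * Real.cos (Real.pi * x)| ≤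
      1 / 10 * (2 * Real.exp (-(Real.pi * t / 4)) * |Real.cos (Real.pi * x)|) := by
  have h := hasSum_thetaTwoRe (by linarith : 0 < t) x
  set E := 2 * Real.exp (-(Real.pi * t / 4)) with hE
  have hE0 : 0 < E := by positivity
  clear_value E
  have h1 := (hasSum_nat_add_iff' 1).2 h
  simp only [Finset.range_one, Finset.sum_singleton, CharP.cast_eq_zero] at h1
  norm_num at h1
  set r := Real.exp (-(Real.pi * t)) with hr
  have hr0 : 0 < r := Real.exp_pos _
  have hr1 : r ≤ 1 / 20 := exp_neg_pi_mul_le ht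
  have hg : HasSum (fun n : ℕ => E * |Real.cos (Real.pi * x)| * (3 * r ^ 2) * (2 * r) ^ n)
      (E * |Real.cos (Real.pi * x)| * (3 * r ^ 2) * (1 - 2 * r)⁻¹) :=
    (hasSum_geometric_of_lt_one (by positivity) (by linarith)).mul_left _
  have hb := tsum_of_norm_bounded hg (f := fun n : ℕ => E * (Real.exp (-(Real.pi * t * (((n : ℝ) + 1) ^ 2 + (n + 1)))) *
      Real.cos ((2 * (n + 1) + 1) * (Real.pi * x)))) fun n => by
    have hc := abs_cos_odd_mul_le (n + 1) (Real.pi * x)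
    have h2n : (2 * ((n + 1 : ℕ) : ℝ) + 1) ≤ 3 * 2 ^ n := by
      have : ∀ n : ℕ, (2 * ((n + 1 : ℕ) : ℝ) + 1) ≤ 3 * 2 ^ n := fun n => by
        induction n with
        | zero => norm_num
        | succ k ih => push_cast at ih ⊢; rw [pow_succ]; nlinarith [(Nat.cast_nonneg k : (0:ℝ) ≤ k)]
      exact this n
    have hex : Real.exp (-(Real.pi * t * (((n : ℝ) + 1) ^ 2 + (n + 1)))) ≤ r ^ (n + 2) := by
      rw [hr, ← Real.exp_nat_mul]
      apply Real.exp_le_exp.2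
      have : 0 < Real.pi * t := by positivity
      push_cast
      nlinarith [mul_nonneg this.le (Nat.cast_nonneg n : (0:ℝ) ≤ n), mul_nonneg this.le (sq_nonneg (n:ℝ))]
    rw [Real.norm_eq_abs, abs_mul, abs_mul, abs_of_pos hE0, abs_of_pos (Real.exp_pos _)]
    push_cast at hc h2n
    calc _ ≤ E * (r ^ (n + 2) * (3 * 2 ^ n * |Real.cos (Real.pi * x)|)) := by
          gcongr
          exact hc.trans (by gcongr)
      _ = _ := by rw [mul_pow]; ring
  rw [h1.tsum_eq, Real.norm_eq_abs] at hb
  refine hb.trans ?_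
  have h5 : 3 * r ^ 2 * (1 - 2 * r)⁻¹ ≤ 1 / 10 := by
    rw [← div_eq_mul_inv, div_le_iff₀ (by linarith)]
    nlinarith
  calc _ = E * |Real.cos (Real.pi * x)| * (3 * r ^ 2 * (1 - 2 * r)⁻¹) := by ring
    _ ≤ E * |Real.cos (Real.pi * x)| * (1 / 10) := by gcongr
    _ = _ := by ring

lemma abs_thetaThreeRe_zero_sub_one_le {t : ℝ} (ht : 1 ≤ t) : |thetaThreeRe t 0 - 1| ≤ 1 / 2 := by
  have h := norm_jacobiTheta_sub_one_le (im_I_mul_pos (by linarith : 0 < t))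
  have h0 := ofReal_thetaThreeRe t 0
  rw [ofReal_zero] at h0
  rw [jacobiTheta_eq_jacobiTheta₂, ← h0, ← ofReal_one, ← ofReal_sub, norm_real, Real.norm_eq_abs] at h
  refine h.trans ?_
  have hr := exp_neg_pi_mul_le ht
  have hr0 := Real.exp_pos (-(Real.pi * t))
  have him : (I * (t : ℂ)).im = t := by simp
  rw [him, neg_mul, div_mul_eq_mul_div, div_le_iff₀ (by linarith)]
  linarith

/-- In the cosine series of `θ₃ - 1` every cosine is at least `-1`. -/
lemma two_sub_le_thetaThreeRe {t : ℝ} (ht : 0 < t) (x : ℝ) :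
    2 - thetaThreeRe t 0 ≤ thetaThreeRe t x := by
  have hx := HurwitzZeta.hasSum_nat_cosKernel₀ x ht
  have h0 := (HurwitzZeta.hasSum_nat_cosKernel₀ 0 ht).neg
  rw [← thetaThreeRe_eq_cosKernel] at hx h0
  have := hasSum_le (fun n => ?_) h0 hx
  · linarith
  · simp only [mul_zero, zero_mul, Real.cos_zero, mul_one]
    have h1 := Real.neg_one_le_cos (2 * Real.pi * x * (n + 1))
    have h2 := Real.exp_pos (-Real.pi * ((n : ℝ) + 1) ^ 2 * t)
    nlinarith

lemma thetaThreeRe_eq_rpow_mul (t x : ℝ) :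
    HurwitzZeta.evenKernel (x : UnitAddCircle) (1 / t) =
      1 / (1 / t) ^ (1 / 2 : ℝ) * thetaThreeRe t x := by
  rw [HurwitzZeta.evenKernel_functional_equation, one_div_one_div, thetaThreeRe_eq_cosKernel]

/-- A bound of `θ₃` on the real line, uniform for periods `it` away from `0`. -/
lemma exists_le_thetaThreeRe {t₀ : ℝ} (ht₀ : 0 < t₀) :
    ∃ κ : ℝ, 0 < κ ∧ ∀ t, t₀ ≤ t → ∀ x, κ * thetaThreeRe t 0 ≤ thetaThreeRe t x := by
  -- For `t ≥ 1`, `θ₃(x) ≥ 2 - θ₃(0) ≥ 1/2` and `θ₃(0) ≤ 3/2` give `1/3`. For `t ≤ 1` the dual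
  -- Gaussian sum has value at most `3/2` at `x = 0`, whence the factor `2/3`.
  refine ⟨min (1 / 3) (2 / 3 * Real.exp (-(Real.pi / (4 * t₀)))), by positivity, fun t ht x => ?_⟩
  have ht0 : 0 < t := ht₀.trans_le ht
  have hp := thetaThreeRe_pos ht0 0
  rcases le_total 1 t with h1 | h1
  · have h2 := abs_le.1 (abs_thetaThreeRe_zero_sub_one_le h1)
    have h3 := two_sub_le_thetaThreeRe ht0 x
    have h4 := mul_le_mul_of_nonneg_right (min_le_left (1 / 3 : ℝ)
      (2 / 3 * Real.exp (-(Real.pi / (4 * t₀))))) hp.le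
    linarith
  · have hs : 1 ≤ 1 / t := by rwa [le_div_iff₀ ht0, one_mul]
    have hs0 : 0 < 1 / t := by positivity
    have h2 := abs_le.1 (abs_thetaThreeRe_zero_sub_one_le hs)
    have e0 := thetaThreeRe_eq_rpow_mul t 0
    have ex := thetaThreeRe_eq_rpow_mul t x
    have hk : HurwitzZeta.evenKernel ((0 : ℝ) : UnitAddCircle) (1 / t) = thetaThreeRe (1 / t) 0 := by
      rw [thetaThreeRe_eq_cosKernel, QuotientAddGroup.mk_zero,
        HurwitzZeta.evenKernel_eq_cosKernel_of_zero]
    rw [hk] at e0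
    have hsum := HurwitzZeta.hasSum_int_evenKernel x hs0
    -- Only the Gaussian closest to `x` is kept; its centre is within `1/2`.
    have hle : Real.exp (-(Real.pi / (4 * t₀))) ≤
        HurwitzZeta.evenKernel (x : UnitAddCircle) (1 / t) := by
      refine le_trans ?_ (le_hasSum hsum (-round x) fun n _ => (Real.exp_pos _).le)
      apply Real.exp_le_exp.2
      have hr := abs_sub_round x
      have hr2 : (((-round x : ℤ) : ℝ) + x) ^ 2 ≤ 1 / 4 := by
        push_cast
        rw [abs_le] at hr
        nlinarith
      have hinv : 1 / t ≤ 1 / t₀ := one_div_le_one_div_of_le ht₀ ht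
      have : Real.pi * (((-round x : ℤ) : ℝ) + x) ^ 2 * (1 / t) ≤ Real.pi * (1 / 4) * (1 / t₀) := by
        gcongr
      have e : Real.pi / (4 * t₀) = Real.pi * (1 / 4) * (1 / t₀) := by field_simp
      rw [e]
      linarith
    have hc : 0 < 1 / (1 / t) ^ (1 / 2 : ℝ) := by positivity
    refine le_of_mul_le_mul_left ?_ hc
    rw [← ex, mul_left_comm, ← e0]
    refine le_trans ?_ hle
    have h5 := Real.exp_pos (-(Real.pi / (4 * t₀)))
    calc _ ≤ (2 / 3 * Real.exp (-(Real.pi / (4 * t₀)))) * (3 / 2) := by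
          refine mul_le_mul (min_le_right _ _) (by linarith) (thetaThreeRe_pos hs0 0).le (by positivity)
      _ = _ := by ring

lemma thetaTwoRe_zero_pos {t : ℝ} (ht : 0 < t) : 0 < thetaTwoRe t 0 := by
  have h := hasSum_thetaTwoRe ht 0
  simp only [mul_zero, Real.cos_zero, mul_one] at h
  rw [← h.tsum_eq]
  exact h.summable.tsum_pos (fun n => by positivity) 0 (by positivity)

lemma thetaTwoRe_duplication {t : ℝ} (ht : 0 < t) (x : ℝ) :
    thetaTwoRe t x * (thetaTwoRe (2 * t) 0 * thetaThreeRe (2 * t) 0) =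
      thetaTwoRe t 0 * (thetaTwoRe (2 * t) x * thetaThreeRe (2 * t) x) := by
  obtain ⟨κ, hκ⟩ := exists_thetaTwo_mul_jacobiTheta₂ (im_I_mul_pos ht)
  have h1 := hκ x
  have h2 := hκ (0 : ℝ)
  rw [show 2 * (I * (t : ℂ)) = I * ((2 * t : ℝ) : ℂ) by push_cast; ring] at h1 h2
  simp only [← ofReal_thetaThreeRe, ← ofReal_thetaTwoRe] at h1 h2
  apply ofReal_injective
  push_cast
  linear_combination (thetaTwoRe t x : ℂ) * h2 - (thetaTwoRe t 0 : ℂ) * h1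

/-- For `t ≥ 1` the leading term of the series suffices. Duplication then passes from `2t` to `t`:
the normalized `θ₂` at `t` is the product of the normalized `θ₂` and `θ₃` at `2t`, and the latter is
bounded below. The factor `|cos πx|` survives every halving. -/
lemma exists_le_abs_thetaTwoRe {t₀ : ℝ} (ht₀ : 0 < t₀) :
    ∃ κ : ℝ, 0 < κ ∧ ∀ t, t₀ ≤ t → ∀ x,
      κ * (|Real.cos (Real.pi * x)| * thetaTwoRe t 0) ≤ |thetaTwoRe t x| := by
  have key : ∀ n : ℕ, ∃ κ : ℝ, 0 < κ ∧ ∀ t, (1 / 2 : ℝ) ^ n ≤ t → ∀ x,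
      κ * (|Real.cos (Real.pi * x)| * thetaTwoRe t 0) ≤ |thetaTwoRe t x| := by
    intro n
    induction n with
    | zero =>
      refine ⟨1 / 2, by norm_num, fun t ht x => ?_⟩
      rw [pow_zero] at ht
      have h1 := abs_thetaTwoRe_sub_le ht x
      have h0 := (abs_le.1 (abs_thetaTwoRe_sub_le ht 0)).2
      simp only [mul_zero, Real.cos_zero, abs_one, mul_one] at h0
      set E := 2 * Real.exp (-(Real.pi * t / 4)) with hE
      have hE0 : 0 < E := by positivity
      have h2 := abs_sub_abs_le_abs_sub (E * Real.cos (Real.pi * x)) (thetaTwoRe t x)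
      rw [abs_sub_comm, abs_mul, abs_of_pos hE0] at h2
      have h3 := abs_nonneg (Real.cos (Real.pi * x))
      nlinarith [mul_nonneg hE0.le h3]
    | succ n ih =>
      obtain ⟨κ, hκ, h⟩ := ih
      obtain ⟨ρ, hρ, h'⟩ := exists_le_thetaThreeRe (t₀ := (1 / 2) ^ n) (by positivity)
      refine ⟨κ * ρ, by positivity, fun t ht x => ?_⟩
      have htn : (1 / 2 : ℝ) ^ n ≤ 2 * t := by rw [pow_succ] at ht; linarith
      have ht0 : 0 < t := lt_of_lt_of_le (by positivity) ht
      have ht2 : 0 < 2 * t := by positivity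
      have a1 := h _ htn x
      have a2 := h' _ htn x
      have d := thetaTwoRe_duplication ht0 x
      have p0 := thetaTwoRe_zero_pos ht0
      have p2 := thetaTwoRe_zero_pos ht2
      have p3 := thetaThreeRe_pos ht2 0
      have p3x := thetaThreeRe_pos ht2 x
      have d' := congrArg abs d
      simp only [abs_mul, abs_of_pos p0, abs_of_pos p2, abs_of_pos p3, abs_of_pos p3x] at d'
      refine le_of_mul_le_mul_right ?_ (mul_pos p2 p3)
      rw [d']
      calc _ = thetaTwoRe t 0 * ((κ * (|Real.cos (Real.pi * x)| * thetaTwoRe (2 * t) 0)) *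
            (ρ * thetaThreeRe (2 * t) 0)) := by ring
        _ ≤ _ := by gcongr
  obtain ⟨n, hn⟩ := exists_pow_lt_of_lt_one ht₀ (by norm_num : (1 / 2 : ℝ) < 1)
  obtain ⟨κ, hκ, h⟩ := key n
  exact ⟨κ, hκ, fun t ht => h t (hn.le.trans ht)⟩

lemma thetaTwoRe_ne_zero {t : ℝ} (ht : 0 < t) {x : ℝ} (hx : Real.cos (Real.pi * x) ≠ 0) :
    thetaTwoRe t x ≠ 0 := by
  obtain ⟨κ, hκ, h⟩ := exists_le_abs_thetaTwoRe ht
  have h1 := h t le_rfl x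
  have h2 : 0 < κ * (|Real.cos (Real.pi * x)| * thetaTwoRe t 0) :=
    mul_pos hκ (mul_pos (abs_pos.2 hx) (thetaTwoRe_zero_pos ht))
  exact abs_pos.1 (h2.trans_le h1)

/-! ### Change of variables and complete elliptic integrals -/

section ChangeOfVariables

variable {f f' : ℝ → ℝ} {p q : ℝ}

lemma strictMonoOn_of_hasDerivAt_pos (hc : ContinuousOn f (Icc p q))
    (hd : ∀ x ∈ Ioo p q, HasDerivAt f (f' x) x) (hpos : ∀ x ∈ Ioo p q, 0 < f' x) :
    StrictMonoOn f (Icc p q) := by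
  refine strictMonoOn_of_deriv_pos (convex_Icc p q) hc fun x hx => ?_
  rw [interior_Icc] at hx
  rw [(hd x hx).deriv]
  exact hpos x hx

lemma image_Ioo_of_hasDerivAt_pos (hpq : p ≤ q) (hc : ContinuousOn f (Icc p q))
    (hd : ∀ x ∈ Ioo p q, HasDerivAt f (f' x) x) (hpos : ∀ x ∈ Ioo p q, 0 < f' x) :
    f '' Ioo p q = Ioo (f p) (f q) :=
  (strictMonoOn_of_hasDerivAt_pos hc hd hpos).image_Ioo_subset.antisymm
    (intermediate_value_Ioo hpq hc)

/-- Stated on open intervals and for arbitrary `g`, because the elliptic integrands are singular at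
the endpoints. -/
lemma setIntegral_Ioo_comp (hpq : p ≤ q) (hc : ContinuousOn f (Icc p q))
    (hd : ∀ x ∈ Ioo p q, HasDerivAt f (f' x) x) (hpos : ∀ x ∈ Ioo p q, 0 < f' x) (g : ℝ → ℝ) :
    ∫ y in Ioo (f p) (f q), g y = ∫ x in Ioo p q, f' x * g (f x) := by
  rw [← image_Ioo_of_hasDerivAt_pos hpq hc hd hpos, integral_image_eq_integral_abs_deriv_smul
    measurableSet_Ioo (fun x hx => (hd x hx).hasDerivWithinAt)
    ((strictMonoOn_of_hasDerivAt_pos hc hd hpos).injOn.mono Ioo_subset_Icc_self)]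
  refine setIntegral_congr_fun measurableSet_Ioo fun x hx => ?_
  simp only [abs_of_pos (hpos x hx), smul_eq_mul]

lemma integrableOn_Ioo_comp_iff (hpq : p ≤ q) (hc : ContinuousOn f (Icc p q))
    (hd : ∀ x ∈ Ioo p q, HasDerivAt f (f' x) x) (hpos : ∀ x ∈ Ioo p q, 0 < f' x) (g : ℝ → ℝ) :
    IntegrableOn g (Ioo (f p) (f q)) ↔ IntegrableOn (fun x => f' x * g (f x)) (Ioo p q) := by
  rw [← image_Ioo_of_hasDerivAt_pos hpq hc hd hpos, integrableOn_image_iff_integrableOn_abs_deriv_smul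
    measurableSet_Ioo (fun x hx => (hd x hx).hasDerivWithinAt)
    ((strictMonoOn_of_hasDerivAt_pos hc hd hpos).injOn.mono Ioo_subset_Icc_self)]
  refine integrableOn_congr_fun (fun x hx => ?_) measurableSet_Ioo
  simp only [abs_of_pos (hpos x hx), smul_eq_mul]

/-- If `f` solves `f'² = r² P(f)` with `f' ≠ 0`, then `∫ dy / √P(y)` is `r` times the time. -/
lemma setIntegral_one_div_sqrt_eq (hpq : p < q) (hc : ContinuousOn f (Icc p q))
    (hd : ∀ x ∈ Ioo p q, HasDerivAt f (f' x) x) (hne : ∀ x ∈ Ioo p q, f' x ≠ 0)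
    (hf : f p < f q) {r : ℝ} (hr : 0 ≤ r) {P : ℝ → ℝ}
    (hP : ∀ x ∈ Ioo p q, f' x ^ 2 = r ^ 2 * P (f x)) :
    ∫ y in Ioo (f p) (f q), 1 / √(P y) = r * (q - p) := by
  have hpos : ∀ x ∈ Ioo p q, 0 < f' x := by
    -- By Darboux a nonvanishing derivative has constant sign, and `f p < f q` makes it positive.
    rcases hasDerivWithinAt_forall_lt_or_forall_gt_of_forall_ne (convex_Ioo p q)
      (fun x hx => (hd x hx).hasDerivWithinAt) hne with h | h
    · exfalso
      have := strictMonoOn_of_hasDerivAt_pos (f := fun x => -f x) (f' := fun x => -f' x) hc.neg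
        (fun x hx => (hd x hx).neg) (fun x hx => neg_pos.2 (h x hx))
      have := this (left_mem_Icc.2 hpq.le) (right_mem_Icc.2 hpq.le) hpq
      simp only at this
      linarith
    · exact h
  rw [setIntegral_Ioo_comp hpq.le hc hd hpos, setIntegral_congr_fun (g := fun _ => r) measurableSet_Ioo]
  · simp [hpq.le, mul_comm]
  · intro x hx
    have h1 : f' x = r * √(P (f x)) := by
      rw [← Real.sqrt_sq (hpos x hx).le, hP x hx, Real.sqrt_mul (sq_nonneg r), Real.sqrt_sq hr]
    have h2 : √(P (f x)) ≠ 0 := fun h0 => hne x hx (by rw [h1, h0, mul_zero])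
    simp only
    rw [h1]
    field_simp

end ChangeOfVariables

/-- The complete integral `∫_0^a dx / √((c² - x²)(a² - x²))`. -/
noncomputable def ellipticOne (c a : ℝ) : ℝ := ∫ x in Ioo 0 a, 1 / √((c ^ 2 - x ^ 2) * (a ^ 2 - x ^ 2))

/-- The complete integral `∫_a^c dx / √((c² - x²)(x² - a²))`. -/
noncomputable def ellipticTwo (c a : ℝ) : ℝ := ∫ x in Ioo a c, 1 / √((c ^ 2 - x ^ 2) * (x ^ 2 - a ^ 2))

/-! ### Reality of the Wronskian and the period relation -/

lemma hasDerivAt_re_of_real {F : ℝ → ℂ} {g : ℝ → ℝ} (h : ∀ y, F y = g y) {d : ℂ} {x : ℝ}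
    (hd : HasDerivAt F d x) : HasDerivAt g d.re x ∧ (d.re : ℂ) = d := by
  have h1 : HasDerivAt g d.re x := by
    have := (Complex.reCLM.hasFDerivAt.comp_hasDerivAt x hd)
    refine this.congr_of_eventuallyEq (Eventually.of_forall fun y => ?_)
    simp [h y]
  refine ⟨h1, ?_⟩
  have h2 := h1.ofReal_comp
  rw [funext h] at hd
  exact h2.unique hd

lemma evenKernel_pos (x : ℝ) {t : ℝ} (ht : 0 < t) :
    0 < HurwitzZeta.evenKernel (x : UnitAddCircle) t := by
  have hs := HurwitzZeta.hasSum_int_evenKernel x ht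
  rw [← hs.tsum_eq]
  exact hs.summable.tsum_pos (fun n => (Real.exp_pos _).le) 0 (Real.exp_pos _)

lemma jacobiTheta₂_I_mul_ne_zero {s : ℝ} (hs : 0 < s) (y : ℝ) :
    jacobiTheta₂ (I * y) (I * s) ≠ 0 := by
  have h := HurwitzZeta.evenKernel_def (y / s) s
  have h2 := (evenKernel_pos (y / s) hs).ne'
  have h3 : ((y / s : ℝ) : ℂ) * I * s = I * y := by
    push_cast
    have : (s : ℂ) ≠ 0 := by exact_mod_cast hs.ne'
    field_simp
  rw [h3] at h
  intro h0
  rw [h0, mul_zero] at h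
  exact h2 (by exact_mod_cast h)

lemma conj_jacobiTheta₂_I_mul (s y : ℝ) :
    (starRingEnd ℂ) (jacobiTheta₂ (I * y) (I * s)) = jacobiTheta₂ (I * y) (I * s) := by
  rw [jacobiTheta₂_conj, ← jacobiTheta₂_neg_left (I * y)]
  congr 1 <;> simp

lemma conj_thetaTwo_I_mul (s y : ℝ) :
    (starRingEnd ℂ) (thetaTwo (I * y) (I * s)) = thetaTwo (I * y) (I * s) := by
  have h := conj_jacobiTheta₂_I_mul s (y + s / 2)
  have e : I * (y : ℂ) + I * s / 2 = I * ((y + s / 2 : ℝ) : ℂ) := by push_cast; ring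
  rw [thetaTwo, e, map_mul, h, ← Complex.exp_conj]
  congr 2
  simp only [map_mul, map_add, map_div₀, conj_ofReal, conj_I, map_ofNat]
  ring

/-- The modular transformation moves the line `iy + 1/2` to the real line shifted by half a period,
where `θ₃` is a nonzero multiple of `θ₂(y/s | i/s)`, whose real zeros are known. -/
lemma jacobiTheta₂_I_mul_add_half_ne_zero {s : ℝ} (hs : 0 < s) {y : ℝ}
    (hy : Real.cos (Real.pi * (y / s)) ≠ 0) : jacobiTheta₂ (I * y + 1 / 2) (I * s) ≠ 0 := by
  have hsc : (s : ℂ) ≠ 0 := by exact_mod_cast hs.ne'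
  rw [jacobiTheta₂_functional_equation]
  have e1 : (I * (y : ℂ) + 1 / 2) / (I * s) = -(-((y / s : ℝ) : ℂ) + I * ((1 / s : ℝ) : ℂ) / 2) := by
    push_cast
    field_simp
    linear_combination (1 : ℂ) * I_sq
  have e2 : -1 / (I * (s : ℂ)) = I * ((1 / s : ℝ) : ℂ) := by
    push_cast
    field_simp
    linear_combination -(1 : ℂ) * I_sq
  rw [e1, e2, jacobiTheta₂_neg_left, jacobiTheta₂_add_half_period, thetaTwo_neg, ← ofReal_thetaTwoRe]
  have h1 : (thetaTwoRe (1 / s) (y / s) : ℂ) ≠ 0 := by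
    exact_mod_cast thetaTwoRe_ne_zero (one_div_pos.2 hs) hy
  have h2 : (-I * (I * (s : ℂ))) ^ (1 / 2 : ℂ) ≠ 0 := by
    rw [show -I * (I * (s : ℂ)) = s by linear_combination (-(s : ℂ)) * I_sq]
    simp [Complex.cpow_eq_zero_iff, hsc]
  exact mul_ne_zero (mul_ne_zero (one_div_ne_zero h2) (Complex.exp_ne_zero _))
    (mul_ne_zero (Complex.exp_ne_zero _) h1)

/-- The ratio `θ₂(0 | is) / θ₃(0 | is)`. -/
noncomputable def thetaRatio (s : ℝ) : ℝ := thetaTwoRe s 0 / thetaThreeRe s 0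

lemma thetaRatio_pos {s : ℝ} (hs : 0 < s) : 0 < thetaRatio s :=
  div_pos (thetaTwoRe_zero_pos hs) (thetaThreeRe_pos hs 0)

/-- Jacobi's quartic identity, with `θ₄(0)` written as `θ₃(1/2)`. It shows that `thetaRatio` is less
than `1`. -/
lemma thetaThreeRe_half_pow_four {s : ℝ} (hs : 0 < s) :
    thetaThreeRe s (1 / 2) ^ 4 = thetaThreeRe s 0 ^ 4 - thetaTwoRe s 0 ^ 4 := by
  have h := jacobiTheta₂_sq_half 0 (im_I_mul_pos hs)
  have h1 := ofReal_thetaThreeRe s (1 / 2)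
  have h2 := ofReal_thetaThreeRe s 0
  have h3 := ofReal_thetaTwoRe s 0
  push_cast at h1 h2 h3
  rw [zero_add, ← h1, ← h2, ← h3] at h
  have h' : thetaThreeRe s (1 / 2) ^ 2 * thetaThreeRe s (1 / 2) ^ 2 =
      thetaThreeRe s 0 ^ 2 * thetaThreeRe s 0 ^ 2 - thetaTwoRe s 0 ^ 2 * thetaTwoRe s 0 ^ 2 := by
    exact_mod_cast h
  linear_combination h'

lemma thetaRatio_lt_one {s : ℝ} (hs : 0 < s) : thetaRatio s < 1 := by
  have h3 := thetaThreeRe_pos hs 0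
  have h2 := thetaTwoRe_zero_pos hs
  rw [thetaRatio, div_lt_one h3]
  have := thetaThreeRe_half_pow_four hs
  have h4 : 0 < thetaThreeRe s (1 / 2) ^ 4 := pow_pos (thetaThreeRe_pos hs _) 4
  exact lt_of_pow_lt_pow_left₀ 4 h3.le (by linarith)

/-- The real form of the Wronskian identity. -/
lemma exists_real_thetaWronskian_eq {s : ℝ} (hs : 0 < s) :
    ∃ c : ℝ, c ≠ 0 ∧ ∀ z, thetaWronskian (I * s) z =
      c * (jacobiTheta₂ (z + 1 / 2) (I * s) * thetaTwo (z + 1 / 2) (I * s)) := by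
  have hT := im_I_mul_pos hs
  have hda := differentiable_jacobiTheta₂ hT
  have hdb := differentiable_thetaTwo hT
  have pA := thetaThreeRe_pos hs 0
  have pB := thetaTwoRe_zero_pos hs
  have hA0 := ofReal_thetaThreeRe s 0
  have hB0 := ofReal_thetaTwoRe s 0
  have hH := ofReal_thetaThreeRe s (1 / 2)
  push_cast at hA0 hB0 hH
  have hA0' : (thetaThreeRe s 0 : ℂ) ≠ 0 := by exact_mod_cast pA.ne'
  have hB0' : (thetaTwoRe s 0 : ℂ) ≠ 0 := by exact_mod_cast pB.ne'
  obtain ⟨c, hc⟩ := exists_thetaWronskian_eq hT ⟨0, by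
    rw [← hA0, ← hB0]; exact mul_ne_zero hB0' hA0'⟩
  have hbr := hasDerivAt_re_of_real (F := fun y : ℝ => thetaTwo y (I * s)) (g := thetaTwoRe s)
    (fun y => (ofReal_thetaTwoRe s y).symm) (x := 1 / 2)
    (HasDerivAt.comp_ofReal (hdb _).hasDerivAt)
  set d := deriv (fun z => thetaTwo z (I * s)) ((1 / 2 : ℝ) : ℂ) with hd
  -- At `z = 1/2`, where `θ₂` vanishes, the identity expresses `c` through real quantities.
  have hhalf := hc ((1 / 2 : ℝ) : ℂ)
  rw [thetaWronskian, ← hd, ← hbr.2, ← ofReal_thetaThreeRe, show (((1 / 2 : ℝ) : ℂ) + 1 / 2) = 0 + 1 by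
    push_cast; norm_num, jacobiTheta₂_add_left, thetaTwo_add_one, ← hA0, ← hB0] at hhalf
  rw [show ((1 / 2 : ℝ) : ℂ) = 1 / 2 by push_cast; rfl, thetaTwo_half] at hhalf
  have hcr : c = ((thetaThreeRe s (1 / 2) * d.re / (thetaThreeRe s 0 * thetaTwoRe s 0) : ℝ) : ℂ) := by
    push_cast
    rw [eq_div_iff (mul_ne_zero hA0' hB0')]
    linear_combination hhalf
  refine ⟨thetaThreeRe s (1 / 2) * d.re / (thetaThreeRe s 0 * thetaTwoRe s 0), ?_, by
    rw [← hcr]; exact hc⟩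
  intro h0
  rw [h0] at hcr
  have hW : ∀ z, thetaWronskian (I * s) z = 0 := fun z => by rw [hc, hcr]; simp
  -- If `c` were zero, `θ₂/θ₃` would be constant on the real line, but it is nonzero at `0` and zero
  -- at `1/2`.
  have hconst : ∀ x : ℝ, HasDerivAt (fun y : ℝ => thetaTwo y (I * s) / jacobiTheta₂ y (I * s)) 0 x := by
    intro x
    have hne : jacobiTheta₂ x (I * s) ≠ 0 := by
      rw [← ofReal_thetaThreeRe]; exact_mod_cast (thetaThreeRe_pos hs x).ne'
    have := HasDerivAt.comp_ofReal ((hdb x).hasDerivAt.div (hda x).hasDerivAt hne)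
    refine this.congr_deriv ?_
    have h := hW x
    rw [thetaWronskian] at h
    rw [div_eq_zero_iff]
    left
    linear_combination -h
  have heq := is_const_of_deriv_eq_zero (fun x => (hconst x).differentiableAt)
    (fun x => (hconst x).deriv) 0 (1 / 2)
  rw [show ((1 / 2 : ℝ) : ℂ) = 1 / 2 by push_cast; rfl, thetaTwo_half, zero_div, ofReal_zero,
    ← hA0, ← hB0] at heq
  exact div_ne_zero hB0' hA0' heq

/-- The first-order differential equation of `θ₃ / θ₂`, in terms of the Wronskian. -/
lemma exists_thetaWronskian_sq {s : ℝ} (hs : 0 < s) :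
    ∃ r : ℝ, 0 < r ∧ (∀ z, thetaWronskian (I * s) z ^ 2 = (r : ℂ) ^ 2 *
      ((jacobiTheta₂ z (I * s) ^ 2 - (thetaRatio s : ℂ) ^ 2 * thetaTwo z (I * s) ^ 2) *
      (jacobiTheta₂ z (I * s) ^ 2 - thetaTwo z (I * s) ^ 2 / (thetaRatio s : ℂ) ^ 2))) ∧
      ∀ z, jacobiTheta₂ (z + 1 / 2) (I * s) ≠ 0 → thetaTwo (z + 1 / 2) (I * s) ≠ 0 →
        thetaWronskian (I * s) z ≠ 0 := by
  obtain ⟨c, hc0, hc⟩ := exists_real_thetaWronskian_eq hs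
  have hT := im_I_mul_pos hs
  have pA := thetaThreeRe_pos hs 0
  have pB := thetaTwoRe_zero_pos hs
  have pH := thetaThreeRe_pos hs (1 / 2)
  have hA0 := ofReal_thetaThreeRe s 0
  have hB0 := ofReal_thetaTwoRe s 0
  have hH := ofReal_thetaThreeRe s (1 / 2)
  push_cast at hA0 hB0 hH
  have hA0' : (thetaThreeRe s 0 : ℂ) ≠ 0 := by exact_mod_cast pA.ne'
  have hB0' : (thetaTwoRe s 0 : ℂ) ≠ 0 := by exact_mod_cast pB.ne'
  have hH' : (thetaThreeRe s (1 / 2) : ℂ) ≠ 0 := by exact_mod_cast pH.ne'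
  refine ⟨|c| * (thetaThreeRe s 0 * thetaTwoRe s 0) / thetaThreeRe s (1 / 2) ^ 2,
    div_pos (mul_pos (abs_pos.2 hc0) (mul_pos pA pB)) (pow_pos pH 2), fun z => ?_, fun z h1 h2 => ?_⟩
  -- Squaring the Wronskian identity leaves the squares of the half-shifted thetas, which are
  -- quadratic forms in `θ₃(z)²` and `θ₂(z)²`. This yields the quartic and the value of `r`.
  · have h1 := jacobiTheta₂_sq_half z hT
    have h2 := thetaTwo_sq_half z hT
    have habs : ((|c| : ℝ) : ℂ) ^ 2 = (c : ℂ) ^ 2 := by exact_mod_cast sq_abs c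
    rw [← hA0, ← hB0, ← hH] at h1 h2
    rw [hc, thetaRatio]
    push_cast
    rw [div_pow, mul_pow (((|c| : ℝ) : ℂ)), habs]
    generalize jacobiTheta₂ (z + 1 / 2) (I * s) = u at *
    generalize thetaTwo (z + 1 / 2) (I * s) = v at *
    field_simp
    linear_combination (c : ℂ) ^ 2 * (u ^ 2 * thetaThreeRe s (1 / 2) ^ 2) * h2 +
      (c : ℂ) ^ 2 * (jacobiTheta₂ z (I * s) ^ 2 * thetaTwoRe s 0 ^ 2 - thetaTwo z (I * s) ^ 2 * thetaThreeRe s 0 ^ 2) * h1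
  · rw [hc]
    exact mul_ne_zero (by exact_mod_cast hc0) (mul_ne_zero h1 h2)

/-- The period relation: the moduli and half-periods of the curve attached to `θ( · | is)`. -/
lemma exists_period_relation {s : ℝ} (hs : 0 < s) :
    ∃ r : ℝ, 0 < r ∧ (∀ z, thetaWronskian (I * s) z ^ 2 = (r : ℂ) ^ 2 *
      ((jacobiTheta₂ z (I * s) ^ 2 - (thetaRatio s : ℂ) ^ 2 * thetaTwo z (I * s) ^ 2) *
      (jacobiTheta₂ z (I * s) ^ 2 - thetaTwo z (I * s) ^ 2 / (thetaRatio s : ℂ) ^ 2))) ∧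
      ellipticOne (thetaRatio s)⁻¹ (thetaRatio s) = r * (1 / 2) ∧
      ellipticTwo (thetaRatio s)⁻¹ (thetaRatio s) = r * (s / 2) := by
  obtain ⟨r, hr, hW, hne⟩ := exists_thetaWronskian_sq hs
  have hT := im_I_mul_pos hs
  have hda := differentiable_jacobiTheta₂ hT
  have hdb := differentiable_thetaTwo hT
  have pA := thetaThreeRe_pos hs 0
  have pB := thetaTwoRe_zero_pos hs
  have hA0 := ofReal_thetaThreeRe s 0
  have hB0 := ofReal_thetaTwoRe s 0
  push_cast at hA0 hB0
  have he0 := thetaRatio_pos hs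
  have he1 := thetaRatio_lt_one hs
  have he0' : (thetaRatio s : ℂ) ≠ 0 := by exact_mod_cast he0.ne'
  have heR : (thetaRatio s : ℂ) = thetaTwo 0 (I * s) / jacobiTheta₂ 0 (I * s) := by
    rw [← hA0, ← hB0, thetaRatio]; push_cast; rfl
  have hder : ∀ z, jacobiTheta₂ z (I * s) ≠ 0 →
      HasDerivAt (fun z => thetaTwo z (I * s) / jacobiTheta₂ z (I * s))
        (-thetaWronskian (I * s) z / jacobiTheta₂ z (I * s) ^ 2) z := fun z hz => by
    refine ((hdb z).hasDerivAt.div (hda z).hasDerivAt hz).congr_deriv ?_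
    rw [thetaWronskian]
    ring
  refine ⟨r, hr, hW, ?_, ?_⟩
  · have hax : ∀ x : ℝ, jacobiTheta₂ x (I * s) ≠ 0 := fun x => by
      rw [← ofReal_thetaThreeRe]; exact_mod_cast (thetaThreeRe_pos hs x).ne'
    -- Read backwards along the real half period, `θ₂/θ₃` increases from `0` at `1/2` to `thetaRatio
    -- s` at `0`.
    have hF : ∀ x : ℝ, HasDerivAt (fun x : ℝ => thetaTwo ((1 / 2 - x : ℝ) : ℂ) (I * s) /
        jacobiTheta₂ ((1 / 2 - x : ℝ) : ℂ) (I * s))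
        (thetaWronskian (I * s) ((1 / 2 - x : ℝ) : ℂ) /
          jacobiTheta₂ ((1 / 2 - x : ℝ) : ℂ) (I * s) ^ 2) x := fun x => by
      have h1 : HasDerivAt (fun x : ℝ => ((1 / 2 - x : ℝ) : ℂ)) (-1 : ℂ) x := by
        have := ((hasDerivAt_id x).const_sub (1 / 2)).ofReal_comp
        refine this.congr_deriv ?_
        push_cast; rfl
      refine (HasDerivAt.comp x (hder ((1 / 2 - x : ℝ) : ℂ) (hax _)) h1).congr_deriv ?_
      ring
    have hreal := fun x : ℝ => hasDerivAt_re_of_real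
      (g := fun x => thetaTwoRe s (1 / 2 - x) / thetaThreeRe s (1 / 2 - x)) (fun y => by
        rw [← ofReal_thetaTwoRe, ← ofReal_thetaThreeRe]; push_cast; rfl) (hF x)
    have h0 : thetaTwoRe s (1 / 2) = 0 := by
      apply ofReal_injective
      rw [ofReal_thetaTwoRe]
      push_cast
      exact thetaTwo_half _
    have key := setIntegral_one_div_sqrt_eq (p := 0) (q := 1 / 2) (by norm_num)
      (fun x _ => (hreal x).1.continuousAt.continuousWithinAt) (fun x _ => (hreal x).1) ?_ ?_ hr.le
      (P := fun y => ((thetaRatio s)⁻¹ ^ 2 - y ^ 2) * (thetaRatio s ^ 2 - y ^ 2)) ?_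
    · simp only [sub_zero, sub_self, h0, zero_div] at key
      exact key
    · intro x hx h0
      have h1 := (hreal x).2
      have hcast : ((1 / 2 - x : ℝ) : ℂ) + 1 / 2 = ((1 / 2 - x + 1 / 2 : ℝ) : ℂ) := by push_cast; rfl
      rw [h0, ofReal_zero, eq_comm, div_eq_zero_iff] at h1
      rcases h1 with h1 | h1
      · revert h1
        apply hne
        · rw [hcast]
          exact hax _
        · have : thetaTwoRe s (1 / 2 - x + 1 / 2) ≠ 0 := by
            apply thetaTwoRe_ne_zero hs
            rw [show Real.pi * (1 / 2 - x + 1 / 2) = Real.pi - Real.pi * x by ring, Real.cos_pi_sub]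
            have := Real.cos_pos_of_mem_Ioo (x := Real.pi * x)
              ⟨by nlinarith [Real.pi_pos, hx.1], by nlinarith [Real.pi_pos, hx.2]⟩
            linarith
          have h2 : (thetaTwoRe s (1 / 2 - x + 1 / 2) : ℂ) ≠ 0 := by exact_mod_cast this
          rwa [ofReal_thetaTwoRe, ← hcast] at h2
      · exact pow_ne_zero 2 (hax _) h1
    · simp only [sub_zero, sub_self, h0, zero_div]
      exact he0
    · intro x _
      apply ofReal_injective
      rw [ofReal_pow, (hreal x).2, div_pow, hW]
      have := hax (1 / 2 - x)
      push_cast [ofReal_thetaTwoRe, ofReal_thetaThreeRe] at this ⊢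
      generalize jacobiTheta₂ (1 / 2 - (x : ℂ)) (I * s) = u at *
      generalize thetaTwo (1 / 2 - (x : ℂ)) (I * s) = v at *
      field_simp
  · have hay := jacobiTheta₂_I_mul_ne_zero hs
    -- Along the imaginary half period `θ₂/θ₃` stays real and goes from `thetaRatio s` to its
    -- inverse, because `is/2` swaps the two thetas. The factor `i` of the direction changes the
    -- sign of the quartic.
    have hF : ∀ y : ℝ, HasDerivAt (fun y : ℝ => thetaTwo (I * y) (I * s) / jacobiTheta₂ (I * y) (I * s))
        (-I * thetaWronskian (I * s) (I * y) / jacobiTheta₂ (I * y) (I * s) ^ 2) y := fun y => by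
      have h1 : HasDerivAt (fun y : ℝ => I * (y : ℂ)) I y := by
        have := ((hasDerivAt_id y).ofReal_comp).const_mul I
        refine this.congr_deriv ?_
        simp
      refine ((hder _ (hay _)).comp y h1).congr_deriv ?_
      ring
    have hreal := fun y : ℝ => hasDerivAt_re_of_real
      (g := fun y : ℝ => (thetaTwo (I * y) (I * s) / jacobiTheta₂ (I * y) (I * s)).re) (fun y => by
        rw [eq_comm, ← Complex.conj_eq_iff_re, map_div₀, conj_thetaTwo_I_mul,
          conj_jacobiTheta₂_I_mul]) (hF y)
    have hval0 : (thetaTwo (I * (0 : ℝ)) (I * s) / jacobiTheta₂ (I * (0 : ℝ)) (I * s)).re =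
        thetaRatio s := by
      rw [ofReal_zero, mul_zero, ← heR, ofReal_re]
    have hval1 : (thetaTwo (I * (s / 2 : ℝ)) (I * s) / jacobiTheta₂ (I * (s / 2 : ℝ)) (I * s)).re =
        (thetaRatio s)⁻¹ := by
      rw [show I * ((s / 2 : ℝ) : ℂ) = 0 + I * s / 2 by push_cast; ring, jacobiTheta₂_add_half_period,
        thetaTwo_add_half_period, mul_div_mul_left _ _ (Complex.exp_ne_zero _), ← ofReal_re (thetaRatio s)⁻¹,
        ofReal_inv, heR, inv_div]
    have key := setIntegral_one_div_sqrt_eq (p := 0) (q := s / 2) (by positivity)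
      (fun x _ => (hreal x).1.continuousAt.continuousWithinAt) (fun x _ => (hreal x).1) ?_ ?_ hr.le
      (P := fun y => ((thetaRatio s)⁻¹ ^ 2 - y ^ 2) * (y ^ 2 - thetaRatio s ^ 2)) ?_
    · rw [hval0, hval1, sub_zero] at key
      exact key
    · intro y hy h0
      have h1 := (hreal y).2
      have hy1 : 0 < y / s := div_pos hy.1 hs
      have hy2 : y / s < 1 / 2 := by rw [div_lt_iff₀ hs]; linarith [hy.2]
      rw [h0, ofReal_zero, eq_comm, div_eq_zero_iff] at h1
      rcases h1 with h1 | h1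
      · have h1' := (mul_eq_zero.1 h1).resolve_left (neg_ne_zero.2 I_ne_zero)
        revert h1'
        apply hne
        · apply jacobiTheta₂_I_mul_add_half_ne_zero hs
          exact (Real.cos_pos_of_mem_Ioo
              ⟨by nlinarith [Real.pi_pos], by nlinarith [Real.pi_pos]⟩).ne'
        · rw [thetaTwo, show I * (y : ℂ) + 1 / 2 + I * s / 2 = I * ((y + s / 2 : ℝ) : ℂ) + 1 / 2 by
            push_cast; ring]
          refine mul_ne_zero (Complex.exp_ne_zero _) (jacobiTheta₂_I_mul_add_half_ne_zero hs ?_)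
          rw [show Real.pi * ((y + s / 2) / s) = Real.pi * (y / s) + Real.pi / 2 by field_simp,
            Real.cos_add_pi_div_two]
          exact neg_ne_zero.2 (Real.sin_pos_of_pos_of_lt_pi (by positivity)
            (by nlinarith [Real.pi_pos])).ne'
      · exact pow_ne_zero 2 (hay _) h1
    · rw [hval0, hval1]
      exact he1.trans ((one_lt_inv₀ he0).2 he1)
    · intro y _
      apply ofReal_injective
      have hg : (((thetaTwo (I * y) (I * s) / jacobiTheta₂ (I * y) (I * s)).re : ℝ) : ℂ) =
          thetaTwo (I * y) (I * s) / jacobiTheta₂ (I * y) (I * s) := by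
        rw [← Complex.conj_eq_iff_re, map_div₀, conj_thetaTwo_I_mul, conj_jacobiTheta₂_I_mul]
      rw [ofReal_pow, (hreal y).2, div_pow, mul_pow, hW]
      have := hay y
      push_cast
      rw [hg, neg_sq, I_sq]
      field_simp
      ring

/-! ### Complete elliptic integrals in trigonometric form -/

/-- The complete elliptic integral of the first kind, of modulus `m`. -/
noncomputable def ellipticK (m : ℝ) : ℝ := ∫ θ in (0 : ℝ)..(Real.pi / 2), 1 / √(1 - m ^ 2 * Real.sin θ ^ 2)

/-- The complementary complete elliptic integral of the first kind. -/
noncomputable def ellipticK' (m : ℝ) : ℝ :=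
  ∫ θ in (0 : ℝ)..(Real.pi / 2), 1 / √(m ^ 2 * Real.cos θ ^ 2 + Real.sin θ ^ 2)

lemma one_sub_sq_mul_sin_sq_pos {m : ℝ} (h0 : 0 ≤ m) (h1 : m < 1) (θ : ℝ) :
    0 < 1 - m ^ 2 * Real.sin θ ^ 2 := by
  have := Real.sin_sq_le_one θ
  nlinarith [sq_nonneg (Real.sin θ)]

lemma sq_mul_cos_sq_add_sin_sq_pos {m : ℝ} (h0 : 0 < m) (θ : ℝ) :
    0 < m ^ 2 * Real.cos θ ^ 2 + Real.sin θ ^ 2 := by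
  rcases eq_or_ne (Real.sin θ) 0 with h | h
  · have : Real.cos θ ^ 2 = 1 := by have := Real.sin_sq_add_cos_sq θ; rw [h] at this; linarith
    rw [this, h]; positivity
  · positivity

lemma continuous_ellipticK_integrand {m : ℝ} (h0 : 0 ≤ m) (h1 : m < 1) :
    Continuous fun θ => 1 / √(1 - m ^ 2 * Real.sin θ ^ 2) := by
  refine continuous_const.div (by fun_prop) fun θ => ?_
  exact (Real.sqrt_pos.2 (one_sub_sq_mul_sin_sq_pos h0 h1 θ)).ne'

lemma continuous_ellipticK'_integrand {m : ℝ} (h0 : 0 < m) :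
    Continuous fun θ => 1 / √(m ^ 2 * Real.cos θ ^ 2 + Real.sin θ ^ 2) := by
  refine continuous_const.div (by fun_prop) fun θ => ?_
  exact (Real.sqrt_pos.2 (sq_mul_cos_sq_add_sin_sq_pos h0 θ)).ne'

lemma ellipticK_pos {m : ℝ} (h0 : 0 ≤ m) (h1 : m < 1) : 0 < ellipticK m :=
  intervalIntegral.intervalIntegral_pos_of_pos
    ((continuous_ellipticK_integrand h0 h1).intervalIntegrable _ _)
    (fun θ => one_div_pos.2 (Real.sqrt_pos.2 (one_sub_sq_mul_sin_sq_pos h0 h1 θ))) (by positivity)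

lemma ellipticK'_pos {m : ℝ} (h0 : 0 < m) : 0 < ellipticK' m :=
  intervalIntegral.intervalIntegral_pos_of_pos
    ((continuous_ellipticK'_integrand h0).intervalIntegrable _ _)
    (fun θ => one_div_pos.2 (Real.sqrt_pos.2 (sq_mul_cos_sq_add_sin_sq_pos h0 θ))) (by positivity)

lemma ellipticK_mono {m n : ℝ} (h0 : 0 ≤ m) (hmn : m ≤ n) (h1 : n < 1) :
    ellipticK m ≤ ellipticK n := by
  refine intervalIntegral.integral_mono_on (by positivity)
    ((continuous_ellipticK_integrand h0 (hmn.trans_lt h1)).intervalIntegrable _ _)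
    ((continuous_ellipticK_integrand (h0.trans hmn) h1).intervalIntegrable _ _) fun θ _ => ?_
  have := one_sub_sq_mul_sin_sq_pos (h0.trans hmn) h1 θ
  gcongr

lemma ellipticK'_strictAnti {m n : ℝ} (h0 : 0 < m) (hmn : m < n) : ellipticK' n < ellipticK' m := by
  refine intervalIntegral.integral_lt_integral_of_continuousOn_of_le_of_exists_lt (by positivity)
    (continuous_ellipticK'_integrand (h0.trans hmn)).continuousOn
    (continuous_ellipticK'_integrand h0).continuousOn (fun θ _ => ?_) ⟨0, ⟨le_rfl, by positivity⟩, ?_⟩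
  · have := sq_mul_cos_sq_add_sin_sq_pos h0 θ
    gcongr
  · simp only [Real.cos_zero, Real.sin_zero]
    have : 0 < m ^ 2 := by positivity
    have h : m ^ 2 < n ^ 2 := by gcongr
    apply one_div_lt_one_div_of_lt (Real.sqrt_pos.2 (by linarith))
    apply Real.sqrt_lt_sqrt <;> linarith

/-- `K'` strictly decreases and `K` does not decrease, so `K'/K` is strictly decreasing. -/
lemma ellipticK_ratio_injective {m n : ℝ} (hm0 : 0 < m) (hm1 : m < 1) (hn0 : 0 < n) (hn1 : n < 1)
    (h : ellipticK' m / ellipticK m = ellipticK' n / ellipticK n) : m = n := by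
  have aux : ∀ {m n : ℝ}, 0 < m → m < 1 → 0 < n → n < 1 → m < n →
      ellipticK' n / ellipticK n < ellipticK' m / ellipticK m := by
    intro m n hm0 hm1 hn0 hn1 hmn
    exact div_lt_div₀ (ellipticK'_strictAnti hm0 hmn) (ellipticK_mono hm0.le hmn.le hn1)
      (ellipticK'_pos hm0).le (ellipticK_pos hm0.le hm1)
  rcases lt_trichotomy m n with hlt | heq | hgt
  · exact absurd h (aux hm0 hm1 hn0 hn1 hlt).ne'
  · exact heq
  · exact absurd h (aux hn0 hn1 hm0 hm1 hgt).ne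

lemma ellipticK_le {m : ℝ} (h0 : 0 ≤ m) (h1 : m < 1) :
    ellipticK m ≤ Real.pi / 2 * (1 / √(1 - m ^ 2)) := by
  have h : ellipticK m ≤ ∫ _ in (0 : ℝ)..(Real.pi / 2), 1 / √(1 - m ^ 2) := by
    refine intervalIntegral.integral_mono_on (by positivity)
      ((continuous_ellipticK_integrand h0 h1).intervalIntegrable _ _)
      (continuous_const.intervalIntegrable _ _) fun θ _ => ?_
    have := Real.sin_sq_le_one θ
    have h2 : 0 < 1 - m ^ 2 := by nlinarith
    gcongr
    nlinarith [sq_nonneg m]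
  simpa using h

lemma le_ellipticK' {m : ℝ} (h0 : 0 < m) (h1 : m < 1) : Real.pi / 2 ≤ ellipticK' m := by
  have h : ∫ _ in (0 : ℝ)..(Real.pi / 2), (1 : ℝ) ≤ ellipticK' m := by
    refine intervalIntegral.integral_mono_on (by positivity)
      (continuous_const.intervalIntegrable _ _)
      ((continuous_ellipticK'_integrand h0).intervalIntegrable _ _) fun θ _ => ?_
    have hp := sq_mul_cos_sq_add_sin_sq_pos h0 θ
    have hm : m ^ 2 ≤ 1 := by nlinarith
    rw [le_div_iff₀ (Real.sqrt_pos.2 hp), one_mul]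
    refine Real.sqrt_le_one.2 ?_
    nlinarith [Real.sin_sq_add_cos_sq θ, mul_le_mul_of_nonneg_right hm (sq_nonneg (Real.cos θ))]
  simpa using h

lemma sin_pos_of_mem {θ : ℝ} (h : θ ∈ Ioo 0 (Real.pi / 2)) : 0 < Real.sin θ :=
  Real.sin_pos_of_pos_of_lt_pi h.1 (by linarith [h.2, Real.pi_pos])

lemma cos_pos_of_mem {θ : ℝ} (h : θ ∈ Ioo 0 (Real.pi / 2)) : 0 < Real.cos θ :=
  Real.cos_pos_of_mem_Ioo ⟨by linarith [h.1, Real.pi_pos], h.2⟩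

section Substitution

variable {c a : ℝ}

lemma ellipticOne_integrand_comp (ha : 0 < a) (hac : a < c) {θ : ℝ} (h : θ ∈ Ioo 0 (Real.pi / 2)) :
    a * Real.cos θ * (1 / √((c ^ 2 - (a * Real.sin θ) ^ 2) * (a ^ 2 - (a * Real.sin θ) ^ 2))) =
      c⁻¹ * (1 / √(1 - (a / c) ^ 2 * Real.sin θ ^ 2)) := by
  have hc : 0 < c := ha.trans hac
  have hcos := cos_pos_of_mem h
  have hp := one_sub_sq_mul_sin_sq_pos (m := a / c) (by positivity) ((div_lt_one hc).2 hac) θ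
  have e : (c ^ 2 - (a * Real.sin θ) ^ 2) * (a ^ 2 - (a * Real.sin θ) ^ 2) =
      (c * (a * Real.cos θ)) ^ 2 * (1 - (a / c) ^ 2 * Real.sin θ ^ 2) := by
    have : Real.cos θ ^ 2 = 1 - Real.sin θ ^ 2 := by rw [Real.cos_sq']
    rw [mul_pow, mul_pow, mul_pow, this]
    field_simp
  have hs := (Real.sqrt_pos.2 hp).ne'
  rw [e, Real.sqrt_mul (sq_nonneg _), Real.sqrt_sq (by positivity)]
  field_simp

lemma hasDerivAt_mul_sin (a θ : ℝ) : HasDerivAt (fun θ => a * Real.sin θ) (a * Real.cos θ) θ :=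
  (Real.hasDerivAt_sin θ).const_mul a

/-- The substitution `x = a sin θ` removes the endpoint singularity. -/
lemma ellipticOne_eq (ha : 0 < a) (hac : a < c) : ellipticOne c a = c⁻¹ * ellipticK (a / c) := by
  have h := setIntegral_Ioo_comp (p := 0) (q := Real.pi / 2) (by positivity)
    (by fun_prop : ContinuousOn (fun θ => a * Real.sin θ) _) (fun θ _ => hasDerivAt_mul_sin a θ)
    (fun θ hθ => mul_pos ha (cos_pos_of_mem hθ))
    (fun x => 1 / √((c ^ 2 - x ^ 2) * (a ^ 2 - x ^ 2)))
  simp only [Real.sin_zero, Real.sin_pi_div_two, mul_zero, mul_one] at h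
  rw [ellipticOne, h, ellipticK, ← intervalIntegral.integral_const_mul,
    intervalIntegral.integral_of_le (by positivity), integral_Ioc_eq_integral_Ioo]
  exact setIntegral_congr_fun measurableSet_Ioo fun θ hθ => ellipticOne_integrand_comp ha hac hθ

lemma integrableOn_ellipticOne (ha : 0 < a) (hac : a < c) :
    IntegrableOn (fun x => 1 / √((c ^ 2 - x ^ 2) * (a ^ 2 - x ^ 2))) (Ioo 0 a) := by
  have hc : 0 < c := ha.trans hac
  have h := integrableOn_Ioo_comp_iff (p := 0) (q := Real.pi / 2) (by positivity)
    (by fun_prop : ContinuousOn (fun θ => a * Real.sin θ) _) (fun θ _ => hasDerivAt_mul_sin a θ)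
    (fun θ hθ => mul_pos ha (cos_pos_of_mem hθ))
    (fun x => 1 / √((c ^ 2 - x ^ 2) * (a ^ 2 - x ^ 2)))
  simp only [Real.sin_zero, Real.sin_pi_div_two, mul_zero, mul_one] at h
  rw [h, integrableOn_congr_fun (fun θ hθ => ellipticOne_integrand_comp ha hac hθ) measurableSet_Ioo]
  exact ((continuous_const.mul (continuous_ellipticK_integrand (by positivity)
    ((div_lt_one hc).2 hac))).integrableOn_Icc (a := 0) (b := Real.pi / 2)).mono_set Ioo_subset_Icc_self

/-- The substitution `x = √(a² cos² θ + c² sin² θ)` of the band `(a, c)`. -/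
noncomputable def bandParam (c a θ : ℝ) : ℝ := √(a ^ 2 * Real.cos θ ^ 2 + c ^ 2 * Real.sin θ ^ 2)

lemma bandParam_arg_pos (ha : 0 < a) (hac : a < c) (θ : ℝ) :
    0 < a ^ 2 * Real.cos θ ^ 2 + c ^ 2 * Real.sin θ ^ 2 := by
  nlinarith [Real.sin_sq_add_cos_sq θ, sq_nonneg (Real.sin θ), sq_nonneg (Real.cos θ),
    mul_pos ha ha, mul_lt_mul hac hac.le ha (ha.trans hac).le]

lemma hasDerivAt_bandParam (ha : 0 < a) (hac : a < c) (θ : ℝ) :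
    HasDerivAt (bandParam c a) ((c ^ 2 - a ^ 2) * (Real.sin θ * Real.cos θ) / bandParam c a θ) θ := by
  have h1 := (((Real.hasDerivAt_cos θ).pow 2).const_mul (a ^ 2)).add
    (((Real.hasDerivAt_sin θ).pow 2).const_mul (c ^ 2))
  refine (h1.sqrt (bandParam_arg_pos ha hac θ).ne').congr_deriv ?_
  unfold bandParam
  simp only [Pi.add_apply, Pi.pow_apply]
  have := (Real.sqrt_pos.2 (bandParam_arg_pos ha hac θ)).ne'
  field_simp
  simp
  ring

lemma bandParam_pos (ha : 0 < a) (hac : a < c) (θ : ℝ) : 0 < bandParam c a θ :=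
  Real.sqrt_pos.2 (bandParam_arg_pos ha hac θ)

lemma bandParam_deriv_pos (ha : 0 < a) (hac : a < c) {θ : ℝ} (h : θ ∈ Ioo 0 (Real.pi / 2)) :
    0 < (c ^ 2 - a ^ 2) * (Real.sin θ * Real.cos θ) / bandParam c a θ := by
  have h1 : 0 < c ^ 2 - a ^ 2 := by nlinarith
  exact div_pos (mul_pos h1 (mul_pos (sin_pos_of_mem h) (cos_pos_of_mem h))) (bandParam_pos ha hac θ)

lemma bandParam_zero (ha : 0 < a) : bandParam c a 0 = a := by
  simp [bandParam, Real.sqrt_sq ha.le]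

lemma bandParam_pi_div_two (hc : 0 < c) : bandParam c a (Real.pi / 2) = c := by
  simp [bandParam, Real.sqrt_sq hc.le]

lemma bandParam_mul_integrand (ha : 0 < a) (hac : a < c) {θ : ℝ} (h : θ ∈ Ioo 0 (Real.pi / 2)) :
    (c ^ 2 - a ^ 2) * (Real.sin θ * Real.cos θ) / bandParam c a θ *
      (1 / √((c ^ 2 - bandParam c a θ ^ 2) * (bandParam c a θ ^ 2 - a ^ 2))) =
      c⁻¹ * (1 / √((a / c) ^ 2 * Real.cos θ ^ 2 + Real.sin θ ^ 2)) := by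
  have hc : 0 < c := ha.trans hac
  have hsc := mul_pos (sin_pos_of_mem h) (cos_pos_of_mem h)
  have h1 : 0 < c ^ 2 - a ^ 2 := by nlinarith
  have hsq : bandParam c a θ ^ 2 = a ^ 2 * Real.cos θ ^ 2 + c ^ 2 * Real.sin θ ^ 2 :=
    Real.sq_sqrt (bandParam_arg_pos ha hac θ).le
  have e : (c ^ 2 - bandParam c a θ ^ 2) * (bandParam c a θ ^ 2 - a ^ 2) =
      ((c ^ 2 - a ^ 2) * (Real.sin θ * Real.cos θ)) ^ 2 := by
    rw [hsq, mul_pow, mul_pow]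
    have : Real.cos θ ^ 2 = 1 - Real.sin θ ^ 2 := by rw [Real.cos_sq']
    rw [this]
    ring
  have e2 : bandParam c a θ = c * √((a / c) ^ 2 * Real.cos θ ^ 2 + Real.sin θ ^ 2) := by
    rw [bandParam, ← Real.sqrt_sq hc.le, ← Real.sqrt_mul (sq_nonneg c), Real.sqrt_sq hc.le]
    congr 1
    field_simp
  have hb := bandParam_pos ha hac θ
  rw [e, Real.sqrt_sq (mul_pos h1 hsc).le, e2]
  have hs := Real.sqrt_pos.2 (sq_mul_cos_sq_add_sin_sq_pos (m := a / c) (by positivity) θ)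
  have h2 := sin_pos_of_mem h
  have h3 := cos_pos_of_mem h
  field_simp

lemma ellipticTwo_eq (ha : 0 < a) (hac : a < c) : ellipticTwo c a = c⁻¹ * ellipticK' (a / c) := by
  have h := setIntegral_Ioo_comp (p := 0) (q := Real.pi / 2) (by positivity)
    (fun θ _ => (hasDerivAt_bandParam ha hac θ).continuousAt.continuousWithinAt)
    (fun θ _ => hasDerivAt_bandParam ha hac θ) (fun θ hθ => bandParam_deriv_pos ha hac hθ)
    (fun x => 1 / √((c ^ 2 - x ^ 2) * (x ^ 2 - a ^ 2)))
  rw [bandParam_zero ha, bandParam_pi_div_two (ha.trans hac)] at h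
  rw [ellipticTwo, h, ellipticK', ← intervalIntegral.integral_const_mul,
    intervalIntegral.integral_of_le (by positivity), integral_Ioc_eq_integral_Ioo]
  exact setIntegral_congr_fun measurableSet_Ioo fun θ hθ => bandParam_mul_integrand ha hac hθ

lemma integrableOn_ellipticTwo (ha : 0 < a) (hac : a < c) :
    IntegrableOn (fun x => 1 / √((c ^ 2 - x ^ 2) * (x ^ 2 - a ^ 2))) (Ioo a c) := by
  have hc : 0 < c := ha.trans hac
  have h := integrableOn_Ioo_comp_iff (p := 0) (q := Real.pi / 2) (by positivity)
    (fun θ _ => (hasDerivAt_bandParam ha hac θ).continuousAt.continuousWithinAt)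
    (fun θ _ => hasDerivAt_bandParam ha hac θ) (fun θ hθ => bandParam_deriv_pos ha hac hθ)
    (fun x => 1 / √((c ^ 2 - x ^ 2) * (x ^ 2 - a ^ 2)))
  rw [bandParam_zero ha, bandParam_pi_div_two (ha.trans hac)] at h
  rw [h, integrableOn_congr_fun (fun θ hθ => bandParam_mul_integrand ha hac hθ) measurableSet_Ioo]
  exact ((continuous_const.mul (continuous_ellipticK'_integrand (by positivity))).integrableOn_Icc
    (a := 0) (b := Real.pi / 2)).mono_set Ioo_subset_Icc_self

lemma ellipticOne_pos (ha : 0 < a) (hac : a < c) : 0 < ellipticOne c a := by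
  have hc : 0 < c := ha.trans hac
  rw [ellipticOne_eq ha hac]
  exact mul_pos (inv_pos.2 hc) (ellipticK_pos (by positivity) ((div_lt_one hc).2 hac))

lemma ellipticTwo_pos (ha : 0 < a) (hac : a < c) : 0 < ellipticTwo c a := by
  have hc : 0 < c := ha.trans hac
  rw [ellipticTwo_eq ha hac]
  exact mul_pos (inv_pos.2 hc) (ellipticK'_pos (by positivity))

/-- The inversion of the period ratio: at `τ = i K'/K` the theta ratio gives back the modulus. -/
lemma thetaRatio_sq_and_wronskian (ha : 0 < a) (hac : a < c) {s : ℝ}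
    (hs : s = ellipticTwo c a / ellipticOne c a) :
    thetaRatio s ^ 2 = a / c ∧ ∀ z, thetaWronskian (I * s) z ^ 2 =
      ((4 * (a * c) * ellipticOne c a ^ 2 : ℝ) : ℂ) *
      ((jacobiTheta₂ z (I * s) ^ 2 - (a / c : ℂ) * thetaTwo z (I * s) ^ 2) *
      (jacobiTheta₂ z (I * s) ^ 2 - thetaTwo z (I * s) ^ 2 / (a / c : ℂ))) := by
  have hc : 0 < c := ha.trans hac
  have hm0 : 0 < a / c := by positivity
  have hm1 : a / c < 1 := (div_lt_one hc).2 hac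
  have hs0 : 0 < s := hs ▸ div_pos (ellipticTwo_pos ha hac) (ellipticOne_pos ha hac)
  obtain ⟨r, hr, hW, h1, h2⟩ := exists_period_relation hs0
  have he0 := thetaRatio_pos hs0
  have he1 := thetaRatio_lt_one hs0
  set e := thetaRatio s with he
  have hei : e < e⁻¹ := he1.trans ((one_lt_inv₀ he0).2 he1)
  have hd : e / e⁻¹ = e ^ 2 := by field_simp
  have hK := ellipticK_pos (m := e ^ 2) (by positivity) (by nlinarith)
  rw [ellipticOne_eq he0 hei, hd, inv_inv] at h1
  rw [ellipticTwo_eq he0 hei, hd, inv_inv] at h2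
  have hsK : s = ellipticK' (e ^ 2) / ellipticK (e ^ 2) := by
    rw [eq_div_iff hK.ne']
    have : e * (s * ellipticK (e ^ 2)) = e * ellipticK' (e ^ 2) := by linear_combination s * h1 - h2
    exact mul_left_cancel₀ he0.ne' this
  have hsm : s = ellipticK' (a / c) / ellipticK (a / c) := by
    rw [hs, ellipticOne_eq ha hac, ellipticTwo_eq ha hac, mul_div_mul_left _ _ (inv_pos.2 hc).ne']
  have hsq : e ^ 2 = a / c :=
    ellipticK_ratio_injective (by positivity) (by nlinarith) hm0 hm1 (hsK.symm.trans hsm)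
  refine ⟨hsq, fun z => ?_⟩
  have hr2 : r ^ 2 = 4 * (a * c) * ellipticOne c a ^ 2 := by
    rw [hsq] at h1
    rw [ellipticOne_eq ha hac]
    have hr' : r = 2 * (e * ellipticK (a / c)) := by linarith
    rw [hr', mul_pow, mul_pow, hsq]
    field_simp
    ring
  have hsqc : (e : ℂ) ^ 2 = (a / c : ℂ) := by exact_mod_cast congrArg ((↑) : ℝ → ℂ) hsq
  rw [hW, ← hr2, hsqc]
  push_cast
  rfl

end Substitution

/-! ### A uniqueness lemma for quotients of entire functions -/

/-- The second-order equation as a first-order system. The Lipschitz constant depends on `v` only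
through its bound `N`, so it is uniform in time along the path. -/
lemma lipschitzOnWith_cubic_field (v q n : ℂ) {M N : ℝ} (hM : 0 ≤ M) (hv : ‖v‖ ≤ N) :
    LipschitzOnWith (Real.toNNReal (N * (1 + ‖q‖ * (6 * M ^ 2 + ‖n‖))))
      (fun p : ℂ × ℂ => (v * p.2, v * (q * (p.1 * (2 * p.1 ^ 2 - n))))) (Metric.closedBall 0 M) := by
  have hN : 0 ≤ N := (norm_nonneg v).trans hv
  refine LipschitzOnWith.of_dist_le_mul fun x hx y hy => ?_
  rw [Real.coe_toNNReal _ (by positivity), dist_eq_norm, dist_eq_norm]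
  rw [mem_closedBall_zero_iff] at hx hy
  have hx1 : ‖x.1‖ ≤ M := (norm_fst_le x).trans hx
  have hy1 : ‖y.1‖ ≤ M := (norm_fst_le y).trans hy
  have h1 : ‖x.1 - y.1‖ ≤ ‖x - y‖ := norm_fst_le (x - y)
  have h2 : ‖x.2 - y.2‖ ≤ ‖x - y‖ := norm_snd_le (x - y)
  set d := ‖x - y‖ with hd
  have hd0 : 0 ≤ d := norm_nonneg _
  have hK : 0 ≤ ‖q‖ * (6 * M ^ 2 + ‖n‖) := by positivity
  have e1 : v * x.2 - v * y.2 = v * (x.2 - y.2) := by ring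
  have e2 : v * (q * (x.1 * (2 * x.1 ^ 2 - n))) - v * (q * (y.1 * (2 * y.1 ^ 2 - n))) =
      v * (q * ((x.1 - y.1) * (2 * (x.1 ^ 2 + x.1 * y.1 + y.1 ^ 2) - n))) := by ring
  rw [Prod.norm_def]
  refine max_le ?_ ?_
  · simp only [Prod.fst_sub, e1, norm_mul]
    calc ‖v‖ * ‖x.2 - y.2‖ ≤ N * d := by gcongr
      _ ≤ N * (1 + ‖q‖ * (6 * M ^ 2 + ‖n‖)) * d := by
        apply mul_le_mul_of_nonneg_right _ hd0
        nlinarith [mul_nonneg hN hK]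
  · simp only [Prod.snd_sub, e2, norm_mul]
    have h3 : ‖2 * (x.1 ^ 2 + x.1 * y.1 + y.1 ^ 2) - n‖ ≤ 6 * M ^ 2 + ‖n‖ := by
      refine (norm_sub_le _ _).trans ?_
      gcongr
      rw [norm_mul, Complex.norm_ofNat]
      have : ‖x.1 ^ 2 + x.1 * y.1 + y.1 ^ 2‖ ≤ M ^ 2 + M * M + M ^ 2 := by
        refine (norm_add₃_le).trans ?_
        rw [norm_pow, norm_pow, norm_mul]
        gcongr
      linarith
    calc ‖v‖ * (‖q‖ * (‖x.1 - y.1‖ * ‖2 * (x.1 ^ 2 + x.1 * y.1 + y.1 ^ 2) - n‖)) ≤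
        N * (‖q‖ * (d * (6 * M ^ 2 + ‖n‖))) := by gcongr
      _ = N * (‖q‖ * (6 * M ^ 2 + ‖n‖)) * d := by ring
      _ ≤ N * (1 + ‖q‖ * (6 * M ^ 2 + ‖n‖)) * d := by
        apply mul_le_mul_of_nonneg_right _ hd0
        nlinarith

/-- If `a/b` and `X` solve the same autonomous second-order equation along the path `V`, with the
same initial data, and `a`, `b` have no common zero, then `a(V) = X b(V)` and `b(V) ≠ 0`. -/
lemma eq_mul_of_ode {a b Ω : ℂ → ℂ} {q n : ℂ} (hb : Differentiable ℂ b) (ha : Differentiable ℂ a)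
    (hΩ : Differentiable ℂ Ω) (hab : ∀ z, a z = 0 → b z ≠ 0)
    (hE : ∀ z, b z ≠ 0 → HasDerivAt (fun z => a z / b z) (Ω z / b z ^ 2) z)
    (hS : ∀ z, b z ≠ 0 → HasDerivAt (fun z => Ω z / b z ^ 2)
      (q * (a z / b z * (2 * (a z / b z) ^ 2 - n))) z)
    {V v X Y : ℝ → ℂ} (hV : ∀ ρ ∈ Icc (0 : ℝ) 1, HasDerivAt V (v ρ) ρ)
    (hv : ContinuousOn v (Icc 0 1))
    (hX : ∀ ρ ∈ Icc (0 : ℝ) 1, HasDerivAt X (v ρ * Y ρ) ρ)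
    (hY : ∀ ρ ∈ Icc (0 : ℝ) 1, HasDerivAt Y (v ρ * (q * (X ρ * (2 * X ρ ^ 2 - n)))) ρ)
    (h0 : a (V 0) = X 0 * b (V 0)) (h0' : Ω (V 0) = Y 0 * b (V 0) ^ 2) :
    ∀ ρ ∈ Icc (0 : ℝ) 1, a (V ρ) = X ρ * b (V ρ) ∧ b (V ρ) ≠ 0 := by
  have cV : ContinuousOn V (Icc 0 1) := fun ρ hρ => (hV ρ hρ).continuousAt.continuousWithinAt
  have cX : ContinuousOn X (Icc 0 1) := fun ρ hρ => (hX ρ hρ).continuousAt.continuousWithinAt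
  have cY : ContinuousOn Y (Icc 0 1) := fun ρ hρ => (hY ρ hρ).continuousAt.continuousWithinAt
  have caV := ha.continuous.comp_continuousOn cV
  have cbV := hb.continuous.comp_continuousOn cV
  have cΩV := hΩ.continuous.comp_continuousOn cV
  -- A continuity argument: `b` might vanish along the path, so the coincidence set is written
  -- without division and is therefore closed. At its points `b ≠ 0`, since `a` and `b` have no
  -- common zero, so division and ODE uniqueness extend it to the right.
  set s : Set ℝ := {ρ | a (V ρ) = X ρ * b (V ρ) ∧ Ω (V ρ) = Y ρ * b (V ρ) ^ 2} with hs
  have hbne : ∀ ρ ∈ s, b (V ρ) ≠ 0 := fun ρ hρ hb0 => by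
    refine hab _ ?_ hb0
    rw [hρ.1, hb0, mul_zero]
  suffices hsub : Icc (0 : ℝ) 1 ⊆ s from fun ρ hρ => ⟨(hsub hρ).1, hbne ρ (hsub hρ)⟩
  refine IsClosed.Icc_subset_of_forall_mem_nhdsWithin ?_ ⟨h0, h0'⟩ ?_
  · have e : s ∩ Icc 0 1 = Icc 0 1 ∩ (fun ρ => (a (V ρ) - X ρ * b (V ρ), Ω (V ρ) - Y ρ * b (V ρ) ^ 2)) ⁻¹'
        {0} := by
      ext ρ
      simp only [hs, mem_inter_iff, mem_ofPred_eq, mem_preimage, mem_singleton_iff, Prod.mk_eq_zero,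
        sub_eq_zero]
      tauto
    rw [e]
    exact ContinuousOn.preimage_isClosed_of_isClosed
      ((caV.sub (cX.mul cbV)).prodMk (cΩV.sub (cY.mul (cbV.pow 2)))) isClosed_Icc isClosed_singleton
  · rintro x ⟨hxs, hx0, hx1⟩
    have hxI : x ∈ Icc (0 : ℝ) 1 := ⟨hx0, hx1.le⟩
    have hcb : ContinuousAt (fun ρ => b (V ρ)) x :=
      hb.continuous.continuousAt.comp (hV x hxI).continuousAt
    obtain ⟨δ, hδ, hδb⟩ := Metric.eventually_nhds_iff.1 (hcb.eventually_ne (hbne x hxs))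
    set y := min 1 (x + δ / 2) with hy
    have hxy : x < y := lt_min hx1 (by linarith)
    have hsubI : Icc x y ⊆ Icc 0 1 := Icc_subset_Icc hx0 (min_le_left _ _)
    have hbI : ∀ ρ ∈ Icc x y, b (V ρ) ≠ 0 := fun ρ hρ => hδb (by
      rw [Real.dist_eq, abs_of_nonneg (by linarith [hρ.1])]
      have := hρ.2.trans (min_le_right _ _)
      linarith)
    set f : ℝ → ℂ × ℂ := fun ρ => (a (V ρ) / b (V ρ), Ω (V ρ) / b (V ρ) ^ 2) with hf
    set g : ℝ → ℂ × ℂ := fun ρ => (X ρ, Y ρ) with hg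
    have hfd : ∀ ρ ∈ Icc x y, HasDerivAt f (v ρ * (f ρ).2, v ρ * (q * ((f ρ).1 * (2 * (f ρ).1 ^ 2 - n)))) ρ := by
      intro ρ hρ
      have hv' := hV ρ (hsubI hρ)
      have d1 := HasDerivAt.comp_of_eq ρ (hE (V ρ) (hbI ρ hρ)) hv' rfl
      have d2 := HasDerivAt.comp_of_eq ρ (hS (V ρ) (hbI ρ hρ)) hv' rfl
      refine (d1.prodMk d2).congr_deriv ?_
      simp only [hf, mul_comm]
    have hgd : ∀ ρ ∈ Icc x y, HasDerivAt g (v ρ * (g ρ).2, v ρ * (q * ((g ρ).1 * (2 * (g ρ).1 ^ 2 - n)))) ρ :=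
      fun ρ hρ => (hX ρ (hsubI hρ)).prodMk (hY ρ (hsubI hρ))
    have cf : ContinuousOn f (Icc x y) := fun ρ hρ => (hfd ρ hρ).continuousAt.continuousWithinAt
    have cg : ContinuousOn g (Icc x y) := fun ρ hρ => (hgd ρ hρ).continuousAt.continuousWithinAt
    obtain ⟨M₁, hM₁⟩ := isCompact_Icc.exists_bound_of_continuousOn cf
    obtain ⟨M₂, hM₂⟩ := isCompact_Icc.exists_bound_of_continuousOn cg
    obtain ⟨N, hN⟩ := isCompact_Icc.exists_bound_of_continuousOn hv
    have hM : 0 ≤ max M₁ M₂ := (norm_nonneg _).trans ((hM₁ x ⟨le_rfl, hxy.le⟩).trans (le_max_left _ _))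
    have hEq := ODE_solution_unique_of_mem_Icc_right (f := f) (g := g) (a := x) (b := y)
      (v := fun ρ p => (v ρ * p.2, v ρ * (q * (p.1 * (2 * p.1 ^ 2 - n)))))
      (s := fun _ => Metric.closedBall 0 (max M₁ M₂))
      (fun ρ hρ => lipschitzOnWith_cubic_field (v ρ) q n hM (hN ρ (hsubI (Ico_subset_Icc_self hρ))))
      cf (fun ρ hρ => (hfd ρ (Ico_subset_Icc_self hρ)).hasDerivWithinAt)
      (fun ρ hρ => mem_closedBall_zero_iff.2 ((hM₁ ρ (Ico_subset_Icc_self hρ)).trans (le_max_left _ _)))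
      cg (fun ρ hρ => (hgd ρ (Ico_subset_Icc_self hρ)).hasDerivWithinAt)
      (fun ρ hρ => mem_closedBall_zero_iff.2 ((hM₂ ρ (Ico_subset_Icc_self hρ)).trans (le_max_right _ _)))
      (by
        have hbx := hbne x hxs
        simp only [hf, hg, Prod.mk.injEq]
        exact ⟨by rw [div_eq_iff hbx, hxs.1], by rw [div_eq_iff (pow_ne_zero 2 hbx), hxs.2]⟩)
    refine mem_of_superset (Ioo_mem_nhdsGT hxy) fun ρ hρ => ?_
    have hρ' := Ioo_subset_Icc_self hρ
    have hbρ := hbI ρ hρ'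
    have h := hEq hρ'
    simp only [hf, hg, Prod.mk.injEq] at h
    exact ⟨by rw [← h.1, div_mul_cancel₀ _ hbρ], by rw [← h.2, div_mul_cancel₀ _ (pow_ne_zero 2 hbρ)]⟩

lemma differentiable_thetaWronskian {T : ℂ} (hT : 0 < T.im) :
    Differentiable ℂ (thetaWronskian T) := by
  have ha := differentiable_jacobiTheta₂ hT
  have hb := differentiable_thetaTwo hT
  have hda : Differentiable ℂ (deriv fun z => jacobiTheta₂ z T) := fun z =>
    ((ha.contDiff (n := 2)).differentiable_deriv_two) z
  have hdb : Differentiable ℂ (deriv fun z => thetaTwo z T) := fun z =>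
    ((hb.contDiff (n := 2)).differentiable_deriv_two) z
  exact (hda.mul hb).sub (ha.mul hdb)

/-- Differentiating the first-order equation of `θ₃ / θ₂` and cancelling the Wronskian. -/
lemma deriv_thetaWronskian {T R m : ℂ} (hT : 0 < T.im) (hR : R ≠ 0)
    (hhalf : jacobiTheta₂ (1 / 2) T ≠ 0)
    (hW : ∀ z, thetaWronskian T z ^ 2 = R * ((jacobiTheta₂ z T ^ 2 - m * thetaTwo z T ^ 2) *
      (jacobiTheta₂ z T ^ 2 - thetaTwo z T ^ 2 / m))) (z : ℂ) :
    deriv (thetaWronskian T) z * thetaTwo z T -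
      2 * thetaWronskian T z * deriv (fun z => thetaTwo z T) z =
      R * jacobiTheta₂ z T * (2 * jacobiTheta₂ z T ^ 2 - (m + 1 / m) * thetaTwo z T ^ 2) := by
  have ha := differentiable_jacobiTheta₂ hT
  have hb := differentiable_thetaTwo hT
  have hΩ := differentiable_thetaWronskian hT
  have hdb : Differentiable ℂ (deriv fun z => thetaTwo z T) := fun z =>
    ((hb.contDiff (n := 2)).differentiable_deriv_two) z
  have hdΩ : Differentiable ℂ (deriv (thetaWronskian T)) := fun z =>
    ((hΩ.contDiff (n := 2)).differentiable_deriv_two) z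
  set F : ℂ → ℂ := fun z => deriv (thetaWronskian T) z * thetaTwo z T -
      2 * thetaWronskian T z * deriv (fun z => thetaTwo z T) z -
      R * jacobiTheta₂ z T * (2 * jacobiTheta₂ z T ^ 2 - (m + 1 / m) * thetaTwo z T ^ 2) with hF
  have hFd : Differentiable ℂ F :=
    ((hdΩ.mul hb).sub ((hΩ.const_mul 2).mul hdb)).sub
      ((ha.const_mul R).mul (((ha.pow 2).const_mul 2).sub ((hb.pow 2).const_mul _)))
  -- Differentiating the first-order equation gives the claim multiplied by the Wronskian. That
  -- factor is cancelled in the ring of entire functions; were it identically zero, the equation at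
  -- `1/2` would force `θ₃(1/2) = 0`.
  have hprod : ∀ z ∈ (univ : Set ℂ), thetaWronskian T z * F z = 0 := by
    intro z _
    have a' := (ha z).hasDerivAt
    have b' := (hb z).hasDerivAt
    have d1 := ((hΩ z).hasDerivAt).pow 2
    have d2 := (((a'.pow 2).sub ((b'.pow 2).const_mul m)).mul
      ((a'.pow 2).sub ((b'.pow 2).div_const m))).const_mul R
    have d3 := d1.congr_of_eventuallyEq (Eventually.of_forall fun z => (hW z).symm)
    have hu := d3.unique d2
    simp only [Pi.sub_apply, Pi.pow_apply, Nat.cast_ofNat, Nat.add_one_sub_one, pow_one] at hu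
    have hwr : thetaWronskian T z = deriv (fun z => jacobiTheta₂ z T) z * thetaTwo z T -
      jacobiTheta₂ z T * deriv (fun z => thetaTwo z T) z := rfl
    have hW' := hW z
    simp only [hF]
    generalize deriv (thetaWronskian T) z = W' at *
    generalize thetaWronskian T z = W at *
    generalize deriv (fun z => jacobiTheta₂ z T) z = A' at *
    generalize deriv (fun z => thetaTwo z T) z = B' at *
    generalize jacobiTheta₂ z T = A at *
    generalize thetaTwo z T = B at *
    linear_combination (B / 2) * hu - 2 * B' * hW' -
      (R * A * (2 * A ^ 2 - (m + 1 / m) * B ^ 2)) * hwr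
  have hA : AnalyticOnNhd ℂ (thetaWronskian T) univ := Complex.analyticOnNhd_univ_iff_differentiable.2 hΩ
  have hB : AnalyticOnNhd ℂ F univ := Complex.analyticOnNhd_univ_iff_differentiable.2 hFd
  rcases AnalyticOnNhd.eq_zero_or_eq_zero_of_mul_eq_zero hA hB hprod isPreconnected_univ with h | h
  · exfalso
    have h1 := hW (1 / 2)
    rw [h (1 / 2) (mem_univ _), thetaTwo_half] at h1
    simp [hR] at h1
    exact hhalf (by simpa using h1)
  · exact sub_eq_zero.1 (h z (mem_univ _))

/-! ### The functions `w`, `A` off the cut -/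

variable {c a : ℝ} {k : ℂ}

lemma mem_segment_of_sq_eq {σ : ℝ} (hc : 0 < c) (hσ : |σ| ≤ c) (h : k ^ 2 = -(σ : ℂ) ^ 2) :
    k ∈ segment ℝ (-(I * c)) (I * c) := by
  have key : ∀ σ : ℝ, |σ| ≤ c → I * (σ : ℂ) ∈ segment ℝ (-(I * (c : ℂ))) (I * c) := by
    intro σ hσ
    rw [abs_le] at hσ
    refine ⟨(c - σ) / (2 * c), (c + σ) / (2 * c), div_nonneg (by linarith) (by linarith),
      div_nonneg (by linarith) (by linarith), by field_simp; ring, ?_⟩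
    have hc' : (c : ℂ) ≠ 0 := by exact_mod_cast hc.ne'
    simp only [real_smul]
    push_cast
    field_simp
    ring
  have hprod : (k - I * σ) * (k - I * (-σ : ℝ)) = 0 := by
    push_cast
    linear_combination h + (σ : ℂ) ^ 2 * (-I_sq)
  rcases mul_eq_zero.1 hprod with h1 | h1
  · rw [sub_eq_zero.1 h1]; exact key σ hσ
  · rw [sub_eq_zero.1 h1]; exact key (-σ) (by rwa [abs_neg])

section OffCut

variable (hc : 0 < c) (ha : 0 < a) (hac : a < c) (hk : k ∉ segment ℝ (-(I * (c : ℂ))) (I * c))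
include hc hk

lemma ne_zero_of_off_cut : k ≠ 0 := fun h =>
  hk (mem_segment_of_sq_eq (σ := 0) hc (by simpa using hc.le) (by simp [h]))

lemma sq_add_ne_zero_of_off_cut {ρ : ℝ} (hρ : ρ ∈ Icc (0 : ℝ) 1) :
    k ^ 2 + (c : ℂ) ^ 2 * ρ ^ 2 ≠ 0 := fun h => by
  refine hk (mem_segment_of_sq_eq (σ := c * ρ) hc ?_ (by push_cast; linear_combination h))
  rw [abs_of_nonneg (mul_nonneg hc.le hρ.1)]
  nlinarith [hρ.2]

include ha hac in
-- If the ratio were `-v` with `v ≥ 0`, then `k² = -ρ²(a² + vc²)/(1 + v)`. This is `-ρ²` times a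
-- weighted mean of `a²` and `c²`, so `k` would lie on the cut.
lemma ratio_mem_slitPlane {ρ : ℝ} (hρ : ρ ∈ Icc (0 : ℝ) 1) :
    (k ^ 2 + (a : ℂ) ^ 2 * ρ ^ 2) / (k ^ 2 + (c : ℂ) ^ 2 * ρ ^ 2) ∈ slitPlane := by
  by_contra hn
  have hq := sq_add_ne_zero_of_off_cut hc hk hρ
  rw [mem_slitPlane_iff, not_or, not_lt, not_not] at hn
  set z := (k ^ 2 + (a : ℂ) ^ 2 * ρ ^ 2) / (k ^ 2 + (c : ℂ) ^ 2 * ρ ^ 2) with hz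
  obtain ⟨v, hv⟩ : ∃ v : ℝ, v = -z.re := ⟨_, rfl⟩
  have hv0 : 0 ≤ v := by rw [hv]; linarith [hn.1]
  have hzv : z = -(v : ℂ) := by
    apply Complex.ext
    · simp [hv]
    · simp [hn.2]
  rw [hz, div_eq_iff hq] at hzv
  have hv1 : 0 < 1 + v := by linarith
  have hnn : 0 ≤ (a ^ 2 + v * c ^ 2) / (1 + v) := by positivity
  refine hk (mem_segment_of_sq_eq (σ := ρ * √((a ^ 2 + v * c ^ 2) / (1 + v))) hc ?_ ?_)
  · rw [abs_of_nonneg (mul_nonneg hρ.1 (Real.sqrt_nonneg _))]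
    have h1 : √((a ^ 2 + v * c ^ 2) / (1 + v)) ≤ c := by
      rw [Real.sqrt_le_left hc.le, div_le_iff₀ hv1]
      nlinarith
    calc _ ≤ 1 * c := mul_le_mul hρ.2 h1 (Real.sqrt_nonneg _) zero_le_one
      _ = c := one_mul c
  · have h2 : ((√((a ^ 2 + v * c ^ 2) / (1 + v)) : ℝ) : ℂ) ^ 2 = ((a : ℂ) ^ 2 + v * c ^ 2) / (1 + v) := by
      rw [← ofReal_pow, Real.sq_sqrt hnn]; push_cast; rfl
    have hv1' : (1 + v : ℂ) ≠ 0 := by exact_mod_cast hv1.ne'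
    push_cast
    rw [mul_pow, h2]
    field_simp
    linear_combination hzv

end OffCut

/-- The branch `√((k² + a²ρ²)/(k² + c²ρ²))` along the ray through `k`, `ρ = 1` at `k` and `ρ = 0`
at infinity. -/
noncomputable def rayRoot (c a : ℝ) (k : ℂ) (ρ : ℝ) : ℂ :=
  ((k ^ 2 + (a : ℂ) ^ 2 * ρ ^ 2) / (k ^ 2 + (c : ℂ) ^ 2 * ρ ^ 2)) ^ (1 / 2 : ℂ)

lemma cpow_half_sq (z : ℂ) : (z ^ (1 / 2 : ℂ)) ^ 2 = z := by
  rw [← Complex.cpow_nat_mul]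
  norm_num

lemma rayRoot_sq (c a : ℝ) (k : ℂ) (ρ : ℝ) : rayRoot c a k ρ ^ 2 =
    (k ^ 2 + (a : ℂ) ^ 2 * ρ ^ 2) / (k ^ 2 + (c : ℂ) ^ 2 * ρ ^ 2) := cpow_half_sq _

lemma w_div {ρ : ℝ} (hρ : ρ ≠ 0) (c a : ℝ) (k : ℂ) :
    w c a ((ρ⁻¹ : ℝ) * k) = (k ^ 2 + (c : ℂ) ^ 2 * ρ ^ 2) * rayRoot c a k ρ / ρ ^ 2 := by
  have hρ' : (ρ : ℂ) ≠ 0 := by exact_mod_cast hρ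
  have e : ∀ d : ℝ, ((ρ⁻¹ : ℝ) * k) ^ 2 + (d : ℂ) ^ 2 = (k ^ 2 + (d : ℂ) ^ 2 * ρ ^ 2) / ρ ^ 2 := by
    intro d
    push_cast
    field_simp
  rw [w, e, e, rayRoot, div_div_div_cancel_right₀ (pow_ne_zero 2 hρ')]
  ring

lemma w_I_mul {s : ℝ} (h : 0 ≤ (a ^ 2 - s ^ 2) / (c ^ 2 - s ^ 2)) :
    w c a (I * s) = ((c ^ 2 - s ^ 2) * √((a ^ 2 - s ^ 2) / (c ^ 2 - s ^ 2)) : ℝ) := by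
  have e : ∀ d : ℝ, (I * (s : ℂ)) ^ 2 + (d : ℂ) ^ 2 = ((d ^ 2 - s ^ 2 : ℝ) : ℂ) := by
    intro d
    push_cast
    linear_combination (s : ℂ) ^ 2 * I_sq
  rw [w, e, e, ← ofReal_div, show (1 / 2 : ℂ) = ((1 / 2 : ℝ) : ℂ) by push_cast; rfl,
    ← ofReal_cpow h, ← Real.sqrt_eq_rpow, ofReal_mul]

lemma w_I_mul_of_abs_le (ha : 0 < a) (hac : a < c) {s : ℝ} (hs : |s| ≤ a) :
    w c a (I * s) = (√((c ^ 2 - s ^ 2) * (a ^ 2 - s ^ 2)) : ℝ) := by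
  have hs2 : s ^ 2 ≤ a ^ 2 := sq_le_sq' (by linarith [(abs_le.1 hs).1]) (abs_le.1 hs).2
  have hc2 : 0 < c ^ 2 - s ^ 2 := by nlinarith
  rw [w_I_mul (div_nonneg (by linarith) hc2.le)]
  congr 1
  rw [show (c ^ 2 - s ^ 2) * (a ^ 2 - s ^ 2) = (c ^ 2 - s ^ 2) ^ 2 * ((a ^ 2 - s ^ 2) / (c ^ 2 - s ^ 2)) by
    field_simp, Real.sqrt_mul (sq_nonneg _), Real.sqrt_sq hc2.le]

lemma w_I_mul_of_lt (ha : 0 < a) (hac : a < c) {s : ℝ} (hs : c < s) :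
    w c a (I * s) = -(√((s ^ 2 - c ^ 2) * (s ^ 2 - a ^ 2)) : ℝ) := by
  have hc2 : 0 < s ^ 2 - c ^ 2 := by nlinarith
  have ha2 : 0 < s ^ 2 - a ^ 2 := by nlinarith
  have e : (a ^ 2 - s ^ 2) / (c ^ 2 - s ^ 2) = (s ^ 2 - a ^ 2) / (s ^ 2 - c ^ 2) := by
    rw [← neg_div_neg_eq]; congr 1 <;> ring
  have hp : 0 ≤ (s ^ 2 - a ^ 2) / (s ^ 2 - c ^ 2) := div_nonneg ha2.le hc2.le
  rw [w_I_mul (e ▸ hp), e, show (s ^ 2 - c ^ 2) * (s ^ 2 - a ^ 2) =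
    (s ^ 2 - c ^ 2) ^ 2 * ((s ^ 2 - a ^ 2) / (s ^ 2 - c ^ 2)) by field_simp,
    Real.sqrt_mul (sq_nonneg _), Real.sqrt_sq hc2.le, ← ofReal_neg]
  congr 1
  ring

/-- The involution `x ↦ ac/x` exchanges `(0, a)` with `(c, ∞)` and preserves the integrand up to
orientation. -/
lemma setIntegral_Ioi_eq_ellipticOne (ha : 0 < a) (hac : a < c) :
    ∫ s in Ioi c, 1 / √((s ^ 2 - c ^ 2) * (s ^ 2 - a ^ 2)) = ellipticOne c a := by
  have hc : 0 < c := ha.trans hac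
  have himg : (fun x => a * c / x) '' Ioo 0 a = Ioi c := by
    ext y
    simp only [mem_image, mem_Ioo, mem_Ioi]
    constructor
    · rintro ⟨x, ⟨h0, h1⟩, rfl⟩
      rw [lt_div_iff₀ h0]
      nlinarith
    · intro hy
      have hy0 : 0 < y := hc.trans hy
      refine ⟨a * c / y, ⟨by positivity, ?_⟩, by field_simp⟩
      rw [div_lt_iff₀ hy0]
      nlinarith
  rw [← himg, integral_image_eq_integral_abs_deriv_smul (f' := fun x => -(a * c) / x ^ 2) measurableSet_Ioo]
  · refine setIntegral_congr_fun measurableSet_Ioo fun x hx => ?_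
    have hx0 := hx.1
    have hxa : 0 < a ^ 2 - x ^ 2 := by nlinarith [hx.1, hx.2]
    have hxc : 0 < c ^ 2 - x ^ 2 := by nlinarith
    have e : ((a * c / x) ^ 2 - c ^ 2) * ((a * c / x) ^ 2 - a ^ 2) =
        (a * c / x ^ 2) ^ 2 * ((c ^ 2 - x ^ 2) * (a ^ 2 - x ^ 2)) := by
      field_simp
    have hs := Real.sqrt_pos.2 (mul_pos hxc hxa)
    simp only [smul_eq_mul]
    rw [e, Real.sqrt_mul (sq_nonneg _), Real.sqrt_sq (by positivity), neg_div, abs_neg,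
      abs_of_pos (by positivity)]
    field_simp
  · intro x hx
    refine HasDerivAt.hasDerivWithinAt ?_
    refine ((hasDerivAt_inv hx.1.ne').const_mul (a * c)).congr_deriv ?_ |>.congr_of_eventuallyEq ?_
    · ring
    · exact Eventually.of_forall fun y => div_eq_mul_inv _ _
  · intro x hx y hy hxy
    have hx0 := hx.1.ne'
    have hy0 := hy.1.ne'
    simp only at hxy
    field_simp at hxy
    exact hxy.symm

lemma integral_symm_eq_two_mul_ellipticOne (ha : 0 < a) (hac : a < c) :
    ∫ s in (-a)..a, 1 / √((c ^ 2 - s ^ 2) * (a ^ 2 - s ^ 2)) = 2 * ellipticOne c a := by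
  have hI : IntervalIntegrable (fun s => 1 / √((c ^ 2 - s ^ 2) * (a ^ 2 - s ^ 2))) volume 0 a := by
    rw [intervalIntegrable_iff_integrableOn_Ioo_of_le ha.le]
    exact integrableOn_ellipticOne ha hac
  have hI' : IntervalIntegrable (fun s => 1 / √((c ^ 2 - s ^ 2) * (a ^ 2 - s ^ 2))) volume (-a) 0 := by
    have := (IntervalIntegrable.iff_comp_neg (f := fun s => 1 / √((c ^ 2 - s ^ 2) * (a ^ 2 - s ^ 2)))).1 hI.symm
    simpa using this
  have h1 : ∫ s in (0 : ℝ)..a, 1 / √((c ^ 2 - s ^ 2) * (a ^ 2 - s ^ 2)) = ellipticOne c a := by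
    rw [intervalIntegral.integral_of_le ha.le, integral_Ioc_eq_integral_Ioo, ellipticOne]
  have h2 := intervalIntegral.integral_comp_neg (a := 0) (b := a)
    (fun s => 1 / √((c ^ 2 - s ^ 2) * (a ^ 2 - s ^ 2)))
  simp only [neg_sq, neg_zero] at h2
  rw [← intervalIntegral.integral_add_adjacent_intervals hI' hI, ← h2, h1]
  ring

lemma Gam_eq (ha : 0 < a) (hac : a < c) : Gam c a = I / (4 * ellipticOne c a) := by
  have h : ∫ s in a..(-a), I / w c a (I * s) = -(I * (2 * ellipticOne c a : ℝ)) := by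
    rw [intervalIntegral.integral_symm, ← integral_symm_eq_two_mul_ellipticOne ha hac,
      ← intervalIntegral.integral_ofReal, ← intervalIntegral.integral_const_mul]
    congr 1
    refine intervalIntegral.integral_congr fun s hs => ?_
    rw [uIcc_of_le (by linarith)] at hs
    rw [w_I_mul_of_abs_le ha hac (abs_le.2 hs)]
    push_cast
    ring
  have hK : (ellipticOne c a : ℂ) ≠ 0 := by exact_mod_cast (ellipticOne_pos ha hac).ne'
  rw [Gam, h]
  push_cast
  rw [inv_eq_iff_eq_inv, inv_div]
  field_simp
  linear_combination (-4 : ℂ) * I_sq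

lemma tau_eq (ha : 0 < a) (hac : a < c) :
    tau c a = I * ((ellipticTwo c a / (2 * ellipticOne c a) : ℝ) : ℂ) := by
  have hK : (ellipticOne c a : ℂ) ≠ 0 := by exact_mod_cast (ellipticOne_pos ha hac).ne'
  have h : ∫ s in a..c, Gam c a * I / wPlus c a s = Gam c a * (ellipticTwo c a : ℂ) := by
    rw [ellipticTwo, ← integral_Ioc_eq_integral_Ioo, ← intervalIntegral.integral_of_le hac.le,
      ← intervalIntegral.integral_ofReal, ← intervalIntegral.integral_const_mul]
    refine intervalIntegral.integral_congr fun s hs => ?_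
    simp only [wPlus]
    rw [mul_comm I (_ : ℂ), mul_div_mul_right _ _ I_ne_zero]
    push_cast
    ring
  rw [tau, h, Gam_eq ha hac]
  push_cast
  field_simp
  norm_num

/-- The value of the Abel map at infinity. It explains the shift by `1/4`: `A - 1/4` vanishes at
infinity and is odd in `k`. -/
lemma abel_infinity (ha : 0 < a) (hac : a < c) :
    ∫ s in Ioi c, Gam c a * I / w c a (I * s) = 1 / 4 := by
  have hK : (ellipticOne c a : ℂ) ≠ 0 := by exact_mod_cast (ellipticOne_pos ha hac).ne'
  have h : ∀ s ∈ Ioi c, Gam c a * I / w c a (I * s) = (1 / (4 * ellipticOne c a) : ℂ) *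
      ((1 / √((s ^ 2 - c ^ 2) * (s ^ 2 - a ^ 2)) : ℝ) : ℂ) := by
    intro s hs
    rw [w_I_mul_of_lt ha hac hs, Gam_eq ha hac]
    push_cast
    rw [div_neg, div_mul_eq_mul_div, I_mul_I, neg_div, neg_div, neg_neg]
    ring
  rw [setIntegral_congr_fun measurableSet_Ioi h, integral_const_mul, integral_complex_ofReal,
    setIntegral_Ioi_eq_ellipticOne ha hac]
  field_simp

/-- The integrand of the Abel map along the ray through `k`. -/
noncomputable def rayField (c a : ℝ) (k : ℂ) (ρ : ℝ) : ℂ :=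
  Gam c a * k / ((k ^ 2 + (c : ℂ) ^ 2 * ρ ^ 2) * rayRoot c a k ρ)

/-- The inversion `r = 1/ρ` puts infinity at `ρ = 0` and makes the integral proper, with an
integrand that is continuous off the cut. -/
lemma abel_eq (ha : 0 < a) (hac : a < c) (k : ℂ) :
    abel c a k = 1 / 4 - ∫ ρ in (0 : ℝ)..1, rayField c a k ρ := by
  have himg : (fun x : ℝ => x⁻¹) '' Ioo 0 1 = Ioi 1 := by
    ext y
    simp only [mem_image, mem_Ioo, mem_Ioi]
    constructor
    · rintro ⟨x, ⟨h0, h1⟩, rfl⟩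
      exact (one_lt_inv₀ h0).2 h1
    · intro hy
      exact ⟨y⁻¹, ⟨by positivity, inv_lt_one_of_one_lt₀ hy⟩, inv_inv y⟩
  rw [abel, abel_infinity ha hac, ← himg, integral_image_eq_integral_abs_deriv_smul
    (f' := fun x => -(x ^ 2)⁻¹) measurableSet_Ioo
    (fun x hx => (hasDerivAt_inv hx.1.ne').hasDerivWithinAt) (inv_injective.injOn),
    intervalIntegral.integral_of_le zero_le_one, integral_Ioc_eq_integral_Ioo]
  congr 1
  refine setIntegral_congr_fun measurableSet_Ioo fun x hx => ?_
  have hx0 : (x : ℂ) ≠ 0 := by exact_mod_cast hx.1.ne'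
  rw [w_div hx.1.ne', abs_neg, abs_of_nonneg (by positivity), real_smul, rayField]
  push_cast
  rw [div_div_eq_mul_div, ← mul_div_assoc]
  congr 1
  field_simp

lemma rayField_neg (c a : ℝ) (k : ℂ) (ρ : ℝ) : rayField c a (-k) ρ = -rayField c a k ρ := by
  rw [rayField, rayField, rayRoot, rayRoot, neg_sq]
  ring

lemma abel_neg (ha : 0 < a) (hac : a < c) (k : ℂ) :
    abel c a (-k) - 1 / 4 = -(abel c a k - 1 / 4) := by
  rw [abel_eq ha hac, abel_eq ha hac]
  simp only [rayField_neg, intervalIntegral.integral_neg]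
  ring

/-! ### Inversion of the Abel map along rays and the determinant -/

/-- By `hab` the denominators are `bB0(R ± 1)`, while `(g ± g⁻¹)² = (R ± 1)²/R`. After cancellation
the dependence on `R` disappears from the difference. -/
lemma det_algebra {g A B A0 B0 a b R : ℂ} (hg : g ≠ 0) (hA0 : A0 ≠ 0) (hB0 : B0 ≠ 0) (hb : b ≠ 0)
    (hgR : g ^ 2 = R) (hR : R ^ 2 ≠ 1) (hab : a * A0 = R * (b * B0)) :
    (g + g⁻¹) ^ 2 * ((a * A + b * B) / (a * A0 + b * B0)) -
      (g - g⁻¹) ^ 2 * ((a * A - b * B) / (a * A0 - b * B0)) = 2 * (A / A0 + B / B0) := by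
  have h1 : R + 1 ≠ 0 := fun h => hR (by linear_combination (R - 1) * h)
  have h2 : R - 1 ≠ 0 := fun h => hR (by linear_combination (R + 1) * h)
  have ha : a = R * (b * B0) / A0 := by rw [← hab, mul_div_cancel_right₀ _ hA0]
  have e1 : a * A0 + b * B0 = b * B0 * (R + 1) := by rw [hab]; ring
  have e2 : a * A0 - b * B0 = b * B0 * (R - 1) := by rw [hab]; ring
  have hR0 : R ≠ 0 := hgR ▸ pow_ne_zero 2 hg
  have g1 : (g + g⁻¹) ^ 2 = (R + 1) ^ 2 / R := by rw [← hgR]; field_simp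
  have g2 : (g - g⁻¹) ^ 2 = (R - 1) ^ 2 / R := by rw [← hgR]; field_simp
  rw [e1, e2, g1, g2, ha]
  field_simp
  ring

/-- The addition formula at `(x + τ/2, 0)`. It recognizes the remaining combination of
doubled-period thetas in the determinant as a square. -/
lemma thetaTwo_sq_eq (x : ℂ) {τ : ℂ} (hτ : 0 < τ.im) :
    thetaTwo x τ ^ 2 = thetaTwo (2 * x) (2 * τ) * jacobiTheta₂ 0 (2 * τ) +
      jacobiTheta₂ (2 * x) (2 * τ) * thetaTwo 0 (2 * τ) := by
  have h := jacobiTheta₂_add_mul_sub (x + τ / 2) 0 hτ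
  rw [add_zero, sub_zero, mul_zero, jacobiTheta₂_add_half_period,
    show 2 * (x + τ / 2) = 2 * x + 2 * τ / 2 by ring, jacobiTheta₂_add_half_period,
    thetaTwo_add_half_period] at h
  have e : cexp (-(Real.pi * I * (2 * τ / 4 + 2 * x))) = cexp (-(Real.pi * I * (τ / 4 + x))) ^ 2 := by
    rw [← Complex.exp_nat_mul]
    congr 1
    push_cast
    ring
  rw [e] at h
  refine mul_left_cancel₀ (pow_ne_zero 2 (Complex.exp_ne_zero (-(Real.pi * I * (τ / 4 + x))))) ?_
  linear_combination h

section Inversion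

variable (ha : 0 < a) (hac : a < c) (hk : k ∉ segment ℝ (-(I * (c : ℂ))) (I * c))
include ha hac hk

lemma rayRoot_ne_zero {ρ : ℝ} (hρ : ρ ∈ Icc (0 : ℝ) 1) : rayRoot c a k ρ ≠ 0 := fun h => by
  have h1 := rayRoot_sq c a k ρ
  rw [h, zero_pow two_ne_zero] at h1
  exact slitPlane_ne_zero (ratio_mem_slitPlane (ha.trans hac) ha hac hk hρ) h1.symm

lemma hasDerivAt_rayRoot {ρ : ℝ} (hρ : ρ ∈ Icc (0 : ℝ) 1) :
    HasDerivAt (rayRoot c a k) (-(ρ * k ^ 2 * (c ^ 2 - a ^ 2)) /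
      (rayRoot c a k ρ * (k ^ 2 + (c : ℂ) ^ 2 * ρ ^ 2) ^ 2)) ρ := by
  have hc := ha.trans hac
  have hq := sq_add_ne_zero_of_off_cut hc hk hρ
  have hs := ratio_mem_slitPlane hc ha hac hk hρ
  have hY := rayRoot_ne_zero ha hac hk hρ
  have hlin : ∀ d : ℂ, HasDerivAt (fun ρ : ℝ => k ^ 2 + d ^ 2 * (ρ : ℂ) ^ 2) (d ^ 2 * (2 * ρ)) ρ := by
    intro d
    have := ((((hasDerivAt_id ρ).ofReal_comp).pow 2).const_mul (d ^ 2)).const_add (k ^ 2)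
    refine this.congr_deriv ?_
    simp
  have hd := (hlin a).div (hlin c) hq
  have hp := HasDerivAt.comp_of_eq ρ (Complex.hasStrictDerivAt_cpow_const (c := 1 / 2) hs).hasDerivAt hd rfl
  refine hp.congr_deriv ?_
  have hsq := rayRoot_sq c a k ρ
  have hz := slitPlane_ne_zero hs
  rw [Complex.cpow_sub _ _ hz, Complex.cpow_one]
  change 1 / 2 * (rayRoot c a k ρ / _) * _ = _
  rw [← hsq]
  rw [eq_div_iff hq] at hsq
  generalize rayRoot c a k ρ = Y at *
  field_simp
  ring

lemma continuousOn_rayField : ContinuousOn (rayField c a k) (Icc 0 1) := by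
  have hc := ha.trans hac
  refine ContinuousOn.div continuousOn_const (ContinuousOn.mul (by fun_prop) fun ρ hρ =>
    (hasDerivAt_rayRoot ha hac hk hρ).continuousAt.continuousWithinAt) fun ρ hρ => ?_
  exact mul_ne_zero (sq_add_ne_zero_of_off_cut hc hk hρ) (rayRoot_ne_zero ha hac hk hρ)

/-- Inversion of the Abel map: `θ₃/θ₂` at `2(A(k) - 1/4)` is an algebraic function of `k`. -/
lemma theta_inversion {s : ℝ} (hs : s = ellipticTwo c a / ellipticOne c a) :
    jacobiTheta₂ (2 * (abel c a k - 1 / 4)) (I * s) * thetaRatio s =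
      rayRoot c a k 1 * thetaTwo (2 * (abel c a k - 1 / 4)) (I * s) ∧
    thetaTwo (2 * (abel c a k - 1 / 4)) (I * s) ≠ 0 := by
  have hc := ha.trans hac
  have hk0 := ne_zero_of_off_cut hc hk
  have hK := ellipticOne_pos ha hac
  have hs0 : 0 < s := hs ▸ div_pos (ellipticTwo_pos ha hac) hK
  have hT := im_I_mul_pos hs0
  obtain ⟨hsq, hW⟩ := thetaRatio_sq_and_wronskian ha hac hs
  have he0 := thetaRatio_pos hs0
  set e := thetaRatio s with he
  have he0' : (e : ℂ) ≠ 0 := by exact_mod_cast he0.ne'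
  have hac' : (a : ℂ) ≠ 0 := by exact_mod_cast ha.ne'
  have hcc' : (c : ℂ) ≠ 0 := by exact_mod_cast hc.ne'
  have hKc : (ellipticOne c a : ℂ) ≠ 0 := by exact_mod_cast hK.ne'
  have hsqc : (e : ℂ) ^ 2 * c = a := by
    have : e ^ 2 * c = a := by rw [hsq]; field_simp
    exact_mod_cast this
  have hhalf : jacobiTheta₂ (1 / 2) (I * s) ≠ 0 := by
    have h1 := ofReal_thetaThreeRe s (1 / 2)
    push_cast at h1
    rw [← h1]
    exact_mod_cast (thetaThreeRe_pos hs0 _).ne'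
  set q : ℂ := ((4 * (a * c) * ellipticOne c a ^ 2 : ℝ) : ℂ) with hq
  have hq0 : q ≠ 0 := by rw [hq]; exact_mod_cast (by positivity : (4 * (a * c) * ellipticOne c a ^ 2) ≠ 0)
  have hΩ' := deriv_thetaWronskian hT hq0 hhalf hW
  have hda := differentiable_jacobiTheta₂ hT
  have hdb := differentiable_thetaTwo hT
  have hdΩ := differentiable_thetaWronskian hT
  have h00 : jacobiTheta₂ 0 (I * s / 2) ≠ 0 := by
    have h1 := ofReal_thetaThreeRe (s / 2) 0
    push_cast at h1
    rw [mul_div_assoc, ← h1]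
    exact_mod_cast (thetaThreeRe_pos (by positivity : 0 < s / 2) _).ne'
  set h : ℝ → ℂ := rayField c a k with hh
  -- The constant extension beyond `[0, 1]` gives the primitive two-sided derivatives at the
  -- endpoints as well.
  have hcont : Continuous (IccExtend zero_le_one ((Icc (0 : ℝ) 1).domRestrict h)) :=
    (continuousOn_iff_continuous_domRestrict.1 (continuousOn_rayField ha hac hk)).Icc_extend'
  set hx := IccExtend zero_le_one ((Icc (0 : ℝ) 1).domRestrict h) with hhx
  have hxeq : ∀ ρ ∈ Icc (0 : ℝ) 1, hx ρ = h ρ := fun ρ hρ => IccExtend_of_mem _ _ hρ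
  have hV : ∀ ρ ∈ Icc (0 : ℝ) 1, HasDerivAt (fun ρ => -2 * ∫ x in (0 : ℝ)..ρ, hx x) (-2 * h ρ) ρ := by
    intro ρ hρ
    rw [← hxeq ρ hρ]
    exact (intervalIntegral.integral_hasDerivAt_right (hcont.intervalIntegrable _ _)
      (hcont.stronglyMeasurableAtFilter _ _) hcont.continuousAt).const_mul _
  have hA0 := ofReal_thetaThreeRe s 0
  have hB0 := ofReal_thetaTwoRe s 0
  push_cast at hA0 hB0
  -- The path is `2(A - 1/4)` along the ray, starting at `0` for `k = ∞`, and `Y` is the derivative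
  -- of `X` with respect to it. At the start the theta quotient has zero derivative, a branch point
  -- where the first-order equation loses uniqueness; hence the second-order one.
  have key := eq_mul_of_ode (a := fun z => jacobiTheta₂ z (I * s)) (b := fun z => thetaTwo z (I * s))
    (Ω := thetaWronskian (I * s)) (q := q) (n := a / c + 1 / (a / c : ℂ)) hdb hda hdΩ
    (fun z hz => thetaTwo_ne_zero_of_jacobiTheta₂_eq_zero hT h00 hz) ?_ ?_ hV
    (continuousOn_const.mul (continuousOn_rayField ha hac hk))
    (X := fun ρ => rayRoot c a k ρ / e)
    (Y := fun ρ => ρ * k * (c ^ 2 - a ^ 2) / (2 * Gam c a * e * (k ^ 2 + (c : ℂ) ^ 2 * ρ ^ 2))) ?_ ?_ ?_ ?_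
    1 ⟨zero_le_one, le_rfl⟩
  · have hu : (-2 : ℂ) * ∫ x in (0 : ℝ)..1, hx x = 2 * (abel c a k - 1 / 4) := by
      rw [abel_eq ha hac, intervalIntegral.integral_congr (g := h)]
      · ring
      · intro x hx'
        rw [uIcc_of_le zero_le_one] at hx'
        exact hxeq x hx'
    rw [hu] at key
    refine ⟨?_, key.2⟩
    rw [key.1]
    field_simp
  · intro z hz
    refine ((hda z).hasDerivAt.div (hdb z).hasDerivAt hz).congr_deriv ?_
    rfl
  · intro z hz
    have := (hdΩ z).hasDerivAt.div ((hdb z).hasDerivAt.pow 2) (pow_ne_zero 2 hz)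
    refine this.congr_deriv ?_
    have h1 := hΩ' z
    simp only [Pi.pow_apply, Nat.cast_ofNat, Nat.add_one_sub_one, pow_one]
    generalize deriv (thetaWronskian (I * s)) z = W' at *
    generalize thetaWronskian (I * s) z = W at *
    generalize deriv (fun z => thetaTwo z (I * s)) z = B' at *
    generalize jacobiTheta₂ z (I * s) = A at *
    generalize thetaTwo z (I * s) = B at *
    generalize (a / c + 1 / (a / c : ℂ)) = n at *
    field_simp
    linear_combination h1
  · intro ρ hρ
    refine ((hasDerivAt_rayRoot ha hac hk hρ).div_const _).congr_deriv ?_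
    have hq' := sq_add_ne_zero_of_off_cut hc hk hρ
    have hY' := rayRoot_ne_zero ha hac hk hρ
    rw [hh, rayField, Gam_eq ha hac]
    generalize rayRoot c a k ρ = Y at *
    field_simp
  · intro ρ hρ
    have hq' := sq_add_ne_zero_of_off_cut hc hk hρ
    have hY' := rayRoot_ne_zero ha hac hk hρ
    have hsq' := rayRoot_sq c a k ρ
    have hG : Gam c a ≠ 0 := by
      rw [Gam_eq ha hac]; exact div_ne_zero I_ne_zero (mul_ne_zero (by norm_num) hKc)
    have hlin : HasDerivAt (fun ρ : ℝ => k ^ 2 + (c : ℂ) ^ 2 * (ρ : ℂ) ^ 2) (c ^ 2 * (2 * ρ)) ρ := by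
      have := ((((hasDerivAt_id ρ).ofReal_comp).pow 2).const_mul ((c : ℂ) ^ 2)).const_add (k ^ 2)
      refine this.congr_deriv ?_
      simp
    have hnum : HasDerivAt (fun ρ : ℝ => (ρ : ℂ) * k * ((c : ℂ) ^ 2 - a ^ 2)) (k * ((c : ℂ) ^ 2 - a ^ 2)) ρ := by
      have := ((((hasDerivAt_id ρ).ofReal_comp).mul_const k)).mul_const ((c : ℂ) ^ 2 - a ^ 2)
      refine this.congr_deriv ?_
      simp
    have hden := hlin.const_mul (2 * Gam c a * e)
    have hq2 : 2 * Gam c a * e * (k ^ 2 + (c : ℂ) ^ 2 * ρ ^ 2) ≠ 0 :=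
      mul_ne_zero (mul_ne_zero (mul_ne_zero two_ne_zero hG) he0') hq'
    refine (hnum.div hden hq2).congr_deriv ?_
    have hqG : q = -(a * c) / (4 * Gam c a ^ 2) := by
      rw [hq, Gam_eq ha hac, div_pow, I_sq]
      push_cast
      field_simp
    rw [eq_div_iff hq'] at hsq'
    rw [hh, rayField, hqG]
    clear_value e q
    clear hqG hΩ' hW
    generalize rayRoot c a k ρ = Y at *
    generalize Gam c a = G at *
    generalize (a : ℂ) = a' at *
    subst hsqc
    field_simp
    linear_combination (-8 : ℂ) * hsq'
  · simp only [intervalIntegral.integral_same, mul_zero]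
    have h1 : rayRoot c a k 0 = 1 := by
      rw [rayRoot]
      simp [hk0]
    rw [h1, ← hA0, ← hB0, he, thetaRatio]
    have h2 : (thetaTwoRe s 0 : ℂ) ≠ 0 := by exact_mod_cast (thetaTwoRe_zero_pos hs0).ne'
    have h3 : (thetaThreeRe s 0 : ℂ) ≠ 0 := by exact_mod_cast (thetaThreeRe_pos hs0 0).ne'
    push_cast
    field_simp
  · simp only [intervalIntegral.integral_same, mul_zero, ofReal_zero, zero_mul, zero_div]
    obtain ⟨c', -, hc'⟩ := exists_real_thetaWronskian_eq hs0
    rw [hc', zero_add, thetaTwo_half]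
    simp

/-- The determinant of the model solution does not depend on `k`. -/
lemma det_Mmod_eq (L : ℝ) {t : ℝ} (ht : t = ellipticTwo c a / (2 * ellipticOne c a)) :
    (Mmod c a L k).det = ((4 * thetaTwoRe t (L / (2 * Real.pi)) ^ 2 / thetaTwoRe t 0 ^ 2 : ℝ) : ℂ) := by
  have hc := ha.trans hac
  have hk0 := ne_zero_of_off_cut hc hk
  have hK := ellipticOne_pos ha hac
  have ht0 : 0 < t := ht ▸ div_pos (ellipticTwo_pos ha hac) (by positivity)
  have hs : 2 * t = ellipticTwo c a / ellipticOne c a := by rw [ht]; field_simp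
  have hs0 : 0 < 2 * t := by positivity
  have hτ := im_I_mul_pos ht0
  obtain ⟨h1, hb⟩ := theta_inversion ha hac hk hs
  obtain ⟨hsq, -⟩ := thetaRatio_sq_and_wronskian ha hac hs
  have hτ2 : I * ((2 * t : ℝ) : ℂ) = 2 * (I * t) := by push_cast; ring
  rw [hτ2] at h1 hb
  have hA0 := ofReal_thetaThreeRe (2 * t) 0
  have hB0 := ofReal_thetaTwoRe (2 * t) 0
  rw [hτ2, ofReal_zero] at hA0 hB0
  have hA0' : jacobiTheta₂ 0 (2 * (I * t)) ≠ 0 := by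
    rw [← hA0]; exact_mod_cast (thetaThreeRe_pos hs0 0).ne'
  have hB0' : thetaTwo 0 (2 * (I * t)) ≠ 0 := by
    rw [← hB0]; exact_mod_cast (thetaTwoRe_zero_pos hs0).ne'
  set u := abel c a k - 1 / 4 with hu
  set l : ℂ := (L : ℂ) / (2 * Real.pi) with hl
  have e1 : abel c a k = u + 1 / 4 := by rw [hu]; ring
  have e2 : abel c a (-k) = -u + 1 / 4 := by rw [hu]; linear_combination abel_neg ha hac k
  have n1 : jacobiTheta₂ (u - l) (I * t) * jacobiTheta₂ (-u - l) (I * t) =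
      jacobiTheta₂ (2 * u) (2 * (I * t)) * jacobiTheta₂ (2 * l) (2 * (I * t)) +
        thetaTwo (2 * u) (2 * (I * t)) * thetaTwo (2 * l) (2 * (I * t)) := by
    rw [← jacobiTheta₂_add_mul_sub _ _ hτ, show -u - l = -(u + l) by ring, jacobiTheta₂_neg_left, mul_comm]
  have n2 : jacobiTheta₂ u (I * t) * jacobiTheta₂ (-u) (I * t) =
      jacobiTheta₂ (2 * u) (2 * (I * t)) * jacobiTheta₂ 0 (2 * (I * t)) +
        thetaTwo (2 * u) (2 * (I * t)) * thetaTwo 0 (2 * (I * t)) := by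
    have := jacobiTheta₂_add_mul_sub u 0 hτ
    rw [add_zero, sub_zero, mul_zero] at this
    rw [jacobiTheta₂_neg_left, this]
  -- The products in `ν` differ from those in `μ` by a shift of `1/2`. Doubled, it becomes a shift
  -- by `1`, which only reverses the sign of the `θ₂` term.
  have n3 : jacobiTheta₂ (-u - 1 / 2 - l) (I * t) * jacobiTheta₂ (u - 1 / 2 - l) (I * t) =
      jacobiTheta₂ (2 * u) (2 * (I * t)) * jacobiTheta₂ (2 * l) (2 * (I * t)) -
        thetaTwo (2 * u) (2 * (I * t)) * thetaTwo (2 * l) (2 * (I * t)) := by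
    have := jacobiTheta₂_add_mul_sub u (1 / 2 + l) hτ
    rw [show 2 * (1 / 2 + l) = 2 * l + 1 by ring, jacobiTheta₂_add_left, thetaTwo_add_one,
      ← jacobiTheta₂_neg_left (u + _)] at this
    rw [show -u - 1 / 2 - l = -(u + (1 / 2 + l)) by ring,
      show u - 1 / 2 - l = u - (1 / 2 + l) by ring, this]
    ring
  have n4 : jacobiTheta₂ (-u - 1 / 2) (I * t) * jacobiTheta₂ (u - 1 / 2) (I * t) =
      jacobiTheta₂ (2 * u) (2 * (I * t)) * jacobiTheta₂ 0 (2 * (I * t)) -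
        thetaTwo (2 * u) (2 * (I * t)) * thetaTwo 0 (2 * (I * t)) := by
    have := jacobiTheta₂_add_mul_sub u (1 / 2) hτ
    rw [show (2 * (1 / 2) : ℂ) = 0 + 1 by norm_num, jacobiTheta₂_add_left, thetaTwo_add_one,
      ← jacobiTheta₂_neg_left (u + _)] at this
    rw [show -u - 1 / 2 = -(u + 1 / 2) by ring, this]
    ring
  have hτc : tau c a = I * t := by rw [tau_eq ha hac, ht]
  have hg2 : gam c a k ^ 2 = rayRoot c a k 1 * (c / a) := by
    have h4 : (((k ^ 2 + (a : ℂ) ^ 2) / (k ^ 2 + (c : ℂ) ^ 2)) ^ (1 / 4 : ℂ)) ^ 2 =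
        rayRoot c a k 1 := by
      rw [← Complex.cpow_nat_mul, rayRoot]
      norm_num
    have h5 : ((√(c / a) : ℝ) : ℂ) ^ 2 = c / a := by
      rw [← ofReal_pow, Real.sq_sqrt (by positivity)]; push_cast; rfl
    rw [gam, mul_pow, h4, h5]
  have hY := rayRoot_ne_zero ha hac hk (ρ := 1) ⟨zero_le_one, le_rfl⟩
  have hac' : (a : ℂ) ≠ 0 := by exact_mod_cast ha.ne'
  have hcc' : (c : ℂ) ≠ 0 := by exact_mod_cast hc.ne'
  have hR0 : rayRoot c a k 1 * (c / a) ≠ 0 := mul_ne_zero hY (div_ne_zero hcc' hac')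
  have hg0 : gam c a k ≠ 0 := fun h0 => hR0 (by rw [← hg2, h0]; simp)
  -- Equality would mean `k²(c² - a²) = 0`, and `0` lies on the cut.
  have hR1 : (rayRoot c a k 1 * (c / a : ℂ)) ^ 2 ≠ 1 := by
    have hq := sq_add_ne_zero_of_off_cut hc hk (ρ := 1) ⟨zero_le_one, le_rfl⟩
    rw [mul_pow, rayRoot_sq]
    intro h0
    simp only [ofReal_one, one_pow, mul_one] at h0 hq
    rw [div_pow] at h0
    field_simp at h0
    have h2 : k ^ 2 * ((c ^ 2 - a ^ 2 : ℝ) : ℂ) = 0 := by push_cast; linear_combination h0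
    have h3 : ((c ^ 2 - a ^ 2 : ℝ) : ℂ) ≠ 0 := by exact_mod_cast (by nlinarith : c ^ 2 - a ^ 2 ≠ 0)
    exact pow_ne_zero 2 hk0 ((mul_eq_zero.1 h2).resolve_right h3)
  -- The inversion formula combined with `θ₂(0)²/θ₃(0)² = a/c` at the doubled period; this produces
  -- the normalizing factor `c/a` of `ϱ²`.
  have hab : jacobiTheta₂ (2 * u) (2 * (I * t)) * jacobiTheta₂ 0 (2 * (I * t)) =
      rayRoot c a k 1 * (c / a) * (thetaTwo (2 * u) (2 * (I * t)) * thetaTwo 0 (2 * (I * t))) := by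
    have hr : (thetaRatio (2 * t) : ℂ) = thetaTwo 0 (2 * (I * t)) / jacobiTheta₂ 0 (2 * (I * t)) := by
      rw [← hA0, ← hB0, thetaRatio]; push_cast; rfl
    have hsqc : (thetaRatio (2 * t) : ℂ) ^ 2 * c = a := by
      have : thetaRatio (2 * t) ^ 2 * c = a := by rw [hsq]; field_simp
      exact_mod_cast this
    rw [hr] at h1 hsqc
    generalize jacobiTheta₂ 0 (2 * (I * t)) = A0 at *
    generalize thetaTwo 0 (2 * (I * t)) = B0 at *
    generalize jacobiTheta₂ (2 * u) (2 * (I * t)) = A at *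
    generalize thetaTwo (2 * u) (2 * (I * t)) = B at *
    have h6 : rayRoot c a k 1 * B * A0 = A * B0 := by
      rw [← h1]; field_simp
    rw [div_pow] at hsqc
    field_simp at hsqc ⊢
    refine mul_right_cancel₀ hA0' ?_
    linear_combination -A * hsqc - (c * B0) * h6
  have hdet : (Mmod c a L k).det = (gam c a k + (gam c a k)⁻¹) ^ 2 * (mu c a L k * mu c a L (-k)) -
      (gam c a k - (gam c a k)⁻¹) ^ 2 * (nu c a L k * nu c a L (-k)) := by
    rw [Mmod, Matrix.det_fin_two_of]
    ring
  have hmu : mu c a L k * mu c a L (-k) =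
      (jacobiTheta₂ (u - l) (I * t) * jacobiTheta₂ (-u - l) (I * t)) /
        (jacobiTheta₂ u (I * t) * jacobiTheta₂ (-u) (I * t)) := by
    rw [mu, mu, e1, e2, hτc, div_mul_div_comm, ← hl, add_sub_cancel_right, add_sub_cancel_right]
  have hnu : nu c a L k * nu c a L (-k) =
      (jacobiTheta₂ (-u - 1 / 2 - l) (I * t) * jacobiTheta₂ (u - 1 / 2 - l) (I * t)) /
        (jacobiTheta₂ (-u - 1 / 2) (I * t) * jacobiTheta₂ (u - 1 / 2) (I * t)) := by
    rw [nu, nu, e1, e2, hτc, div_mul_div_comm, ← hl, show -(u + 1 / 4) - 1 / 4 = -u - 1 / 2 by ring,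
      show -(-u + 1 / 4) - 1 / 4 = u - 1 / 2 by ring]
  rw [hdet, hmu, hnu, n1, n2, n3, n4, det_algebra hg0 hA0' hB0' hb hg2 hR1 hab]
  have hlr : l = ((L / (2 * Real.pi) : ℝ) : ℂ) := by rw [hl]; push_cast; rfl
  push_cast
  rw [ofReal_thetaTwoRe, ofReal_thetaTwoRe, thetaTwo_sq_eq _ hτ, thetaTwo_sq_eq _ hτ, ← hlr, ofReal_zero,
    mul_zero]
  generalize jacobiTheta₂ 0 (2 * (I * t)) = A0 at *
  generalize thetaTwo 0 (2 * (I * t)) = B0 at *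
  generalize jacobiTheta₂ (2 * l) (2 * (I * t)) = A at *
  generalize thetaTwo (2 * l) (2 * (I * t)) = B at *
  field_simp
  ring

end Inversion

/-! ### Periods on the elliptic curve and the phase `B` -/

lemma setIntegral_comp_neg_sq {p q : ℝ} (hp : 0 ≤ p) (hq : 0 < q) (g : ℝ → ℝ) :
    ∫ y in Ioo (-q ^ 2) (-p ^ 2), g y = ∫ s in Ioo p q, 2 * s * g (-s ^ 2) := by
  have himg : (fun s : ℝ => -s ^ 2) '' Ioo p q = Ioo (-q ^ 2) (-p ^ 2) := by
    ext y
    simp only [mem_image, mem_Ioo]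
    constructor
    · rintro ⟨s, ⟨h1, h2⟩, rfl⟩
      constructor <;> nlinarith
    · rintro ⟨h1, h2⟩
      have hy : 0 ≤ -y := by nlinarith [sq_nonneg p]
      refine ⟨√(-y), ⟨Real.lt_sqrt_of_sq_lt (by linarith), ?_⟩, by rw [Real.sq_sqrt hy, neg_neg]⟩
      rw [Real.sqrt_lt' hq]
      linarith
  rw [← himg, integral_image_eq_integral_abs_deriv_smul (f' := fun s => -(2 * s)) measurableSet_Ioo]
  · refine setIntegral_congr_fun measurableSet_Ioo fun s hs => ?_
    have hs0 : 0 < s := hp.trans_lt hs.1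
    simp only [abs_neg, smul_eq_mul]
    rw [abs_of_pos (by positivity)]
  · intro s _
    exact ((hasDerivAt_pow 2 s).neg.congr_deriv (by norm_num)).hasDerivWithinAt
  · intro s hs r hr h
    have hs0 : 0 < s := hp.trans_lt hs.1
    have hr0 : 0 < r := hp.trans_lt hr.1
    simp only [neg_inj] at h
    exact (pow_left_inj₀ hs0.le hr0.le two_ne_zero).1 h

lemma intervalIntegral_gap_eq (ha : 0 < a) {p : ℝ} (hp : 0 ≤ p) (hpa : p ≤ a) (f : ℝ → ℝ) :
    ∫ z in (-a ^ 2)..(-p ^ 2), f z / √(-z * (z + a ^ 2) * (z + c ^ 2)) =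
      2 * ∫ s in Ioo p a, f (-s ^ 2) * (1 / √((c ^ 2 - s ^ 2) * (a ^ 2 - s ^ 2))) := by
  rw [intervalIntegral.integral_of_le (by nlinarith), integral_Ioc_eq_integral_Ioo,
    setIntegral_comp_neg_sq hp ha, ← integral_const_mul]
  refine setIntegral_congr_fun measurableSet_Ioo fun s hs => ?_
  have hs0 : 0 < s := hp.trans_lt hs.1
  rw [show -(-s ^ 2) * (-s ^ 2 + a ^ 2) * (-s ^ 2 + c ^ 2) =
    s ^ 2 * ((c ^ 2 - s ^ 2) * (a ^ 2 - s ^ 2)) by ring, Real.sqrt_mul (sq_nonneg s), Real.sqrt_sq hs0.le]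
  field_simp

lemma gapInt_eq (ha : 0 < a) (f : ℝ → ℝ) :
    gapInt c a f = 2 * ∫ s in Ioo 0 a, f (-s ^ 2) * (1 / √((c ^ 2 - s ^ 2) * (a ^ 2 - s ^ 2))) := by
  have := intervalIntegral_gap_eq (c := c) ha le_rfl ha.le f
  rw [← this, gapInt]
  norm_num

lemma bandInt_eq (ha : 0 < a) (hac : a < c) (f : ℝ → ℝ) :
    bandInt c a f = 2 * ∫ s in Ioo a c, f (-s ^ 2) * (1 / √((c ^ 2 - s ^ 2) * (s ^ 2 - a ^ 2))) := by
  rw [bandInt, intervalIntegral.integral_of_le (by nlinarith), integral_Ioc_eq_integral_Ioo,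
    setIntegral_comp_neg_sq ha.le (ha.trans hac), ← integral_const_mul]
  refine setIntegral_congr_fun measurableSet_Ioo fun s hs => ?_
  have hs0 : 0 < s := ha.trans hs.1
  rw [show -s ^ 2 * (-s ^ 2 + a ^ 2) * (-s ^ 2 + c ^ 2) =
    s ^ 2 * ((c ^ 2 - s ^ 2) * (s ^ 2 - a ^ 2)) by ring, Real.sqrt_mul (sq_nonneg s), Real.sqrt_sq hs0.le]
  field_simp

lemma setIntegral_even_quartic_mul {p q : ℝ} {J : ℝ → ℝ} (hJ : IntegrableOn J (Ioo p q)) (α β γ : ℝ) :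
    ∫ s in Ioo p q, (α * s ^ 4 + β * s ^ 2 + γ) * J s =
      α * (∫ s in Ioo p q, s ^ 4 * J s) + β * (∫ s in Ioo p q, s ^ 2 * J s) +
        γ * ∫ s in Ioo p q, J s := by
  have hi : ∀ n : ℕ, IntegrableOn (fun s => s ^ n * J s) (Ioo p q) := by
    intro n
    rw [← integrableOn_Icc_iff_integrableOn_Ioo] at hJ ⊢
    exact hJ.continuousOn_mul (continuous_pow n).continuousOn isCompact_Icc
  rw [← integral_const_mul, ← integral_const_mul, ← integral_const_mul, ← integral_add, ← integral_add]
  · refine integral_congr_ae (Eventually.of_forall fun s => ?_)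
    simp only
    ring
  · exact ((hi 4).const_mul α).add ((hi 2).const_mul β)
  · exact hJ.const_mul γ
  · exact (hi 4).const_mul α
  · exact (hi 2).const_mul β

lemma gapInt_quadratic (ha : 0 < a) (hac : a < c) (α β γ : ℝ) :
    gapInt c a (fun z => α * z ^ 2 + β * z + γ) =
      2 * (α * (∫ s in Ioo 0 a, s ^ 4 * (1 / √((c ^ 2 - s ^ 2) * (a ^ 2 - s ^ 2)))) -
        β * (∫ s in Ioo 0 a, s ^ 2 * (1 / √((c ^ 2 - s ^ 2) * (a ^ 2 - s ^ 2)))) +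
        γ * ellipticOne c a) := by
  rw [gapInt_eq ha, ellipticOne, sub_eq_add_neg, ← neg_mul,
    ← setIntegral_even_quartic_mul (integrableOn_ellipticOne ha hac) α (-β) γ]
  congr 2
  ext s
  ring

lemma bandInt_quadratic (ha : 0 < a) (hac : a < c) (α β γ : ℝ) :
    bandInt c a (fun z => α * z ^ 2 + β * z + γ) =
      2 * (α * (∫ s in Ioo a c, s ^ 4 * (1 / √((c ^ 2 - s ^ 2) * (s ^ 2 - a ^ 2)))) -
        β * (∫ s in Ioo a c, s ^ 2 * (1 / √((c ^ 2 - s ^ 2) * (s ^ 2 - a ^ 2)))) +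
        γ * ellipticTwo c a) := by
  rw [bandInt_eq ha hac, ellipticTwo, sub_eq_add_neg, ← neg_mul,
    ← setIntegral_even_quartic_mul (integrableOn_ellipticTwo ha hac) α (-β) γ]
  congr 2
  ext s
  ring

lemma gapInt_one (ha : 0 < a) (hac : a < c) : (gapInt c a fun _ => 1) = 2 * ellipticOne c a := by
  simpa using gapInt_quadratic ha hac 0 0 1

/-- The Whitham equation says that a polynomial has vanishing gap integral. -/
lemma WhithamEq.gapInt_eq_zero {ξ : ℝ} (ha : 0 < a) (hac : a < c) (h : WhithamEq c ξ a) :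
    gapInt c a (fun z => 1 * z ^ 2 + (ξ + (a ^ 2 + c ^ 2) / 2) * z +
      a ^ 2 * (ξ + (c ^ 2 - a ^ 2) / 2)) = 0 := by
  rw [WhithamEq, intervalIntegral.integral_of_le ha.le, integral_Ioc_eq_integral_Ioo] at h
  rw [gapInt_eq ha, ← h, h]
  refine mul_eq_zero_of_right _ (Eq.trans ?_ h)
  -- The polynomial factors as `(z + a²)(z + ξ + (c² - a²)/2)`, and at `z = -s²` the first factor
  -- rationalizes the square root.
  refine setIntegral_congr_fun measurableSet_Ioo fun s hs => ?_
  have h1 : 0 < a ^ 2 - s ^ 2 := by nlinarith [hs.1, hs.2]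
  have h2 : 0 < c ^ 2 - s ^ 2 := by nlinarith
  rw [Real.sqrt_div h1.le, Real.sqrt_mul h2.le]
  have h3 := Real.sqrt_pos.2 h1
  have h4 := Real.sqrt_pos.2 h2
  have h5 := Real.sq_sqrt h1.le
  field_simp
  linear_combination (-(ξ + (c ^ 2 - a ^ 2) / 2 - s ^ 2)) * 2 * h5

lemma phaseB_eq_bandInt {ξ : ℝ} (ha : 0 < a) (hac : a < c) :
    phaseB c a ξ = 12 * bandInt c a (fun z => 1 * z ^ 2 + (ξ + (a ^ 2 + c ^ 2) / 2) * z +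
      a ^ 2 * (ξ + (c ^ 2 - a ^ 2) / 2)) := by
  rw [phaseB, intervalIntegral.integral_symm, intervalIntegral.integral_neg, neg_neg,
    intervalIntegral.integral_of_le hac.le, integral_Ioc_eq_integral_Ioo, bandInt_eq ha hac,
    ← integral_const_mul, ← integral_const_mul, ← integral_const_mul, ← integral_const_mul]
  refine setIntegral_congr_fun measurableSet_Ioo fun s hs => ?_
  have h1 : 0 < s ^ 2 - a ^ 2 := by nlinarith [hs.1, hs.2]
  have h2 : 0 < c ^ 2 - s ^ 2 := by nlinarith [hs.1, hs.2]
  rw [Real.sqrt_div h1.le, Real.sqrt_mul h2.le]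
  have h3 := Real.sqrt_pos.2 h1
  have h4 := Real.sqrt_pos.2 h2
  have h5 := Real.sq_sqrt h1.le
  field_simp
  linear_combination (-(ξ + (c ^ 2 - a ^ 2) / 2 - s ^ 2)) * 2 * h5

/-- The phase of the model problem is the phase of the one-gap solution. -/
lemma phaseB_eq {ξ : ℝ} (ha : 0 < a) (hac : a < c) (h : WhithamEq c ξ a) :
    phaseB c a ξ = 12 * ξ * waveV c a - 4 * freqW c a := by
  -- The polynomial of `B/12` is the polynomial of `dΩ₃` plus `ξ` times that of `dΩ₁`, up to the
  -- constant term. Both sides have zero gap integral, so the constant terms agree as well.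
  have h0 := h.gapInt_eq_zero ha hac
  have hK := (ellipticOne_pos ha hac).ne'
  have e1 := gapInt_quadratic ha hac 0 1 0
  have e2 := gapInt_quadratic ha hac 1 ((a ^ 2 + c ^ 2) / 2) 0
  have e3 := fun d => bandInt_quadratic ha hac 0 1 (-d)
  have e4 := fun d => bandInt_quadratic ha hac 1 ((a ^ 2 + c ^ 2) / 2) (-d)
  simp only [zero_mul, one_mul, add_zero, zero_add, ← sub_eq_add_neg] at e1 e2 e3 e4
  rw [phaseB_eq_bandInt ha hac, waveV, freqW, e3, e4, e1, e2, gapInt_one ha hac, bandInt_quadratic ha hac]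
  rw [gapInt_quadratic ha hac] at h0
  generalize (∫ s in Ioo 0 a, s ^ 4 * (1 / √((c ^ 2 - s ^ 2) * (a ^ 2 - s ^ 2)))) = G2 at *
  generalize (∫ s in Ioo 0 a, s ^ 2 * (1 / √((c ^ 2 - s ^ 2) * (a ^ 2 - s ^ 2)))) = G1 at *
  generalize ellipticOne c a = G0 at *
  generalize ellipticTwo c a = B0 at *
  field_simp
  linear_combination 12 * B0 * h0

/-! ### The function `a(ξ)` -/

/-- The left-hand side of the Whitham equation, divided by `a²`. -/
noncomputable def whithamFun (c ξ a : ℝ) : ℝ :=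
  ∫ σ in (0 : ℝ)..1, (ξ + (c ^ 2 - a ^ 2) / 2 - a ^ 2 * σ ^ 2) * √((1 - σ ^ 2) / (c ^ 2 - a ^ 2 * σ ^ 2))

/-- The substitution `s = aσ` fixes the interval of integration, and the quotient extends
continuously to both ends `a = 0` and `a = c`. -/
lemma whithamEq_iff {a ξ : ℝ} (ha : 0 < a) : WhithamEq c ξ a ↔ whithamFun c ξ a = 0 := by
  have h := intervalIntegral.mul_integral_comp_mul_left (a := 0) (b := 1)
    (f := fun s => (ξ + (c ^ 2 - a ^ 2) / 2 - s ^ 2) * √((a ^ 2 - s ^ 2) / (c ^ 2 - s ^ 2))) a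
  rw [mul_zero, mul_one] at h
  have e : ∫ σ in (0 : ℝ)..1, (ξ + (c ^ 2 - a ^ 2) / 2 - (a * σ) ^ 2) *
      √((a ^ 2 - (a * σ) ^ 2) / (c ^ 2 - (a * σ) ^ 2)) = a * whithamFun c ξ a := by
    rw [whithamFun, ← intervalIntegral.integral_const_mul]
    refine intervalIntegral.integral_congr fun σ _ => ?_
    rw [show (a ^ 2 - (a * σ) ^ 2) / (c ^ 2 - (a * σ) ^ 2) =
      a ^ 2 * ((1 - σ ^ 2) / (c ^ 2 - a ^ 2 * σ ^ 2)) by ring, Real.sqrt_mul (sq_nonneg a), Real.sqrt_sq ha.le]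
    ring
  rw [WhithamEq, ← h, e]
  simp [ha.ne']

/-- From `c² - a²σ² ≥ c²(1 - σ²)`. The bound is uniform up to `a = c`, as dominated convergence
requires. -/
lemma sqrt_ratio_le (hc : 0 < c) {a σ : ℝ} (ha : a ∈ Icc 0 c) (hσ : σ ∈ Icc (0 : ℝ) 1) :
    √((1 - σ ^ 2) / (c ^ 2 - a ^ 2 * σ ^ 2)) ≤ 1 / c := by
  have h1 : 0 ≤ 1 - σ ^ 2 := by nlinarith [hσ.1, hσ.2]
  have h2 : c ^ 2 * (1 - σ ^ 2) ≤ c ^ 2 - a ^ 2 * σ ^ 2 := by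
    have : a ^ 2 ≤ c ^ 2 := pow_le_pow_left₀ ha.1 ha.2 2
    nlinarith [sq_nonneg σ]
  rw [Real.sqrt_le_left (by positivity), div_pow, one_pow]
  rcases h1.eq_or_lt with h | h
  · rw [← h, zero_div]; positivity
  · rw [div_le_div_iff₀ (lt_of_lt_of_le (by positivity) h2) (by positivity)]
    linarith

lemma continuousOn_whithamFun (hc : 0 < c) (ξ : ℝ) : ContinuousOn (whithamFun c ξ) (Icc 0 c) := by
  intro a₀ ha₀
  refine intervalIntegral.continuousWithinAt_of_dominated_interval
    (bound := fun _ => (|ξ| + 3 * c ^ 2) * (1 / c)) ?_ ?_ intervalIntegrable_const ?_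
  · refine Eventually.of_forall fun a => Measurable.aestronglyMeasurable ?_
    fun_prop
  · filter_upwards [self_mem_nhdsWithin] with a ha
    refine Eventually.of_forall fun σ hσ => ?_
    rw [uIoc_of_le zero_le_one] at hσ
    rw [norm_mul]
    refine mul_le_mul ?_ ?_ (norm_nonneg _) (by positivity)
    · have h1 : a ^ 2 ≤ c ^ 2 := pow_le_pow_left₀ ha.1 ha.2 2
      have h2 : a ^ 2 * σ ^ 2 ≤ c ^ 2 :=
        (mul_le_of_le_one_right (sq_nonneg a) (pow_le_one₀ hσ.1.le hσ.2)).trans h1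
      have h3 : 0 ≤ a ^ 2 * σ ^ 2 := by positivity
      rw [Real.norm_eq_abs, abs_le]
      constructor <;> linarith [neg_abs_le ξ, le_abs_self ξ, sq_nonneg a]
    · rw [Real.norm_eq_abs, abs_of_nonneg (Real.sqrt_nonneg _)]
      exact sqrt_ratio_le hc ha ⟨hσ.1.le, hσ.2⟩
  · refine Eventually.of_forall fun σ hσ => ?_
    rw [uIoc_of_le zero_le_one] at hσ
    rcases hσ.2.eq_or_lt with h | h
    · subst h
      simp only [one_pow, sub_self, zero_div, Real.sqrt_zero, mul_zero]
      exact continuousWithinAt_const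
    · have h1 : a₀ ^ 2 ≤ c ^ 2 := pow_le_pow_left₀ ha₀.1 ha₀.2 2
      have h2 : c ^ 2 - a₀ ^ 2 * σ ^ 2 ≠ 0 := by
        have h3 : σ ^ 2 < 1 := by nlinarith [hσ.1]
        have : a₀ ^ 2 * σ ^ 2 ≤ c ^ 2 * σ ^ 2 := by gcongr
        have : c ^ 2 * σ ^ 2 < c ^ 2 * 1 := by gcongr
        linarith
      have : ContinuousAt (fun a : ℝ => (1 - σ ^ 2) / (c ^ 2 - a ^ 2 * σ ^ 2)) a₀ :=
        ContinuousAt.div (by fun_prop) (by fun_prop) h2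
      exact (ContinuousAt.mul (by fun_prop) this.sqrt).continuousWithinAt

lemma continuousOn_whithamFun_integrand {a : ℝ} (ha : a ∈ Ico 0 c) (ξ : ℝ) :
    ContinuousOn (fun σ => (ξ + (c ^ 2 - a ^ 2) / 2 - a ^ 2 * σ ^ 2) *
      √((1 - σ ^ 2) / (c ^ 2 - a ^ 2 * σ ^ 2))) (Icc 0 1) := by
  refine ContinuousOn.mul (by fun_prop) (ContinuousOn.sqrt (ContinuousOn.div (by fun_prop)
    (by fun_prop) fun σ hσ => ?_))
  have h1 : a ^ 2 < c ^ 2 := pow_lt_pow_left₀ ha.2 ha.1 two_ne_zero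
  have h2 : a ^ 2 * σ ^ 2 ≤ a ^ 2 := mul_le_of_le_one_right (sq_nonneg a) (pow_le_one₀ hσ.1 hσ.2)
  linarith

lemma whithamFun_mono {a ξ ξ' : ℝ} (ha : a ∈ Ico 0 c) (h : ξ ≤ ξ') :
    whithamFun c ξ a ≤ whithamFun c ξ' a := by
  refine intervalIntegral.integral_mono_on zero_le_one ?_ ?_ fun σ _ => ?_
  · exact (continuousOn_whithamFun_integrand ha ξ).intervalIntegrable_of_Icc zero_le_one
  · exact (continuousOn_whithamFun_integrand ha ξ').intervalIntegrable_of_Icc zero_le_one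
  · gcongr

lemma whithamFun_zero_pos (hc : 0 < c) {ξ : ℝ} (h : -c ^ 2 / 2 < ξ) : 0 < whithamFun c ξ 0 := by
  refine intervalIntegral.intervalIntegral_pos_of_pos_on
    ((continuousOn_whithamFun_integrand ⟨le_rfl, hc⟩ ξ).intervalIntegrable_of_Icc zero_le_one)
    (fun σ hσ => ?_) zero_lt_one
  have h1 : 0 < 1 - σ ^ 2 := by nlinarith [hσ.1, hσ.2]
  refine mul_pos (by nlinarith) (Real.sqrt_pos.2 (div_pos h1 (by simpa using pow_pos hc 2)))

/-- At `a = c` the square root is the constant `1/c`, and the integral is elementary. This is where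
the upper limit `c²/3` of `ξ` comes from. -/
lemma whithamFun_self (hc : 0 < c) (ξ : ℝ) : whithamFun c ξ c = (ξ - c ^ 2 / 3) / c := by
  have h : whithamFun c ξ c = ∫ σ in (0 : ℝ)..1, (ξ / c - c * σ ^ 2) := by
    rw [whithamFun, intervalIntegral.integral_of_le zero_le_one, intervalIntegral.integral_of_le zero_le_one,
      integral_Ioc_eq_integral_Ioo, integral_Ioc_eq_integral_Ioo]
    refine setIntegral_congr_fun measurableSet_Ioo fun σ hσ => ?_
    have h1 : 0 < 1 - σ ^ 2 := by nlinarith [hσ.1, hσ.2]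
    rw [show (1 - σ ^ 2) / (c ^ 2 - c ^ 2 * σ ^ 2) = (1 / c) ^ 2 by field_simp,
      Real.sqrt_sq (by positivity)]
    field_simp
    ring
  rw [h, intervalIntegral.integral_sub (by simp) (by simp)]
  simp
  field_simp
  ring

/-- The function `a(ξ)` exists. -/
lemma whitham_spec {ξ : ℝ} (hc : 0 < c) (h1 : -c ^ 2 / 2 < ξ) (h2 : ξ < c ^ 2 / 3) :
    0 < whitham c ξ ∧ whitham c ξ < c ∧ WhithamEq c ξ (whitham c ξ) := by
  have hex : ∃ a : ℝ, 0 < a ∧ a < c ∧ WhithamEq c ξ a := by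
    have hneg : whithamFun c ξ c < 0 := by
      rw [whithamFun_self hc]
      exact div_neg_of_neg_of_pos (by linarith) hc
    obtain ⟨a, ⟨ha0, hac⟩, ha⟩ := intermediate_value_Ioo' hc.le (continuousOn_whithamFun hc ξ)
      ⟨hneg, whithamFun_zero_pos hc h1⟩
    exact ⟨a, ha0, hac, (whithamEq_iff ha0).2 ha⟩
  exact Classical.epsilon_spec hex

/-- The function `a(ξ)` stays away from `c` for `ξ` away from `c²/3`. -/
lemma exists_whitham_le {ε : ℝ} (hc : 0 < c) (hε : 0 < ε) (hε' : ε < 5 * c ^ 2 / 6) :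
    ∃ c' < c, ∀ ξ : ℝ, -c ^ 2 / 2 < ξ → ξ ≤ c ^ 2 / 3 - ε → whitham c ξ ≤ c' := by
  -- By monotonicity in `ξ`, every `a(ξ)` with `ξ ≤ c²/3 - ε` lies in this compact set. It omits
  -- `c`, where the function is negative, so its maximum is the required `c'`; monotonicity of
  -- `a(ξ)` is not needed.
  have hS : IsCompact (Icc 0 c ∩ whithamFun c (c ^ 2 / 3 - ε) ⁻¹' Ici 0) :=
    isCompact_Icc.of_isClosed_subset ((continuousOn_whithamFun hc _).preimage_isClosed_of_isClosed
      isClosed_Icc isClosed_Ici) inter_subset_left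
  obtain ⟨c', hc', hmax⟩ := hS.exists_isMaxOn
    ⟨0, ⟨le_rfl, hc.le⟩, (whithamFun_zero_pos hc (by linarith)).le⟩ continuousOn_id
  refine ⟨c', lt_of_le_of_ne hc'.1.2 ?_, fun ξ h1 h2 => ?_⟩
  · rintro rfl
    have := hc'.2
    rw [mem_preimage, whithamFun_self hc, mem_Ici, le_div_iff₀ hc] at this
    linarith
  · obtain ⟨ha0, hac, ha⟩ := whitham_spec hc h1 (by linarith)
    refine hmax ⟨⟨ha0.le, hac.le⟩, ?_⟩
    exact ((whithamEq_iff ha0).1 ha).symm.le.trans (whithamFun_mono ⟨ha0.le, hac⟩ h2)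

/-! ### The Dirichlet eigenvalue bounds the determinant -/

/-- The integrand is smallest at `s = 0`, where it equals `1/(ac)`. -/
lemma le_setIntegral_ellipticOne (ha : 0 < a) (hac : a < c) {s₀ : ℝ} (h0 : 0 ≤ s₀) (h1 : s₀ ≤ a) :
    s₀ / (a * c) ≤ ∫ s in Ioo 0 s₀, 1 / √((c ^ 2 - s ^ 2) * (a ^ 2 - s ^ 2)) := by
  have hc := ha.trans hac
  have hI := (integrableOn_ellipticOne ha hac).mono_set (Ioo_subset_Ioo_right h1 : Ioo 0 s₀ ⊆ Ioo 0 a)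
  have h := setIntegral_mono_on (f := fun _ => 1 / (a * c)) (integrableOn_const (by simp)) hI measurableSet_Ioo fun s hs => by
    have h2 : 0 < a ^ 2 - s ^ 2 := by nlinarith [hs.1, hs.2]
    have h3 : 0 < c ^ 2 - s ^ 2 := by nlinarith
    refine one_div_le_one_div_of_le (Real.sqrt_pos.2 (mul_pos h3 h2)) ?_
    rw [Real.sqrt_le_left (by positivity), mul_pow, mul_comm]
    exact mul_le_mul (by nlinarith [sq_nonneg s]) (by nlinarith [sq_nonneg s]) h3.le (sq_nonneg a)
  rw [setIntegral_const] at h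
  simpa [h0, div_eq_mul_inv] using h

lemma gapAbel_eq (ha : 0 < a) (hac : a < c) (p : GapPoint a) :
    gapAbel c a p = -((p.sheet : ℤ) : ℝ) * Real.pi * ((∫ s in Ioo √(-p.proj) a,
      1 / √((c ^ 2 - s ^ 2) * (a ^ 2 - s ^ 2))) / ellipticOne c a) := by
  have hy : 0 ≤ -p.proj := by linarith [p.mem.2]
  have h1 : √(-p.proj) ≤ a := by
    rw [Real.sqrt_le_left ha.le]; linarith [p.mem.1]
  have h2 := intervalIntegral_gap_eq (c := c) ha (Real.sqrt_nonneg _) h1 fun _ => 1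
  rw [Real.sq_sqrt hy, neg_neg] at h2
  rw [gapAbel, h2, gapInt_one ha hac, mul_div_assoc, mul_div_mul_left _ _ two_ne_zero]
  simp only [one_mul]

/-- The distance of the normalized gap integral from `1`. -/
lemma le_one_sub_gap_ratio (ha : 0 < a) (hac : a < c) {s₀ : ℝ} (h0 : 0 ≤ s₀) (h1 : s₀ ≤ a) :
    s₀ / (a * c * ellipticOne c a) ≤
      1 - (∫ s in Ioo s₀ a, 1 / √((c ^ 2 - s ^ 2) * (a ^ 2 - s ^ 2))) / ellipticOne c a := by
  have hK := ellipticOne_pos ha hac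
  have hI : ∀ p q, 0 ≤ p → q ≤ a → p ≤ q → IntervalIntegrable
      (fun s => 1 / √((c ^ 2 - s ^ 2) * (a ^ 2 - s ^ 2))) volume p q := fun p q hp hq hpq => by
    rw [intervalIntegrable_iff_integrableOn_Ioo_of_le hpq]
    exact (integrableOn_ellipticOne ha hac).mono_set (Ioo_subset_Ioo hp hq)
  have hadd := intervalIntegral.integral_add_adjacent_intervals (hI 0 s₀ le_rfl h1 h0)
    (hI s₀ a h0 le_rfl h1)
  simp only [intervalIntegral.integral_of_le h0, intervalIntegral.integral_of_le h1,
    intervalIntegral.integral_of_le ha.le, integral_Ioc_eq_integral_Ioo] at hadd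
  have h2 := le_setIntegral_ellipticOne ha hac h0 h1
  rw [← div_div, div_le_iff₀ hK, sub_mul, div_mul_cancel₀ _ hK.ne', ellipticOne, ← hadd]
  linarith

/-- The sheet `u` and the integer `n` do not affect `|cos|`, and Jordan's inequality gives
`cos(πr/2) = sin(π(1 - r)/2) ≥ 1 - r`. -/
lemma le_abs_cos_of_eq {r y : ℝ} {n : ℤ} {u : ℤˣ} (h0 : 0 ≤ r) (h1 : r ≤ 1)
    (h : Real.pi * y = ((u : ℤ) : ℝ) * (Real.pi * r / 2) + n * Real.pi) :
    1 - r ≤ |Real.cos (Real.pi * y)| := by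
  have h2 : |Real.cos (Real.pi * y)| = |Real.cos (Real.pi * r / 2)| := by
    rw [h, Real.cos_add_int_mul_pi, abs_mul, abs_zpow]
    rcases Int.units_eq_one_or u with rfl | rfl <;> simp
  have h3 := Real.mul_le_sin (x := Real.pi / 2 * (1 - r)) (by have := Real.pi_pos; nlinarith)
    (by have := Real.pi_pos; nlinarith)
  have h4 : 2 / Real.pi * (Real.pi / 2 * (1 - r)) = 1 - r := by field_simp
  rw [h4, show Real.pi / 2 * (1 - r) = Real.pi / 2 - Real.pi * r / 2 by ring, Real.sin_pi_div_two_sub] at h3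
  rw [h2]
  exact h3.trans (le_abs_self _)

lemma mul_ellipticOne_le {m : ℝ} (ha : 0 < a) (hac : a < c) (hm : a / c ≤ m) (hm1 : m < 1) :
    a * c * ellipticOne c a ≤ c * (Real.pi / 2 * (1 / √(1 - m ^ 2))) := by
  have hc := ha.trans hac
  have hm0 : 0 < a / c := by positivity
  have h := (ellipticK_mono hm0.le hm hm1).trans (ellipticK_le (hm0.le.trans hm) hm1)
  have hK := (ellipticK_pos hm0.le (hm.trans_lt hm1)).le
  rw [ellipticOne_eq ha hac, ← mul_assoc, mul_assoc a, mul_inv_cancel₀ hc.ne', mul_one]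
  exact mul_le_mul hac.le h hK hc.le

/-- Keeps `Im τ` away from `0`, as the uniform bound for `θ₂` requires, through `K' ≥ π/2` and the
upper bound for `K`. -/
lemma le_period_ratio {m : ℝ} (ha : 0 < a) (hac : a < c) (hm : a / c ≤ m) (hm1 : m < 1) :
    √(1 - m ^ 2) / 2 ≤ ellipticTwo c a / (2 * ellipticOne c a) := by
  have hc := ha.trans hac
  have hm0 : 0 < a / c := by positivity
  have h := (ellipticK_mono hm0.le hm hm1).trans (ellipticK_le (hm0.le.trans hm) hm1)
  have h' := le_ellipticK' hm0 (hm.trans_lt hm1)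
  have hK := ellipticK_pos hm0.le (hm.trans_lt hm1)
  have hs : 0 < √(1 - m ^ 2) := Real.sqrt_pos.2 (by nlinarith [hm0.trans_le hm])
  rw [ellipticOne_eq ha hac, ellipticTwo_eq ha hac, mul_left_comm, mul_div_mul_left _ _ (inv_pos.2 hc).ne',
    div_le_div_iff₀ two_pos (by positivity)]
  rw [mul_one_div, le_div_iff₀ hs] at h
  linarith

/-- The angle of the theta function in terms of the position of the divisor in the gap. -/
lemma IsDirichletEigenvalue.exists_angle {q : ℝ → ℝ} {x t y : ℝ} (hc : 0 < c) (ht : 0 < t)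
    (h1 : -c ^ 2 / 2 < x / (12 * t)) (h2 : x / (12 * t) < c ^ 2 / 3)
    (h : IsDirichletEigenvalue c q x t (x / (12 * t)) y) :
    ∃ u : ℤˣ, ∃ n : ℤ, -(whitham c (x / (12 * t))) ^ 2 ≤ y ∧ y ≤ 0 ∧
      Real.pi * (Lam c q x t / (2 * Real.pi)) = ((u : ℤ) : ℝ) * (Real.pi *
        ((∫ s in Ioo √(-y) (whitham c (x / (12 * t))),
          1 / √((c ^ 2 - s ^ 2) * (whitham c (x / (12 * t)) ^ 2 - s ^ 2))) /
            ellipticOne c (whitham c (x / (12 * t)))) / 2) + n * Real.pi := by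
  obtain ⟨ha, hac, hW⟩ := whitham_spec hc h1 h2
  have hB := phaseB_eq ha hac hW
  obtain ⟨p₀, p, ⟨n₀, h₀⟩, ⟨n, hn⟩, rfl⟩ := h
  refine ⟨p.sheet, n₀ + n, p.mem.1, p.mem.2, ?_⟩
  have hp := gapAbel_eq ha hac p
  have hx : 12 * (x / (12 * t)) * t = x := by field_simp
  -- Since `tB = Vx - 4Wt`, adding the congruences for `p₀` and for `p` cancels the initial divisor
  -- and leaves `-Λ` modulo `2π`.
  have hL : Lam c q x t = -gapAbel c (whitham c (x / (12 * t))) p + 2 * Real.pi * (n₀ + n) := by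
    rw [Lam, hB]
    linear_combination waveV c (whitham c (x / (12 * t))) * hx + h₀ + hn
  rw [hL, hp]
  push_cast
  field_simp

/-- The determinant is bounded below by the distance of the Dirichlet eigenvalue from `0`. -/
lemma exists_le_norm_det_Mmod {ε : ℝ} (hc : 0 < c) (hε : 0 < ε) (hε' : ε < 5 * c ^ 2 / 6) :
    ∃ K : ℝ, 0 < K ∧ ∀ (q : ℝ → ℝ) (x t y : ℝ) (k : ℂ), 0 < t → -c ^ 2 / 2 < x / (12 * t) →
      x / (12 * t) ≤ c ^ 2 / 3 - ε → IsDirichletEigenvalue c q x t (x / (12 * t)) y →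
      k ∉ segment ℝ (-(I * (c : ℂ))) (I * c) →
      K * -y ≤ ‖(Mmod c (whitham c (x / (12 * t))) (Lam c q x t) k).det‖ := by
  obtain ⟨c', hc'c, hc'⟩ := exists_whitham_le hc hε hε'
  have hc'0 : 0 < c' :=
    (whitham_spec hc (by linarith) (by linarith)).1.trans_le (hc' (c ^ 2 / 3 - ε) (by linarith) le_rfl)
  set m := c' / c with hm
  have hm0 : 0 < m := by positivity
  have hm1 : m < 1 := (div_lt_one hc).2 hc'c
  have hs : 0 < √(1 - m ^ 2) := Real.sqrt_pos.2 (by nlinarith)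
  obtain ⟨κ, hκ, hθ⟩ := exists_le_abs_thetaTwoRe (half_pos hs)
  set D := c * (Real.pi / 2 * (1 / √(1 - m ^ 2))) with hD
  have hD0 : 0 < D := by positivity
  refine ⟨4 * κ ^ 2 / D ^ 2, by positivity, fun q x t y k ht h1 h2 hy hk => ?_⟩
  have h2' : x / (12 * t) < c ^ 2 / 3 := by linarith
  obtain ⟨ha, hac, -⟩ := whitham_spec hc h1 h2'
  obtain ⟨u, n, hy1, hy0, hang⟩ := hy.exists_angle hc ht h1 h2'
  have hac' := hc' _ h1 h2
  generalize whitham c (x / (12 * t)) = a at *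
  have ham : a / c ≤ m := div_le_div_of_nonneg_right hac' hc.le
  have hK := ellipticOne_pos ha hac
  have hsa : √(-y) ≤ a := by rw [Real.sqrt_le_left ha.le]; linarith
  have hdist := le_one_sub_gap_ratio ha hac (Real.sqrt_nonneg _) hsa
  have hr0 : 0 ≤ (∫ s in Ioo √(-y) a, 1 / √((c ^ 2 - s ^ 2) * (a ^ 2 - s ^ 2))) / ellipticOne c a :=
    div_nonneg (setIntegral_nonneg measurableSet_Ioo fun s _ => by positivity) hK.le
  generalize (∫ s in Ioo √(-y) a, 1 / √((c ^ 2 - s ^ 2) * (a ^ 2 - s ^ 2))) / ellipticOne c a = r at *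
  have hd0 : 0 ≤ √(-y) / (a * c * ellipticOne c a) := by positivity
  have hcos := le_abs_cos_of_eq hr0 (by linarith) hang
  have hD1 : √(-y) / D ≤ √(-y) / (a * c * ellipticOne c a) :=
    div_le_div_of_nonneg_left (Real.sqrt_nonneg _) (by positivity) (mul_ellipticOne_le ha hac ham hm1)
  have ht0 := le_period_ratio ha hac ham hm1
  rw [det_Mmod_eq ha hac hk _ rfl, Complex.norm_real, Real.norm_of_nonneg (by positivity)]
  have hT := hθ _ ht0 (Lam c q x t / (2 * Real.pi))
  have hT0 := thetaTwoRe_zero_pos ((half_pos hs).trans_le ht0)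
  generalize ellipticTwo c a / (2 * ellipticOne c a) = s at *
  have h3 : κ * (√(-y) / D) ≤ |thetaTwoRe s (Lam c q x t / (2 * Real.pi))| / thetaTwoRe s 0 := by
    rw [le_div_iff₀ hT0, mul_assoc]
    refine le_trans ?_ hT
    gcongr
    exact hD1.trans (hdist.trans hcos)
  -- Squaring turns the distance `√(-y)` into `-y`, matching the squared theta quotient in the
  -- determinant.
  have h4 := pow_le_pow_left₀ (by positivity) h3 2
  rw [mul_pow, div_pow, Real.sq_sqrt (by linarith), div_pow, sq_abs] at h4
  calc 4 * κ ^ 2 / D ^ 2 * -y = 4 * (κ ^ 2 * (-y / D ^ 2)) := by ring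
    _ ≤ 4 * (thetaTwoRe s (Lam c q x t / (2 * Real.pi)) ^ 2 / thetaTwoRe s 0 ^ 2) := by gcongr
    _ = _ := by ring

end KdVShock

theorem corollary5p2 (c ε : ℝ) (hc : 0 < c) (hε : 0 < ε) (hε' : ε < 5 * c ^ 2 / 12) :
    ∃ C : ℝ, 0 < C ∧
      ∀ γ : ℝ, 0 < γ → γ < 1 / 2 →
      ∀ q : ℝ → ℝ, KdVShock.IsSteplike c q →
      ∀ x t : ℝ, (x, t) ∈ KdVShock.domainD c ε γ q →
      ∀ k : ℂ, k ∉ segment ℝ (-(Complex.I * c)) (Complex.I * c) →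
        C / (KdVShock.whitham c (-c ^ 2 / 2 + ε) ^ 2 * t ^ γ) ≤
          ‖(KdVShock.Mmod c (KdVShock.whitham c (x / (12 * t))) (KdVShock.Lam c q x t) k).det‖ := by
  have hc2 : 0 < c ^ 2 := by positivity
  obtain ⟨K, hK, h⟩ := KdVShock.exists_le_norm_det_Mmod hc hε (by linarith)
  have ha := (KdVShock.whitham_spec (ξ := -c ^ 2 / 2 + ε) hc (by linarith) (by linarith)).1
  -- The factor `a²(-c²/2 + ε)` depends only on `c` and `ε`; it is put into the constant to cancel
  -- the one in the claimed bound.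
  refine ⟨K * KdVShock.whitham c (-c ^ 2 / 2 + ε) ^ 2, by positivity, ?_⟩
  rintro γ - - q - x t ⟨ht, ⟨h1, h2⟩, y, hy, hyt⟩ k hk
  simp only at ht h1 h2 hy hyt
  have hγ : 0 < t ^ γ := Real.rpow_pos_of_pos ht γ
  refine le_trans ?_ (h q x t y k ht (by linarith) h2 hy hk)
  rw [mul_comm K, mul_div_mul_left _ _ (pow_ne_zero 2 ha.ne'), ← mul_one_div]
  gcongr
  linarith
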